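/- Let $N$ be a smooth $6$-manifold with an $SU(3)$-structure $(g_6,\omega,\Omega)$: $g_6$ is a Riemannian metric, $J$ is a $g_6$-orthogonal almost complex structure, $\omega=g_6(J\cdot,\cdot)$, and $\Omega$ is a nowhere vanishing complex $3$-form of type $(3,0)$ with respect to $J$, such that $\Omega\wedge\omega=\bar\Omega\wedge\omega=0$, $\omega^3=6\,\mathrm{vol}_6$ and $\Omega\wedge\bar\Omega=-8i\,\mathrm{vol}_6$. Suppose that for a real constant $\lambda$ $$d\omega=-3\lambda\,\mathrm{Re}\,\Omega,\qquad d\Omega=2\lambda i\,\omega^2,\qquad d(\omega^2)=0,$$ i.e. $N$ is Calabi–Yau ($\lambda=0$) or nearly Kähler ($\lambda\ne0$). Let $L$ be a smooth $1$-manifold with a nowhere vanishing smooth $1$-form $dr$ (locally the differential of a coordinate $r$), and write $f'=df/dr$ for functions on $L$. Let $F:L\to\mathbb C$ be smooth and nowhere zero and $G:L\to\mathbb R$ smooth and positive. On $M=N\times L$ put $$\varphi=\mathrm{Re}(F^3\Omega)+G|F|^2dr\wedge\omega,\qquad \psi=\tfrac12|F|^4\omega^2+\mathrm{Im}(F^3\Omega)\wedge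 G\,dr,$$ $$g_7=G^2dr^2+|F|^2g_6,\qquad \mathrm{vol}_7=G|F|^6\,\mathrm{vol}_6\wedge dr.$$ Then $\varphi$ is a positive $3$-form whose associated metric and volume form, defined by $g(u,v)\,\mathrm{vol}=\frac16(u\lrcorner\varphi)\wedge(v\lrcorner\varphi)\wedge\varphi$, are $g_7$ and $\mathrm{vol}_7$, and $\psi=*\varphi$. Let $\nabla$ be the Levi-Civita connection of $g_7$. The full torsion tensor $T$ of the $G_2$-structure is defined by $\nabla_a\varphi_{bcd}=T_a{}^e\psi_{ebcd}$; $T^\sharp$ denotes the endomorphism $u^a\mapsto u^aT_a{}^e$, so that $T(u,v)=g_7(T^\sharp u,v)$. The torsion components are defined by the decomposition $T=\tau_1g_7+\tau_7\lrcorner\varphi+\tau_{14}+\tau_{27}$, where $\tau_1$ is a function, $\tau_7$ a $1$-form with $\tau_7\lrcorner\varphi=\varphi(\tau_7^\sharp,\cdot,\cdot)$, $\tau_{14}$ a $2$-form with $(\tau_{14})^{ab}\varphi_{abc}=0$, and $\tau_{27}$ a traceless symmetric $2$-tensor, with $\tau_{27}=g_7(\tau_{27}^\sharp\cdot,\cdot)$.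 On every open set $U\subseteq L$ on which $F=he^{i\theta/3}$ with $h,\theta:U\to\mathbb R$ smooth, at every point of $N\times U$ the tensor $T$ and its components exist, are unique, and are given by $$\tau_1=\frac17\Big(\frac{\theta'}{G}-\frac{6\lambda\sin\theta}{h}\Big),\qquad \tau_7=-h^{-1}\Big(\frac{h'}{G}+\lambda\cos\theta\Big)G\,dr,\qquad \tau_{14}=0,$$ $$\tau_{27}^\sharp=\frac17\Big(\frac{\theta'}{G}+\frac{\lambda\sin\theta}{h}\Big)\,\mathrm{diag}(6,-\delta_6),$$ $$T^\sharp=\mathrm{diag}\Big(\frac{\theta'}{G},-\frac{\lambda\sin\theta}{h}\,\delta_6\Big)-h^{-1}\Big(\frac{h'}{G}+\lambda\cos\theta\Big)J_6,$$ where $\mathrm{diag}(a,b\,\delta_6)$ acts by $a$ on $TL$ and by $b$ on $TN$, and $J_6$ acts by $J$ on $TN$ and by $0$ on $TL$. -/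

import Mathlib

open scoped Manifold ContDiff Topology

noncomputable section

namespace G2Warped

/-! ### Multilinear algebra of alternating forms -/

section Algebra

variable {V : Type*}

theorem update_castAdd_castAdd {p q : ℕ} (v : Fin (p + q) → V) (i : Fin p) (z : V) :
    (fun k => Function.update v (Fin.castAdd q i) z (Fin.castAdd q k))
      = Function.update (fun k => v (Fin.castAdd q k)) i z := by
  ext k
  by_cases h : k = i
  · subst h; simp
  · rw [Function.update_of_ne h, Function.update_of_ne]
    exact fun h' => h (Fin.castAdd_injective _ _ h')

theorem update_natAdd_natAdd {p q : ℕ} (v : Fin (p + q) → V) (i : Fin q) (z : V) :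
    (fun k => Function.update v (Fin.natAdd p i) z (Fin.natAdd p k))
      = Function.update (fun k => v (Fin.natAdd p k)) i z := by
  ext k
  by_cases h : k = i
  · subst h; simp
  · rw [Function.update_of_ne h, Function.update_of_ne]
    exact fun h' => h (Fin.natAdd_injective _ _ h')

theorem update_castAdd_natAdd {p q : ℕ} (v : Fin (p + q) → V) (i : Fin p) (z : V) :
    (fun k => Function.update v (Fin.castAdd q i) z (Fin.natAdd p k))
      = fun k => v (Fin.natAdd p k) := by
  ext k
  rw [Function.update_of_ne]
  intro h
  have := congrArg Fin.val h
  simp at this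
  omega

theorem update_natAdd_castAdd {p q : ℕ} (v : Fin (p + q) → V) (i : Fin q) (z : V) :
    (fun k => Function.update v (Fin.natAdd p i) z (Fin.castAdd q k))
      = fun k => v (Fin.castAdd q k) := by
  ext k
  rw [Function.update_of_ne]
  intro h
  have := congrArg Fin.val h
  simp at this
  omega

variable [AddCommGroup V] [Module ℝ V] [TopologicalSpace V]

/-- The (non-alternating) product `α ⊗ β` of two alternating forms. -/
def tensorForm {A : Type*} [NormedCommRing A] [NormedAlgebra ℝ A] {p q : ℕ}
    (α : V [⋀^Fin p]→L[ℝ] A) (β : V [⋀^Fin q]→L[ℝ] A) :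
    ContinuousMultilinearMap ℝ (fun _ : Fin (p + q) => V) A where
  toFun v := α (fun i => v (Fin.castAdd q i)) * β (fun j => v (Fin.natAdd p j))
  map_update_add' := by
    intro inst v i x y
    obtain rfl : inst = instDecidableEqFin (p + q) := Subsingleton.elim _ _
    refine Fin.addCases (fun i => ?_) (fun j => ?_) i
    · rw [update_castAdd_castAdd, update_castAdd_castAdd, update_castAdd_castAdd,
        update_castAdd_natAdd, update_castAdd_natAdd, update_castAdd_natAdd,
        ContinuousAlternatingMap.map_update_add, add_mul]
    · rw [update_natAdd_natAdd, update_natAdd_natAdd, update_natAdd_natAdd,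
        update_natAdd_castAdd, update_natAdd_castAdd, update_natAdd_castAdd,
        ContinuousAlternatingMap.map_update_add, mul_add]
  map_update_smul' := by
    intro inst v i c x
    obtain rfl : inst = instDecidableEqFin (p + q) := Subsingleton.elim _ _
    refine Fin.addCases (fun i => ?_) (fun j => ?_) i
    · rw [update_castAdd_castAdd, update_castAdd_castAdd,
        update_castAdd_natAdd, update_castAdd_natAdd,
        ContinuousAlternatingMap.map_update_smul, smul_mul_assoc]
    · rw [update_natAdd_natAdd, update_natAdd_natAdd,
        update_natAdd_castAdd, update_natAdd_castAdd,
        ContinuousAlternatingMap.map_update_smul, mul_smul_comm]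
  cont := by
    refine Continuous.mul ?_ ?_
    · exact α.cont.comp (by fun_prop)
    · exact β.cont.comp (by fun_prop)

/-- The wedge product, normalised by
`(α ∧ β)(v) = 1/(p! q!) ∑_σ sign σ · α(v_{σ 1}, …, v_{σ p}) · β(v_{σ (p+1)}, …, v_{σ (p+q)})`,
so that `(dx ∧ dy)(∂x, ∂y) = 1`. -/
def wedge {A : Type*} [NormedCommRing A] [NormedAlgebra ℝ A] {p q : ℕ}
    (α : V [⋀^Fin p]→L[ℝ] A) (β : V [⋀^Fin q]→L[ℝ] A) : V [⋀^Fin (p + q)]→L[ℝ] A :=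
  ((p.factorial * q.factorial : ℕ) : ℝ)⁻¹ •
    ContinuousMultilinearMap.alternatization (tensorForm α β)

/-- The contraction `u ⌟ α`, i.e. `(u ⌟ α)(v₁, …, v_k) = α(u, v₁, …, v_k)`. -/
def contract {k : ℕ} (u : V) (α : V [⋀^Fin (k + 1)]→L[ℝ] ℝ) : V [⋀^Fin k]→L[ℝ] ℝ where
  toMultilinearMap := (α.toAlternatingMap.curryLeft u).toMultilinearMap
  cont := α.cont.comp (by
    refine continuous_pi fun i => ?_
    refine Fin.cases ?_ (fun j => ?_) i
    · simpa using continuous_const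
    · simpa using continuous_apply j)
  map_eq_zero_of_eq' := (α.toAlternatingMap.curryLeft u).map_eq_zero_of_eq'

/-- A real form regarded as a complex-valued form. -/
def ofRealForm {k : ℕ} (α : V [⋀^Fin k]→L[ℝ] ℝ) : V [⋀^Fin k]→L[ℝ] ℂ :=
  Complex.ofRealCLM.compContinuousAlternatingMap α

/-- Real part of a complex-valued form. -/
def reForm {k : ℕ} (α : V [⋀^Fin k]→L[ℝ] ℂ) : V [⋀^Fin k]→L[ℝ] ℝ :=
  Complex.reCLM.compContinuousAlternatingMap α

/-- Imaginary part of a complex-valued form. -/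
def imForm {k : ℕ} (α : V [⋀^Fin k]→L[ℝ] ℂ) : V [⋀^Fin k]→L[ℝ] ℝ :=
  Complex.imCLM.compContinuousAlternatingMap α

/-- Complex conjugate of a complex-valued form. -/
def conjForm {k : ℕ} (α : V [⋀^Fin k]→L[ℝ] ℂ) : V [⋀^Fin k]→L[ℝ] ℂ :=
  (Complex.conjCLE : ℂ →L[ℝ] ℂ).compContinuousAlternatingMap α

/-- `e` is an orthonormal frame of the `7`-dimensional space `V` for the bilinear form `g`
(as `V` will be `7`-dimensional and `g` positive definite, `e` is then a basis). -/
def IsOrthonormalFrame (g : V →L[ℝ] V →L[ℝ] ℝ) (e : Fin 7 → V) : Prop :=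
  ∀ i j, g (e i) (e j) = if i = j then 1 else 0

/-- `φ` is a positive `3`-form on the `7`-dimensional space `V`, with associated inner product `g`
and associated volume form `vol`:  `g(u,v) vol = 1/6 (u ⌟ φ) ∧ (v ⌟ φ) ∧ φ`, where `g` is an inner
product and `vol` is a volume form of `g` (it has value `1` on some orthonormal frame). -/
structure IsG2Form (φ : V [⋀^Fin 3]→L[ℝ] ℝ) (g : V →L[ℝ] V →L[ℝ] ℝ)
    (vol : V [⋀^Fin 7]→L[ℝ] ℝ) : Prop where
  symm : ∀ u v, g u v = g v u
  pos : ∀ u, u ≠ 0 → 0 < g u u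
  unit_vol : ∃ e, IsOrthonormalFrame g e ∧ vol e = 1
  metric : ∀ u v, g u v • vol
    = (1 / 6 : ℝ) • wedge (wedge (contract u φ) (contract v φ)) φ

/-- `ψ = ∗φ` for the Hodge star of the inner product `g` and the volume form `vol`:
`ψ_{pqrs} = 1/3! φ_{abc} vol^{abc}_{pqrs}`, the contraction being computed in an orthonormal frame
(the sum does not depend on the frame). -/
def IsHodgeDual (g : V →L[ℝ] V →L[ℝ] ℝ) (vol : V [⋀^Fin 7]→L[ℝ] ℝ)
    (φ : V [⋀^Fin 3]→L[ℝ] ℝ) (ψ : V [⋀^Fin 4]→L[ℝ] ℝ) : Prop :=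
  ∃ e, IsOrthonormalFrame g e ∧ ∀ v : Fin 4 → V,
    ψ v = (1 / 6 : ℝ) * ∑ a, ∑ b, ∑ c,
      φ ![e a, e b, e c] * vol ![e a, e b, e c, v 0, v 1, v 2, v 3]

/-- `β ∈ Λ²₁₄`, i.e. `β ⌟ φ = β^{ab} φ_{abc} = 0`. -/
def MemLambda14 (g : V →L[ℝ] V →L[ℝ] ℝ) (φ : V [⋀^Fin 3]→L[ℝ] ℝ)
    (β : V [⋀^Fin 2]→L[ℝ] ℝ) : Prop :=
  ∀ e, IsOrthonormalFrame g e → ∀ v, ∑ a, ∑ b, β ![e a, e b] * φ ![e a, e b, v] = 0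

/-- `s` is a symmetric bilinear form with vanishing `g`-trace. -/
def IsTracelessSymm (g s : V →L[ℝ] V →L[ℝ] ℝ) : Prop :=
  (∀ u v, s u v = s v u) ∧ ∀ e, IsOrthonormalFrame g e → ∑ a, s (e a) (e a) = 0

/-- The `G₂`-decomposition `T = τ₁ g + τ₇ ⌟ φ + τ₁₄ + τ₂₇` of the bilinear form
`T(u, v) = g(S u, v)`, with `τ₁₄ ∈ Λ²₁₄` and `τ₂₇` symmetric and traceless. The contraction
`τ₇ ⌟ φ` is `φ(X, ·, ·)` for the vector `X` metrically dual to `τ₇`. -/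
def IsTorsionDecomposition (g : V →L[ℝ] V →L[ℝ] ℝ) (φ : V [⋀^Fin 3]→L[ℝ] ℝ) (S : V →L[ℝ] V)
    (τ₁ : ℝ) (τ₇ : V [⋀^Fin 1]→L[ℝ] ℝ) (τ₁₄ : V [⋀^Fin 2]→L[ℝ] ℝ)
    (τ₂₇ : V →L[ℝ] V →L[ℝ] ℝ) : Prop :=
  MemLambda14 g φ τ₁₄ ∧ IsTracelessSymm g τ₂₇ ∧
    ∃ X : V, (∀ v, g X v = τ₇ ![v]) ∧
      ∀ u v, g (S u) v = τ₁ * g u v + φ ![X, u, v] + τ₁₄ ![u, v] + τ₂₇ u v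

end Algebra

/-! ### Differential forms on manifolds -/

section Forms

variable {E H : Type*} [NormedAddCommGroup E] [NormedSpace ℝ E] [TopologicalSpace H]
  {E' H' : Type*} [NormedAddCommGroup E'] [NormedSpace ℝ E'] [TopologicalSpace H']

/-- `A`-valued `k`-forms on the manifold `M` (no regularity). -/
abbrev DForm (I : ModelWithCorners ℝ E H) (M : Type*) [TopologicalSpace M] [ChartedSpace H M]
    (k : ℕ) (A : Type*) [NormedAddCommGroup A] [NormedSpace ℝ A] :=
  ∀ x : M, TangentSpace I x [⋀^Fin k]→L[ℝ] A

variable {I : ModelWithCorners ℝ E H} {M : Type*} [TopologicalSpace M] [ChartedSpace H M]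
  {I' : ModelWithCorners ℝ E' H'} {M' : Type*} [TopologicalSpace M'] [ChartedSpace H' M']
  {k : ℕ} {A : Type*} [NormedAddCommGroup A] [NormedSpace ℝ A]

/-- The expression of a form in the preferred chart at `x₀`: the pullback of the form by the inverse
of the chart. -/
def DForm.inChart (α : DForm I M k A) (x₀ : M) : E → E [⋀^Fin k]→L[ℝ] A := fun y =>
  (α ((extChartAt I x₀).symm y)).compContinuousLinearMap
    (mfderivWithin 𝓘(ℝ, E) I (extChartAt I x₀).symm (Set.range I) y)

/-- A form is smooth if its expressions in charts are smooth. -/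
def DForm.IsSmooth (α : DForm I M k A) : Prop :=
  ∀ x₀ : M, ContDiffOn ℝ ∞ (α.inChart x₀) (extChartAt I x₀).target

/-- The exterior derivative of a form, computed at `x` in the chart at `x`. -/
def DForm.d (α : DForm I M k A) : DForm I M (k + 1) A := fun x =>
  (extDerivWithin (α.inChart x) (Set.range I) (extChartAt I x x)).compContinuousLinearMap
    (mfderiv I 𝓘(ℝ, E) (extChartAt I x) x)

/-- The pullback of a form. -/
def DForm.pullback (f : M → M') (α : DForm I' M' k A) : DForm I M k A := fun x =>
  (α (f x)).compContinuousLinearMap (mfderiv I I' f x)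

/-- Differentiability at `x` of a vector field. -/
def VFDiffAt (I : ModelWithCorners ℝ E H) {M : Type*} [TopologicalSpace M] [ChartedSpace H M]
    [IsManifold I 1 M] (X : ∀ y : M, TangentSpace I y) (x : M) : Prop :=
  MDifferentiableAt I (I.prod 𝓘(ℝ, E)) (fun y => (⟨y, X y⟩ : TangentBundle I M)) x

/-- `cov` is the Levi-Civita connection of `g`: it is torsion free and compatible with `g`.
In Mathlib's convention `cov Y x u` is `∇_u Y` at the point `x`. -/
structure IsLeviCivita [FiniteDimensional ℝ E] [CompleteSpace E] [IsManifold I 1 M]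
    [IsManifold I 2 M]
    (g : ∀ x : M, TangentSpace I x →L[ℝ] TangentSpace I x →L[ℝ] ℝ)
    (cov : CovariantDerivative I E (TangentSpace I : M → Type _)) : Prop where
  torsion_free : ∀ x, cov.torsion x = 0
  metric : ∀ (X Y : ∀ y : M, TangentSpace I y) (x : M), VFDiffAt I X x → VFDiffAt I Y x →
    ∀ u : TangentSpace I x, mvfderiv I (fun y => g y (X y) (Y y)) x u
      = g x (cov X x u) (Y x) + g x (X x) (cov Y x u)

/-- The covariant derivative of a form evaluated on vector fields `A₁, …, A_k`:
`(∇_u α)(A₁, …, A_k) = u(α(A₁, …, A_k)) - ∑ i, α(A₁, …, ∇_u A_i, …, A_k)`. -/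
def covDerivForm [IsManifold I 1 M] (cov : CovariantDerivative I E (TangentSpace I : M → Type _))
    (α : DForm I M k ℝ) (x : M) (u : TangentSpace I x)
    (B : Fin k → ∀ y : M, TangentSpace I y) : ℝ :=
  mvfderiv I (fun y => α y (fun i => B i y)) x u
    - ∑ i, α x (Function.update (fun j => B j x) i (cov (B i) x u))

/-- `S` is the full torsion tensor `T_a{}^e` at `x` of a `G₂`-structure `φ` with dual `4`-form `ψ`
and Levi-Civita connection `cov`, viewed as the endomorphism `u^a ↦ u^a T_a{}^e`:
`∇_a φ_{bcd} = T_a{}^e ψ_{ebcd}`. -/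
def IsFullTorsion [IsManifold I 1 M] (cov : CovariantDerivative I E (TangentSpace I : M → Type _))
    (φ : DForm I M 3 ℝ) (ψ : DForm I M 4 ℝ) (x : M)
    (S : TangentSpace I x →L[ℝ] TangentSpace I x) : Prop :=
  ∀ (u : TangentSpace I x) (B : Fin 3 → ∀ y : M, TangentSpace I y), (∀ i, VFDiffAt I (B i) x) →
    covDerivForm cov φ x u B = ψ x ![S u, B 0 x, B 1 x, B 2 x]

/-- `τ₁, τ₇, τ₁₄, τ₂₇` are the torsion components at `x`: the components in the
`G₂`-decomposition of the full torsion tensor. -/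
def AreTorsionComponents [IsManifold I 1 M]
    (cov : CovariantDerivative I E (TangentSpace I : M → Type _))
    (g : ∀ x : M, TangentSpace I x →L[ℝ] TangentSpace I x →L[ℝ] ℝ)
    (φ : DForm I M 3 ℝ) (ψ : DForm I M 4 ℝ) (x : M)
    (τ₁ : ℝ) (τ₇ : TangentSpace I x [⋀^Fin 1]→L[ℝ] ℝ) (τ₁₄ : TangentSpace I x [⋀^Fin 2]→L[ℝ] ℝ)
    (τ₂₇ : TangentSpace I x →L[ℝ] TangentSpace I x →L[ℝ] ℝ) : Prop :=
  ∃ S : TangentSpace I x →L[ℝ] TangentSpace I x, IsFullTorsion cov φ ψ x S ∧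
    IsTorsionDecomposition (g x) (φ x) S τ₁ τ₇ τ₁₄ τ₂₇

end Forms

/-! ### `SU(3)`-structures on `6`-manifolds -/

/-- An `SU(3)`-structure `(g₆, ω, Ω)` on a `6`-manifold, with its almost complex structure `J`:
`ω = g₆(J ·, ·)` is the Hermitian form, and `Ω` is a nowhere vanishing form of type `(3,0)`. The
volume form `vol₆` is the one determined by `ω³ = 6 vol₆`. -/
structure SU3Structure (N : Type*) [TopologicalSpace N]
    [ChartedSpace (EuclideanSpace ℝ (Fin 6)) N] [IsManifold (𝓡 6) ∞ N] where
  /-- the Riemannian metric -/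
  g : Bundle.ContMDiffRiemannianMetric (𝓡 6) ∞ (EuclideanSpace ℝ (Fin 6))
    (TangentSpace (𝓡 6) : N → Type _)
  /-- the almost complex structure -/
  J : ∀ x : N, TangentSpace (𝓡 6) x →L[ℝ] TangentSpace (𝓡 6) x
  /-- the Hermitian form -/
  omega : DForm (𝓡 6) N 2 ℝ
  /-- the complex volume form -/
  Omega : DForm (𝓡 6) N 3 ℂ
  /-- the volume form -/
  vol : DForm (𝓡 6) N 6 ℝ
  smooth_omega : omega.IsSmooth
  smooth_Omega : Omega.IsSmooth
  J_sq : ∀ x u, J x (J x u) = -u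
  J_isometry : ∀ x u v, g.inner x (J x u) (J x v) = g.inner x u v
  omega_eq : ∀ x u v, omega x ![u, v] = g.inner x (J x u) v
  Omega_type : ∀ x u v w, Omega x ![J x u, v, w] = Complex.I * Omega x ![u, v, w]
  Omega_ne_zero : ∀ x, Omega x ≠ 0
  Omega_wedge_omega : ∀ x, wedge (Omega x) (ofRealForm (omega x)) = 0
  conj_Omega_wedge_omega : ∀ x, wedge (conjForm (Omega x)) (ofRealForm (omega x)) = 0
  omega_cubed : ∀ x, wedge (wedge (omega x) (omega x)) (omega x) = (6 : ℝ) • vol x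
  Omega_wedge_conj : ∀ x, wedge (Omega x) (conjForm (Omega x)) = (-8 * Complex.I) • ofRealForm (vol x)

/-- The equations `dω = -3λ Re Ω`, `dΩ = 2λi ω²`, `d(ω²) = 0`: Calabi–Yau for `λ = 0`, nearly
Kähler (of type `λ`) for `λ ≠ 0`. -/
structure SU3Structure.IsOfType {N : Type*} [TopologicalSpace N]
    [ChartedSpace (EuclideanSpace ℝ (Fin 6)) N] [IsManifold (𝓡 6) ∞ N]
    (σ : SU3Structure N) (lam : ℝ) : Prop where
  d_omega : ∀ x, σ.omega.d x = (-3 * lam) • reForm (σ.Omega x)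
  d_Omega : ∀ x, σ.Omega.d x = (2 * lam * Complex.I) • ofRealForm (wedge (σ.omega x) (σ.omega x))
  d_omega_sq : ∀ x, DForm.d (I := 𝓡 6) (M := N) (k := 4) (fun y => wedge (σ.omega y) (σ.omega y)) x = 0

/-! ### The warped product -/

section Warped

/-- The model of the product `N⁶ × L`. -/
abbrev I7 : ModelWithCorners ℝ (EuclideanSpace ℝ (Fin 6) × ℝ)
    (ModelProd (EuclideanSpace ℝ (Fin 6)) ℝ) := (𝓡 6).prod 𝓘(ℝ, ℝ)

variable {N : Type*} [TopologicalSpace N] [ChartedSpace (EuclideanSpace ℝ (Fin 6)) N]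
  [IsManifold (𝓡 6) ∞ N] {L : Type*} [TopologicalSpace L] [ChartedSpace ℝ L]

/-- The projection `T_{(x,t)}(N × L) → T_x N`. -/
def projN (p : N × L) : TangentSpace I7 p →L[ℝ] TangentSpace (𝓡 6) p.1 :=
  mfderiv I7 (𝓡 6) (Prod.fst : N × L → N) p

/-- The projection `T_{(x,t)}(N × L) → T_t L`. -/
def projL (p : N × L) : TangentSpace I7 p →L[ℝ] TangentSpace 𝓘(ℝ, ℝ) p.2 :=
  mfderiv I7 𝓘(ℝ, ℝ) (Prod.snd : N × L → L) p

/-- The inclusion `T_x N → T_{(x,t)}(N × L)`. -/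
def inclN (p : N × L) : TangentSpace (𝓡 6) p.1 →L[ℝ] TangentSpace I7 p :=
  mfderiv (𝓡 6) I7 (fun y : N => (y, p.2)) p.1

/-- The inclusion `T_t L → T_{(x,t)}(N × L)`. -/
def inclL (p : N × L) : TangentSpace 𝓘(ℝ, ℝ) p.2 →L[ℝ] TangentSpace I7 p :=
  mfderiv 𝓘(ℝ, ℝ) I7 (fun s : L => (p.1, s)) p.2

/-- The endomorphism `diag(a, b δ₆)` of `T(N × L)`: multiplication by `a` on `TL` and by `b` on
`TN`. -/
def diagEnd (p : N × L) (a b : ℝ) : TangentSpace I7 p →L[ℝ] TangentSpace I7 p :=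
  a • (inclL p ∘L projL p) + b • (inclN p ∘L projN p)

/-- The almost complex structure `J₆` of `N`, as an endomorphism of `T(N × L)` vanishing on `TL`. -/
def J6 (σ : SU3Structure N) (p : N × L) : TangentSpace I7 p →L[ℝ] TangentSpace I7 p :=
  inclN p ∘L σ.J p.1 ∘L projN p

/-- The derivative `f' = df/dr` of a function on the `1`-manifold `L`, i.e. the ratio of the
`1`-forms `df` and `dr`. -/
def derivR (dr : DForm 𝓘(ℝ, ℝ) L 1 ℝ) (f : L → ℝ) (t : L) : ℝ :=
  mvfderiv 𝓘(ℝ, ℝ) f t (1 : ℝ) / dr t (fun _ => (1 : ℝ))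

variable (σ : SU3Structure N) (dr : DForm 𝓘(ℝ, ℝ) L 1 ℝ) (F : L → ℂ) (G : L → ℝ)

/-- `dr` as a `1`-form on `N × L`. -/
def drM : DForm I7 (N × L) 1 ℝ := dr.pullback Prod.snd

/-- `ω` as a `2`-form on `N × L`. -/
def omegaM : DForm I7 (N × L) 2 ℝ := σ.omega.pullback Prod.fst

/-- `Ω` as a `3`-form on `N × L`. -/
def OmegaM : DForm I7 (N × L) 3 ℂ := σ.Omega.pullback Prod.fst

/-- `vol₆` as a `6`-form on `N × L`. -/
def volM : DForm I7 (N × L) 6 ℝ := σ.vol.pullback Prod.fst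

/-- `φ = Re(F³ Ω) + G |F|² dr ∧ ω`. -/
def phi : DForm I7 (N × L) 3 ℝ := fun p =>
  reForm (F p.2 ^ 3 • OmegaM σ p)
    + (G p.2 * ‖F p.2‖ ^ 2) • (wedge (drM dr p) (omegaM σ p) :
        TangentSpace I7 p [⋀^Fin (1 + 2)]→L[ℝ] ℝ)

/-- `ψ = 1/2 |F|⁴ ω² + Im(F³ Ω) ∧ G dr`. -/
def psi : DForm I7 (N × L) 4 ℝ := fun p =>
  (1 / 2 * ‖F p.2‖ ^ 4) • (wedge (omegaM σ p) (omegaM σ p) :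
        TangentSpace I7 p [⋀^Fin (2 + 2)]→L[ℝ] ℝ)
    + wedge (imForm (F p.2 ^ 3 • OmegaM σ p)) (G p.2 • drM dr p)

/-- `g₇ = G² dr² + |F|² g₆`. -/
def g7 (p : N × L) : TangentSpace I7 p →L[ℝ] TangentSpace I7 p →L[ℝ] ℝ :=
  let dr' : TangentSpace I7 p →L[ℝ] ℝ :=
    (ContinuousAlternatingMap.ofSubsingleton ℝ (TangentSpace I7 p) ℝ (0 : Fin 1)).symm (drM dr p)
  G p.2 ^ 2 • dr'.smulRight dr'
    + ‖F p.2‖ ^ 2 • (ContinuousLinearMap.precomp ℝ (projN p)) ∘L (σ.g.inner p.1) ∘L (projN p)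

/-- `vol₇ = G |F|⁶ vol₆ ∧ dr`. -/
def vol7 : DForm I7 (N × L) 7 ℝ := fun p =>
  (G p.2 * ‖F p.2‖ ^ 6) • wedge (volM σ p) (drM dr p)

end Warped

end G2Warped

end

/-!
The torsion of the warped `G₂`-structure is computed at one point `p` of `N × L`, in the product of
charts of `N` and `L`.

*Passing to a chart.* At a given point a connection differs from the flat connection of the chart by
its Christoffel tensor `Γ` (`exists_christoffel`). Hence `∇φ` is the derivative of the components of
`φ`, minus the action of `Γ` on `φ` (`covDerivForm_eq`). For the Levi-Civita connection `Γ` is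
symmetric and determines the derivative of the metric (`christoffel_symm`, `christoffel_metric`).

*The base.* An `SU(3)`-structure has unitary coframes `z₀, z₁, z₂` of type `(1,0)` with `Ω = z₀ ∧
z₁ ∧ z₂` (`IsSU3.exists_unitaryFrame`). Differentiating the algebraic identities between `g₆`, `J`,
`ω` and `Ω`, and using that `dω` and `dΩ` are the alternations of `∇ω` and `∇Ω`, one finds a system
of linear equations for `∇ω`, `∇J` and `∇Ω` at a point. The equations `dω = -3λ Re Ω` and `dΩ = 2λi
ω²` make its solution unique: `∇_u ω = -λ Re (u ⌟ Ω)` and `∇_u Ω = λ (u + i Ju)♭ ∧ ω`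
(`nearlyKahler_pointwise`, and on the manifold `SU3Structure.IsOfType.fderiv_inChart`).

*The warped product.* Write `F = h e^{iθ/3}` and `G dr = r ds` for a coordinate `s` of `L`. Then
`g₇ = r² ds² + h² g₆` and `φ = Re(h³ e^{iθ} Ω) + r h² ds ∧ ω`. The Koszul formula gives the
Christoffel tensor of `g₇` in terms of that of `g₆` and of `h'` and `r'` (`warped_christoffel`).
Inserting it and the formulas for `∇ω` and `∇Ω` into `∇φ`, all terms with Christoffel symbols of
`g₆` cancel, and the rest is `∇_u φ = ψ(S u, ·, ·, ·)` for the endomorphism `S` of the theorem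
(`warpedPhi_covariant`, `covDerivForm_phi`).

*`G₂`-algebra.* In the coframe `h Re z_j`, `h Im z_j`, `r ds`, where `z` is a unitary coframe for
`e^{iθ} Ω`, the forms `φ` and `ψ` are the standard ones of `ℂ³ ⊕ ℝ` (`warpedPhi_eq`,
`warpedPsi_eq`). This gives the metric, the volume form and the Hodge dual (`isG2Form_of_frame`,
`isHodgeDual_of_frame`). The torsion endomorphism is unique because `ψ` is nondegenerate
(`eq_zero_of_stdPsi`), and its decomposition is unique because the trace determines `τ₁`, the
contraction with `φ` determines `τ₇`, by `φ_{uab} φ_{abv} = 6 g_{uv}`, and the rest splits into its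
symmetric and skew parts (`IsTorsionDecomposition.unique`). The explicit endomorphism is a
combination of the identity, the projection to `TL` and `J₆`, and `J₆` corresponds to the
contraction of `φ` with the unit vector along `L`, so its components can be read off
(`isTorsionDecomposition_of_frame`).
-/

noncomputable section

namespace G2Warped

/-! ### Connections and forms in a chart -/

section ChartPoint

set_option linter.unusedSectionVars false

open Bundle

variable {E H : Type*} [NormedAddCommGroup E] [NormedSpace ℝ E] [TopologicalSpace H]
  {I : ModelWithCorners ℝ E H} {M : Type*} [TopologicalSpace M] [ChartedSpace H M]

/-- The components of a vector field in the preferred chart at `x`. -/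
def chartRep (I : ModelWithCorners ℝ E H) {M : Type*} [TopologicalSpace M] [ChartedSpace H M]
    (x : M) (B : ∀ y : M, TangentSpace I y) (y : M) : E :=
  mfderiv I 𝓘(ℝ, E) (extChartAt I x) y (B y)

variable [IsManifold I 1 M]

theorem chartRep_self (x : M) (B : ∀ y : M, TangentSpace I y) : chartRep I x B x = B x := by
  simp only [chartRep]
  rw [mfderiv_extChartAt_self]
  rfl

/-- Near `x`, the fibre component in the trivialization of the tangent bundle at `x` is the
component in the chart. -/
theorem chartRep_eventuallyEq (x : M) (B : ∀ y : M, TangentSpace I y) :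
    (fun y => (trivializationAt E (TangentSpace I) x ⟨y, B y⟩).2) =ᶠ[𝓝 x] chartRep I x B := by
  filter_upwards [(chartAt H x).open_source.mem_nhds (mem_chart_source H x)] with y hy
  have hy' : y ∈ (trivializationAt E (TangentSpace I) x).baseSet := by simpa using hy
  have h1 : (trivializationAt E (TangentSpace I) x).continuousLinearMapAt ℝ y (B y)
      = (trivializationAt E (TangentSpace I) x ⟨y, B y⟩).2 := by
    rw [Trivialization.continuousLinearMapAt_apply, Trivialization.coe_linearMapAt_of_mem _ hy']
  exact h1.symm.trans
    (congrArg (fun T : TangentSpace I y →L[ℝ] E => T (B y))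
      (TangentBundle.continuousLinearMapAt_trivializationAt hy))

theorem mdifferentiableAt_chartRep {x : M} {B : ∀ y : M, TangentSpace I y} :
    VFDiffAt I B x ↔ MDifferentiableAt I 𝓘(ℝ, E) (chartRep I x B) x := by
  rw [VFDiffAt, mdifferentiableAt_section]
  exact (chartRep_eventuallyEq x B).mdifferentiableAt_iff

/-- The vector field which near `x` has the constant components `v` in the chart at `x`. -/
def coordField (I : ModelWithCorners ℝ E H) {M : Type*} [TopologicalSpace M] [ChartedSpace H M]
    [IsManifold I 1 M] (x : M) (v : E) (y : M) : TangentSpace I y :=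
  FiberBundle.extend E (E := (TangentSpace I : M → Type _)) (x := x) v y

theorem coordField_self (x : M) (v : E) : coordField I x v x = v :=
  FiberBundle.extend_apply_self _ _

theorem chartRep_coordField_eventuallyEq (x : M) (v : E) :
    chartRep I x (coordField I x v) =ᶠ[𝓝 x] fun _ => v := by
  have h0 : chartRep I x (coordField I x v) x = v := by
    rw [chartRep_self, coordField_self]
  refine (chartRep_eventuallyEq x _).symm.trans ?_
  have h1 : (trivializationAt E (TangentSpace I) x ⟨x, v⟩).2 = v := by
    have h2 := (chartRep_eventuallyEq x (coordField I x v)).self_of_nhds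
    rw [h0] at h2
    exact (congrArg (fun w : TangentSpace I x =>
      (trivializationAt E (TangentSpace I) x ⟨x, w⟩).2) (coordField_self x v)).symm.trans h2
  filter_upwards [(chartAt H x).open_source.mem_nhds (mem_chart_source H x)] with y hy
  have hy' : y ∈ (trivializationAt E (TangentSpace I) x).baseSet := by simpa using hy
  have h3 : coordField I x v y = (trivializationAt E (TangentSpace I) x).symm y
      (trivializationAt E (TangentSpace I) x ⟨x, v⟩).2 := rfl
  rw [h3, Trivialization.apply_mk_symm _ hy', h1]

/-- The differential of the inverse of the chart at `x`. -/
def chartSymmDeriv (I : ModelWithCorners ℝ E H) {M : Type*} [TopologicalSpace M] [ChartedSpace H M]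
    (x : M) (η : E) : E →L[ℝ] TangentSpace I ((extChartAt I x).symm η) :=
  mfderivWithin 𝓘(ℝ, E) I (extChartAt I x).symm (Set.range I) η

/-- A vector field is the combination of the coordinate vectors given by its components. -/
theorem chartSymmDeriv_chartRep (x : M) (B : ∀ y : M, TangentSpace I y) {η : E}
    (hη : η ∈ (extChartAt I x).target) :
    chartSymmDeriv I x η (chartRep I x B ((extChartAt I x).symm η))
      = B ((extChartAt I x).symm η) :=
  congrArg (fun T : TangentSpace I ((extChartAt I x).symm η) →L[ℝ]
    TangentSpace I ((extChartAt I x).symm η) => T (B ((extChartAt I x).symm η)))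
      (mfderivWithin_extChartAt_symm_comp_mfderiv_extChartAt (I := I) hη)

/-- The flat connection of the chart at `x`, which differentiates components of vector fields. -/
theorem isCovariantDerivativeOn_flat (x : M) :
    IsCovariantDerivativeOn (I := I) E (V := (TangentSpace I : M → Type _))
      (fun (B : ∀ y : M, TangentSpace I y) (y : M) =>
        (mvfderiv I (chartRep I x B) y : TangentSpace I y →L[ℝ] E)) {x} where
  add := by
    rintro B B' y hB hB' rfl
    have e : chartRep I y (B + B') = chartRep I y B + chartRep I y B' := by
      ext z; exact map_add (mfderiv I 𝓘(ℝ, E) (extChartAt I y) z) _ _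
    simp only [e]
    exact mvfderiv_add (mdifferentiableAt_chartRep.1 hB) (mdifferentiableAt_chartRep.1 hB')
  leibniz := by
    rintro B f y hB hf rfl
    have e : chartRep I y (f • B) = f • chartRep I y B := by
      ext z; exact map_smul (mfderiv I 𝓘(ℝ, E) (extChartAt I y) z) _ _
    simp only [e]
    rw [mvfderiv_smul hf (mdifferentiableAt_chartRep.1 hB), chartRep_self]
    rfl

/-- A connection differs at `x` from the flat connection of the chart by the Christoffel tensor `Γ`:
`∇_u B = ∂_u B + Γ(B, u)`. -/
theorem exists_christoffel [FiniteDimensional ℝ E] [CompleteSpace E] [IsManifold I 2 M]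
    (cov : CovariantDerivative I E (TangentSpace I : M → Type _)) (x : M) :
    ∃ Γ : E →L[ℝ] E →L[ℝ] E, ∀ (B : ∀ y : M, TangentSpace I y), VFDiffAt I B x → ∀ u : E,
      (cov B x u : E) = (mvfderiv I (chartRep I x B) x u : E) + Γ (B x) u := by
  refine ⟨(cov.isCovariantDerivativeOn (s := {x})).difference (isCovariantDerivativeOn_flat x) x,
    fun B hB u => ?_⟩
  have h := (cov.isCovariantDerivativeOn (s := {x})).difference_apply
    (isCovariantDerivativeOn_flat x) (x := x) rfl hB
  have h2 := congrArg (fun T : TangentSpace I x →L[ℝ] E => T u) h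
  refine Eq.trans ?_ (congrArg (fun z : E => (mvfderiv I (chartRep I x B) x u : E) + z) h2.symm)
  exact (add_sub_cancel (G := E) _ _).symm

section Boundaryless

variable [I.Boundaryless]

theorem eventually_comp_extChartAt_symm (x : M) {P : M → Prop} (h : ∀ᶠ y in 𝓝 x, P y) :
    ∀ᶠ η in 𝓝 (extChartAt I x x), P ((extChartAt I x).symm η) := by
  have := (continuousAt_extChartAt_symm (I := I) x).tendsto
  rw [extChartAt_to_inv] at this
  exact this.eventually h

/-- The differential at `x` of a vector-valued function, computed in the chart at `x`. -/
theorem mvfderiv_eq_fderiv {F : Type*} [NormedAddCommGroup F] [NormedSpace ℝ F] (f : M → F)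
    (x : M) (u : E) :
    mvfderiv I f x u = fderiv ℝ (f ∘ (extChartAt I x).symm) (extChartAt I x x) u := by
  by_cases h : MDifferentiableAt I 𝓘(ℝ, F) f x
  · have : mfderiv I 𝓘(ℝ, F) f x
        = fderivWithin ℝ (f ∘ (extChartAt I x).symm) (Set.range I) (extChartAt I x x) := by
      unfold mfderiv
      exact if_pos h
    rw [I.range_eq_univ, fderivWithin_univ] at this
    exact congrArg (fun T : E →L[ℝ] F => T u) this
  -- if `f` is not differentiable at `x`, both sides are the junk value `0`
  · have h1 : mvfderiv I f x = 0 := by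
      rw [mvfderiv, mfderiv_zero_of_not_mdifferentiableAt h]
      exact ContinuousLinearMap.comp_zero _
    have h2 : ¬ DifferentiableAt ℝ (f ∘ (extChartAt I x).symm) (extChartAt I x x) := by
      intro h3
      refine h ((mdifferentiableAt_iff _ _).2 ⟨?_, ?_⟩)
      · have h4 := h3.continuousAt.comp (continuousAt_extChartAt (I := I) x)
        refine h4.congr ?_
        filter_upwards [extChartAt_source_mem_nhds (I := I) x] with y hy
        simp only [Function.comp]
        rw [(extChartAt I x).left_inv hy]
      · rw [I.range_eq_univ]
        exact h3.differentiableWithinAt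
    rw [h1, fderiv_zero_of_not_differentiableAt h2]
    rfl

theorem MDifferentiableAt.differentiableAt_comp_symm {F : Type*} [NormedAddCommGroup F]
    [NormedSpace ℝ F] {f : M → F} {x : M} (h : MDifferentiableAt I 𝓘(ℝ, F) f x) :
    DifferentiableAt ℝ (f ∘ (extChartAt I x).symm) (extChartAt I x x) := by
  have := ((mdifferentiableAt_iff _ _).1 h).2
  rw [I.range_eq_univ, differentiableWithinAt_univ] at this
  exact this

theorem DForm.inChart_chartRep {k : ℕ} {A : Type*} [NormedAddCommGroup A] [NormedSpace ℝ A]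
    (α : DForm I M k A) (x : M) (B : Fin k → ∀ y : M, TangentSpace I y) {η : E}
    (hη : η ∈ (extChartAt I x).target) :
    α.inChart x η (fun i => chartRep I x (B i) ((extChartAt I x).symm η))
      = α ((extChartAt I x).symm η) (fun i => B i ((extChartAt I x).symm η)) := by
  exact congrArg (α ((extChartAt I x).symm η))
    (funext fun i => chartSymmDeriv_chartRep x (B i) hη)

theorem DForm.inChart_self {k : ℕ} {A : Type*} [NormedAddCommGroup A] [NormedSpace ℝ A]
    (α : DForm I M k A) (x : M) (v : Fin k → E) :
    α.inChart x (extChartAt I x x) v = α x v := by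
  have h := DForm.inChart_chartRep α x (fun i => coordField I x (v i))
    (mem_extChartAt_target x)
  rw [extChartAt_to_inv] at h
  have h2 : ∀ i, chartRep I x (coordField I x (v i)) x = v i := fun i => by
    rw [chartRep_self, coordField_self]
  simp only [h2, coordField_self] at h
  exact h

/-- The covariant derivative of a form at `x`, in terms of the derivative of the form in the chart
at `x` and the Christoffel tensor `Γ` at `x`. -/
theorem covDerivForm_eq {k : ℕ} (cov : CovariantDerivative I E (TangentSpace I : M → Type _))
    {x : M} {Γ : E →L[ℝ] E →L[ℝ] E}
    (hΓ : ∀ (B : ∀ y : M, TangentSpace I y), VFDiffAt I B x → ∀ u : E,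
      (cov B x u : E) = (mvfderiv I (chartRep I x B) x u : E) + Γ (B x) u)
    (α : DForm I M k ℝ) (hα : DifferentiableAt ℝ (α.inChart x) (extChartAt I x x))
    (u : E) (B : Fin k → ∀ y : M, TangentSpace I y) (hB : ∀ i, VFDiffAt I (B i) x)
    (b : Fin k → E) (hb : ∀ i, B i x = b i) :
    covDerivForm cov α x u B
      = fderiv ℝ (α.inChart x) (extChartAt I x x) u b
        - ∑ i, α.inChart x (extChartAt I x x) (Function.update b i (Γ (b i) u)) := by
  have hrep : ∀ i, chartRep I x (B i) x = b i := fun i => by rw [chartRep_self]; exact hb i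
  have e1 : (fun y => α y (fun i => B i y)) ∘ (extChartAt I x).symm =ᶠ[𝓝 (extChartAt I x x)]
      fun η => α.inChart x η (fun i => (chartRep I x (B i) ∘ (extChartAt I x).symm) η) := by
    filter_upwards [extChartAt_target_mem_nhds x] with η hη
    exact (DForm.inChart_chartRep α x B hη).symm
  have hd : ∀ i, DifferentiableAt ℝ (chartRep I x (B i) ∘ (extChartAt I x).symm)
      (extChartAt I x x) := fun i =>
    MDifferentiableAt.differentiableAt_comp_symm (mdifferentiableAt_chartRep.1 (hB i))
  have hval : ∀ i, (chartRep I x (B i) ∘ (extChartAt I x).symm) (extChartAt I x x) = b i :=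
    fun i => by rw [Function.comp_apply, extChartAt_to_inv, hrep]
  have hcov : ∀ i, (cov (B i) x u : E)
      = fderiv ℝ (chartRep I x (B i) ∘ (extChartAt I x).symm) (extChartAt I x x) u
        + Γ (b i) u := fun i => by
    have := hΓ (B i) (hB i) u
    rw [mvfderiv_eq_fderiv] at this
    rw [this, ← hb i]
  -- the terms with derivatives of the components cancel against those of the product rule
  have hsum : ∀ i, α x (Function.update (fun j => B j x) i (cov (B i) x u))
      = α.inChart x (extChartAt I x x) (Function.update b i
          (fderiv ℝ (chartRep I x (B i) ∘ (extChartAt I x).symm) (extChartAt I x x) u))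
        + α.inChart x (extChartAt I x x) (Function.update b i (Γ (b i) u)) := fun i => by
    rw [← ContinuousAlternatingMap.map_update_add, ← hcov, DForm.inChart_self]
    congr 1
    exact congrArg (fun f : Fin k → E => Function.update f i (cov (B i) x u : E)) (funext hb)
  have hdef : covDerivForm cov α x u B = mvfderiv I (fun y => α y (fun i => B i y)) x u
    - ∑ i, α x (Function.update (fun j => B j x) i (cov (B i) x u)) := rfl
  rw [hdef, mvfderiv_eq_fderiv, e1.fderiv_eq,
    fderiv_continuousAlternatingMap_apply_apply hα hd, Finset.sum_congr rfl fun i _ => hsum i,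
    Finset.sum_add_distrib]
  simp only [hval]
  ring

/-- The exterior derivative at `x` is the alternating sum of partial derivatives in the chart
at `x`. -/
theorem DForm.d_apply {k : ℕ} {A : Type*} [NormedAddCommGroup A] [NormedSpace ℝ A]
    (α : DForm I M k A) (x : M) (v : Fin (k + 1) → E) :
    α.d x v = ∑ i, (-1) ^ i.val •
      fderiv ℝ (α.inChart x) (extChartAt I x x) (v i) (i.removeNth v) := by
  have h1 : α.d x v = extDerivWithin (α.inChart x) (Set.range I) (extChartAt I x x)
      (fun i => (mfderiv I 𝓘(ℝ, E) (extChartAt I x) x : E →L[ℝ] E) (v i)) := rfl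
  have h2 : (mfderiv I 𝓘(ℝ, E) (extChartAt I x) x : E →L[ℝ] E) = ContinuousLinearMap.id ℝ E :=
    mfderiv_extChartAt_self
  rw [h1, h2, I.range_eq_univ, extDerivWithin_univ]
  exact ContinuousAlternatingMap.alternatizeUncurryFin_apply _ _

theorem DForm.IsSmooth.differentiableAt {k : ℕ} {A : Type*} [NormedAddCommGroup A]
    [NormedSpace ℝ A] {α : DForm I M k A} (hα : α.IsSmooth) (x : M) :
    DifferentiableAt ℝ (α.inChart x) (extChartAt I x x) :=
  ((hα x).contDiffAt (extChartAt_target_mem_nhds x)).differentiableAt (by simp)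

/-- A bilinear form on the tangent spaces, in the chart at `x`. -/
def bilinInChart (g : ∀ y : M, TangentSpace I y →L[ℝ] TangentSpace I y →L[ℝ] ℝ) (x : M) (η : E)
    (v w : E) : ℝ :=
  g ((extChartAt I x).symm η)
    (chartSymmDeriv I x η v)
    (chartSymmDeriv I x η w)

theorem chartRep_coordField_symm_eventuallyEq (x : M) (v : E) :
    ∀ᶠ η in 𝓝 (extChartAt I x x), coordField I x v ((extChartAt I x).symm η)
      = chartSymmDeriv I x η v := by
  filter_upwards [extChartAt_target_mem_nhds x,
    eventually_comp_extChartAt_symm (I := I) x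
      (chartRep_coordField_eventuallyEq (I := I) x v)] with η hη h
  rw [← chartSymmDeriv_chartRep x (coordField I x v) hη, h]

theorem bilinInChart_self (g : ∀ y : M, TangentSpace I y →L[ℝ] TangentSpace I y →L[ℝ] ℝ)
    (x : M) (v w : E) : bilinInChart g x (extChartAt I x x) v w = g x v w := by
  have hv := (chartRep_coordField_symm_eventuallyEq (I := I) x v).self_of_nhds
  have hw := (chartRep_coordField_symm_eventuallyEq (I := I) x w).self_of_nhds
  rw [bilinInChart, ← hv, ← hw, extChartAt_to_inv, coordField_self,
    coordField_self]

variable [FiniteDimensional ℝ E] [CompleteSpace E] [IsManifold I 2 M]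

theorem vfDiffAt_coordField (x : M) (v : E) :
    VFDiffAt I (coordField I x v) x :=
  FiberBundle.mdifferentiableAt_extend ..

/-- The columns of the Christoffel tensor are the covariant derivatives of coordinate fields. -/
theorem christoffel_coordField {cov : CovariantDerivative I E (TangentSpace I : M → Type _)}
    {x : M} {Γ : E →L[ℝ] E →L[ℝ] E}
    (hΓ : ∀ (B : ∀ y : M, TangentSpace I y), VFDiffAt I B x → ∀ u : E,
      (cov B x u : E) = (mvfderiv I (chartRep I x B) x u : E) + Γ (B x) u) (u v : E) :
    (cov (coordField I x v) x u : E) = Γ v u := by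
  have h := hΓ _ (vfDiffAt_coordField x v) u
  have h1 : mvfderiv I (chartRep I x (coordField I x v)) x u
      = (0 : E) := by
    have e : chartRep I x (coordField I x v) ∘ (extChartAt I x).symm
        =ᶠ[𝓝 (extChartAt I x x)] fun _ => v :=
      eventually_comp_extChartAt_symm x (chartRep_coordField_eventuallyEq x v)
    rw [mvfderiv_eq_fderiv, e.fderiv_eq]
    simp
  rw [h, h1, zero_add]
  exact congrArg (fun z : E => Γ z u) (coordField_self _ _)

/-- Coordinate vector fields commute. -/
theorem mlieBracket_coordField (x : M) (u v : E) :
    VectorField.mlieBracket I (coordField I x u) (coordField I x v) x = 0 := by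
  have key : ∀ w : E,
      VectorField.mpullbackWithin 𝓘(ℝ, E) I (extChartAt I x).symm (coordField I x w)
        (Set.range I) =ᶠ[𝓝 (extChartAt I x x)] fun _ => (w : E) := by
    intro w
    filter_upwards [extChartAt_target_mem_nhds x,
      chartRep_coordField_symm_eventuallyEq x w] with η hη h
    rw [VectorField.mpullbackWithin_apply, h]
    exact (isInvertible_mfderivWithin_extChartAt_symm hη).inverse_apply_eq.2 rfl
  rw [← VectorField.mlieBracketWithin_univ, VectorField.mlieBracketWithin_apply,
    (key u).lieBracketWithin_vectorField_eq_nhds (key v)]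
  have h0 : VectorField.lieBracketWithin ℝ (fun _ : E => u) (fun _ : E => v)
      ((extChartAt I x).symm ⁻¹' Set.univ ∩ Set.range I) (extChartAt I x x) = 0 := by
    simp [VectorField.lieBracketWithin]
  exact (congrArg _ h0).trans (map_zero _)

/-- The Christoffel tensor of a torsion free connection is symmetric. -/
theorem christoffel_symm {cov : CovariantDerivative I E (TangentSpace I : M → Type _)}
    {x : M} {Γ : E →L[ℝ] E →L[ℝ] E}
    (hΓ : ∀ (B : ∀ y : M, TangentSpace I y), VFDiffAt I B x → ∀ u : E,
      (cov B x u : E) = (mvfderiv I (chartRep I x B) x u : E) + Γ (B x) u)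
    (htor : cov.torsion x = 0) (u v : E) : Γ v u = Γ u v := by
  have h := cov.torsion_apply (vfDiffAt_coordField x u)
    (vfDiffAt_coordField x (v : E))
  rw [htor, mlieBracket_coordField, coordField_self, coordField_self,
    sub_zero] at h
  have h1 := christoffel_coordField hΓ u v
  have h2 := christoffel_coordField hΓ v u
  rw [← h1, ← h2]
  exact (sub_eq_zero (G := E)).1 h.symm

/-- Compatibility with the metric in the chart: `∂_u g(v, w) = g(Γ(v, u), w) + g(v, Γ(w, u))` for
constant `v` and `w`. -/
theorem christoffel_metric {cov : CovariantDerivative I E (TangentSpace I : M → Type _)}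
    {g : ∀ x : M, TangentSpace I x →L[ℝ] TangentSpace I x →L[ℝ] ℝ}
    {x : M} {Γ : E →L[ℝ] E →L[ℝ] E}
    (hΓ : ∀ (B : ∀ y : M, TangentSpace I y), VFDiffAt I B x → ∀ u : E,
      (cov B x u : E) = (mvfderiv I (chartRep I x B) x u : E) + Γ (B x) u)
    (hg : IsLeviCivita g cov) (u v w : E) :
    fderiv ℝ (fun η => bilinInChart g x η v w) (extChartAt I x x) u
      = bilinInChart g x (extChartAt I x x) (Γ v u) w
        + bilinInChart g x (extChartAt I x x) v (Γ w u) := by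
  have h := hg.metric _ _ x (vfDiffAt_coordField x (v : E))
    (vfDiffAt_coordField x (w : E)) u
  have e : (fun y => g y (coordField I x v y)
      (coordField I x w y)) ∘ (extChartAt I x).symm
        =ᶠ[𝓝 (extChartAt I x x)] fun η => bilinInChart g x η v w := by
    filter_upwards [chartRep_coordField_symm_eventuallyEq x (v : E),
      chartRep_coordField_symm_eventuallyEq x (w : E)] with η h1 h2
    simp only [Function.comp, bilinInChart]
    rw [h1, h2]
  rw [mvfderiv_eq_fderiv, e.fderiv_eq, coordField_self,
    coordField_self] at h
  rw [h, bilinInChart_self, bilinInChart_self, ← christoffel_coordField hΓ,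
    ← christoffel_coordField hΓ]

end Boundaryless

end ChartPoint

/-! ### The wedge product in low degrees -/

section WedgeEval

variable {V : Type*} [AddCommGroup V] [Module ℝ V] [TopologicalSpace V]
  {A : Type*} [NormedCommRing A] [NormedAlgebra ℝ A]

theorem wedge_apply {p q : ℕ} (α : V [⋀^Fin p]→L[ℝ] A) (β : V [⋀^Fin q]→L[ℝ] A)
    (v : Fin (p + q) → V) :
    wedge α β v = ((p.factorial * q.factorial : ℕ) : ℝ)⁻¹ •
      ∑ σ : Equiv.Perm (Fin (p + q)), Equiv.Perm.sign σ •
        (α (fun i => v (σ (Fin.castAdd q i))) * β (fun j => v (σ (Fin.natAdd p j)))) := by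
  simp only [wedge, ContinuousAlternatingMap.smul_apply,
    ContinuousMultilinearMap.alternatization_apply_apply]
  rfl

/-- Only the permutations preserving the two blocks contribute if `β` vanishes on all tuples
taking a vector from the first block. -/
theorem wedge_apply_of_block {p q : ℕ} (α : V [⋀^Fin p]→L[ℝ] A) (β : V [⋀^Fin q]→L[ℝ] A)
    (v : Fin (p + q) → V)
    (h : ∀ s : Fin q → Fin (p + q), (∃ j i, s j = Fin.castAdd q i) → β (fun j => v (s j)) = 0) :
    wedge α β v = α (fun i => v (Fin.castAdd q i)) * β (fun j => v (Fin.natAdd p j)) := by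
  rw [wedge_apply]
  -- the block-preserving permutations; each contributes the same term, cancelling `p! q!`
  let e : Equiv.Perm (Fin p) × Equiv.Perm (Fin q) → Equiv.Perm (Fin (p + q)) := fun τ =>
    finSumFinEquiv.permCongr (Equiv.Perm.sumCongr τ.1 τ.2)
  have he : Function.Injective e := fun τ ρ hτ => by
    have := finSumFinEquiv.permCongr.injective hτ
    exact Equiv.Perm.sumCongrHom_injective this
  have hc : ∀ τ i, e τ (Fin.castAdd q i) = Fin.castAdd q (τ.1 i) := fun τ i => by
    simp [e, Equiv.permCongr_apply]
  have hn : ∀ τ j, e τ (Fin.natAdd p j) = Fin.natAdd p (τ.2 j) := fun τ j => by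
    simp [e, Equiv.permCongr_apply]
  have hs : ∀ τ, Equiv.Perm.sign (e τ) = Equiv.Perm.sign τ.1 * Equiv.Perm.sign τ.2 := fun τ => by
    simp only [e]
    rw [Equiv.Perm.sign_permCongr, Equiv.Perm.sign_sumCongr]
  rw [← Fintype.sum_of_injective e he
    (fun _ => α (fun i => v (Fin.castAdd q i)) * β (fun j => v (Fin.natAdd p j)))]
  · rw [Finset.sum_const, Finset.card_univ, Fintype.card_prod, Fintype.card_perm,
      Fintype.card_perm, Fintype.card_fin, Fintype.card_fin, ← Nat.cast_smul_eq_nsmul ℝ, smul_smul,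
      inv_mul_cancel₀ (by positivity), one_smul]
  · intro σ hσ
    by_cases hσ' : ∃ j i, σ (Fin.natAdd p j) = Fin.castAdd q i
    · rw [h (fun j => σ (Fin.natAdd p j)) hσ', mul_zero, smul_zero]
    · refine absurd ?_ hσ
      have h1 : Set.MapsTo (finSumFinEquiv.symm.permCongr σ) (Set.range Sum.inr)
          (Set.range (Sum.inr : Fin q → Fin p ⊕ Fin q)) := by
        rintro _ ⟨j, rfl⟩
        rw [Equiv.permCongr_apply, Equiv.symm_symm, finSumFinEquiv_apply_right]
        rcases hs : finSumFinEquiv.symm (σ (Fin.natAdd p j)) with i | k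
        · refine absurd ⟨j, i, ?_⟩ hσ'
          rw [Equiv.symm_apply_eq] at hs
          rw [hs, finSumFinEquiv_apply_left]
        · exact ⟨k, rfl⟩
      have h2 : Set.MapsTo (finSumFinEquiv.symm.permCongr σ) (Set.range Sum.inl)
          (Set.range (Sum.inl : Fin p → Fin p ⊕ Fin q)) :=
        (Equiv.Perm.perm_mapsTo_inl_iff_mapsTo_inr _).2 h1
      obtain ⟨τ, hτ⟩ := Equiv.Perm.mem_sumCongrHom_range_of_perm_mapsTo_inl h2
      refine ⟨τ, ?_⟩
      have : e τ = finSumFinEquiv.permCongr (Equiv.Perm.sumCongrHom _ _ τ) := rfl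
      rw [this, hτ]
      ext k
      simp [Equiv.permCongr_apply]
  · rintro ⟨τ, ρ⟩
    simp only [hc, hn, hs]
    have h1 := α.toAlternatingMap.map_perm (fun i => v (Fin.castAdd q i)) τ
    have h2 := β.toAlternatingMap.map_perm (fun i => v (Fin.natAdd p i)) ρ
    have h1' : α (fun i => v (Fin.castAdd q (τ i)))
      = Equiv.Perm.sign τ • α (fun i => v (Fin.castAdd q i)) := h1
    have h2' : β (fun i => v (Fin.natAdd p (ρ i)))
      = Equiv.Perm.sign ρ • β (fun i => v (Fin.natAdd p i)) := h2
    rw [h1', h2', smul_mul_smul_comm, smul_smul, Int.units_mul_self, one_smul]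

/-- The signed sum over `S₃`, written out. The list of permutations is checked by `decide`, as an
equality of multisets. -/
theorem sum_sign_perm_three {B : Type*} [AddCommGroup B] (f : Fin 3 → Fin 3 → Fin 3 → B) :
    ∑ σ : Equiv.Perm (Fin 3), Equiv.Perm.sign σ • f (σ 0) (σ 1) (σ 2)
      = f 0 1 2 - f 0 2 1 - f 1 0 2 + f 1 2 0 + f 2 0 1 - f 2 1 0 := by
  have h : (Finset.univ : Finset (Equiv.Perm (Fin 3))).val.map
      (fun σ => ((((Equiv.Perm.sign σ : ℤˣ) : ℤ), σ 0, σ 1, σ 2) : ℤ × Fin 3 × Fin 3 × Fin 3))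
        = {(1, 0, 1, 2), (-1, 0, 2, 1), (-1, 1, 0, 2), (1, 1, 2, 0), (1, 2, 0, 1),
          (-1, 2, 1, 0)} := by decide
  have h2 := congrArg (fun m => (m.map
    (fun x : ℤ × Fin 3 × Fin 3 × Fin 3 => x.1 • f x.2.1 x.2.2.1 x.2.2.2)).sum) h
  simp only [Multiset.map_map, Function.comp_def] at h2
  refine Eq.trans ?_ (h2.trans ?_)
  · rfl
  · simp only [Multiset.insert_eq_cons, Multiset.map_cons, Multiset.map_singleton,
      Multiset.sum_cons, Multiset.sum_singleton, one_smul, neg_smul]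
    abel

/-- The signed sum over `S₄`, written out. -/
theorem sum_sign_perm_four {B : Type*} [AddCommGroup B] (f : Fin 4 → Fin 4 → Fin 4 → Fin 4 → B) :
    ∑ σ : Equiv.Perm (Fin 4), Equiv.Perm.sign σ • f (σ 0) (σ 1) (σ 2) (σ 3)
      = f 0 1 2 3 - f 0 1 3 2 - f 0 2 1 3 + f 0 2 3 1 + f 0 3 1 2 - f 0 3 2 1
        - f 1 0 2 3 + f 1 0 3 2 + f 1 2 0 3 - f 1 2 3 0 - f 1 3 0 2 + f 1 3 2 0
        + f 2 0 1 3 - f 2 0 3 1 - f 2 1 0 3 + f 2 1 3 0 + f 2 3 0 1 - f 2 3 1 0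
        - f 3 0 1 2 + f 3 0 2 1 + f 3 1 0 2 - f 3 1 2 0 - f 3 2 0 1 + f 3 2 1 0 := by
  have h : (Finset.univ : Finset (Equiv.Perm (Fin 4))).val.map
      (fun σ => ((((Equiv.Perm.sign σ : ℤˣ) : ℤ), σ 0, σ 1, σ 2, σ 3) :
        ℤ × Fin 4 × Fin 4 × Fin 4 × Fin 4))
        = {(1, 0, 1, 2, 3), (-1, 0, 1, 3, 2), (-1, 0, 2, 1, 3), (1, 0, 2, 3, 1),
          (1, 0, 3, 1, 2), (-1, 0, 3, 2, 1), (-1, 1, 0, 2, 3), (1, 1, 0, 3, 2),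
          (1, 1, 2, 0, 3), (-1, 1, 2, 3, 0), (-1, 1, 3, 0, 2), (1, 1, 3, 2, 0),
          (1, 2, 0, 1, 3), (-1, 2, 0, 3, 1), (-1, 2, 1, 0, 3), (1, 2, 1, 3, 0),
          (1, 2, 3, 0, 1), (-1, 2, 3, 1, 0), (-1, 3, 0, 1, 2), (1, 3, 0, 2, 1),
          (1, 3, 1, 0, 2), (-1, 3, 1, 2, 0), (-1, 3, 2, 0, 1), (1, 3, 2, 1, 0)} := by decide
  have h2 := congrArg (fun m => (m.map
    (fun x : ℤ × Fin 4 × Fin 4 × Fin 4 × Fin 4 => x.1 • f x.2.1 x.2.2.1 x.2.2.2.1 x.2.2.2.2)).sum) h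
  simp only [Multiset.map_map, Function.comp_def] at h2
  refine Eq.trans ?_ (h2.trans ?_)
  · rfl
  · simp only [Multiset.insert_eq_cons, Multiset.map_cons, Multiset.map_singleton,
      Multiset.sum_cons, Multiset.sum_singleton, one_smul, neg_smul]
    abel

section Swap

variable {B : Type*} [AddCommGroup B] [Module ℝ B] [TopologicalSpace B]

theorem alt_two_swap (β : V [⋀^Fin 2]→L[ℝ] B) (a b : V) : β ![b, a] = -β ![a, b] := by
  have h := β.toAlternatingMap.map_swap ![a, b] (show (0 : Fin 2) ≠ 1 by decide)
  have e : ![a, b] ∘ Equiv.swap (0 : Fin 2) 1 = ![b, a] := by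
    ext i; fin_cases i <;> rfl
  rw [e] at h
  exact h

theorem alt_three_swap_left (β : V [⋀^Fin 3]→L[ℝ] B) (a b c : V) :
    β ![b, a, c] = -β ![a, b, c] := by
  have h := β.toAlternatingMap.map_swap ![a, b, c] (show (0 : Fin 3) ≠ 1 by decide)
  have e : ![a, b, c] ∘ Equiv.swap (0 : Fin 3) 1 = ![b, a, c] := by
    ext i; fin_cases i <;> rfl
  rw [e] at h
  exact h

theorem alt_three_swap_right (β : V [⋀^Fin 3]→L[ℝ] B) (a b c : V) :
    β ![a, c, b] = -β ![a, b, c] := by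
  have h := β.toAlternatingMap.map_swap ![a, b, c] (show (1 : Fin 3) ≠ 2 by decide)
  have e : ![a, b, c] ∘ Equiv.swap (1 : Fin 3) 2 = ![a, c, b] := by
    ext i; fin_cases i <;> rfl
  rw [e] at h
  exact h

end Swap

theorem wedge_one_two (α : V [⋀^Fin 1]→L[ℝ] A) (β : V [⋀^Fin 2]→L[ℝ] A) (v : Fin (1 + 2) → V) :
    wedge α β v = α ![v 0] * β ![v 1, v 2] - α ![v 1] * β ![v 0, v 2]
      + α ![v 2] * β ![v 0, v 1] := by
  have h : ∀ σ : Equiv.Perm (Fin 3), α (fun i => v (σ (Fin.castAdd 2 i)))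
      * β (fun j => v (σ (Fin.natAdd 1 j)))
        = (fun a b c => α ![v a] * β ![v b, v c]) (σ 0) (σ 1) (σ 2) := fun σ => by
    congr 2 <;> ext i <;> fin_cases i <;> rfl
  rw [wedge_apply, Finset.sum_congr rfl fun σ _ => congrArg (Equiv.Perm.sign σ • ·) (h σ),
    sum_sign_perm_three (fun a b c => α ![v a] * β ![v b, v c])]
  simp only [alt_two_swap β (v 1) (v 2), alt_two_swap β (v 0) (v 2), alt_two_swap β (v 0) (v 1)]
  rw [inv_smul_eq_iff₀ (by positivity)]
  norm_num [Nat.factorial, two_smul]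
  ring

theorem wedge_two_two (α β : V [⋀^Fin 2]→L[ℝ] A) (v : Fin (2 + 2) → V) :
    wedge α β v = α ![v 0, v 1] * β ![v 2, v 3] - α ![v 0, v 2] * β ![v 1, v 3]
      + α ![v 0, v 3] * β ![v 1, v 2] + α ![v 1, v 2] * β ![v 0, v 3]
      - α ![v 1, v 3] * β ![v 0, v 2] + α ![v 2, v 3] * β ![v 0, v 1] := by
  have h : ∀ σ : Equiv.Perm (Fin 4), α (fun i => v (σ (Fin.castAdd 2 i)))
      * β (fun j => v (σ (Fin.natAdd 2 j)))
        = (fun a b c d => α ![v a, v b] * β ![v c, v d]) (σ 0) (σ 1) (σ 2) (σ 3) := fun σ => by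
    congr 2 <;> ext i <;> fin_cases i <;> rfl
  rw [wedge_apply, Finset.sum_congr rfl fun σ _ => congrArg (Equiv.Perm.sign σ • ·) (h σ),
    sum_sign_perm_four (fun a b c d => α ![v a, v b] * β ![v c, v d])]
  simp only [fun γ : V [⋀^Fin 2]→L[ℝ] A => alt_two_swap γ (v 1) (v 2),
    fun γ : V [⋀^Fin 2]→L[ℝ] A => alt_two_swap γ (v 0) (v 2),
    fun γ : V [⋀^Fin 2]→L[ℝ] A => alt_two_swap γ (v 0) (v 1),
    fun γ : V [⋀^Fin 2]→L[ℝ] A => alt_two_swap γ (v 0) (v 3),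
    fun γ : V [⋀^Fin 2]→L[ℝ] A => alt_two_swap γ (v 1) (v 3),
    fun γ : V [⋀^Fin 2]→L[ℝ] A => alt_two_swap γ (v 2) (v 3)]
  rw [inv_smul_eq_iff₀ (by positivity)]
  norm_num [Nat.factorial, ofNat_smul_eq_nsmul]
  ring

theorem wedge_three_one (α : V [⋀^Fin 3]→L[ℝ] A) (β : V [⋀^Fin 1]→L[ℝ] A)
    (v : Fin (3 + 1) → V) :
    wedge α β v = α ![v 0, v 1, v 2] * β ![v 3] - α ![v 0, v 1, v 3] * β ![v 2]
      + α ![v 0, v 2, v 3] * β ![v 1] - α ![v 1, v 2, v 3] * β ![v 0] := by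
  have h : ∀ σ : Equiv.Perm (Fin 4), α (fun i => v (σ (Fin.castAdd 1 i)))
      * β (fun j => v (σ (Fin.natAdd 3 j)))
        = (fun a b c d => α ![v a, v b, v c] * β ![v d]) (σ 0) (σ 1) (σ 2) (σ 3) := fun σ => by
    congr 2 <;> ext i <;> fin_cases i <;> rfl
  rw [wedge_apply, Finset.sum_congr rfl fun σ _ => congrArg (Equiv.Perm.sign σ • ·) (h σ),
    sum_sign_perm_four (fun a b c d => α ![v a, v b, v c] * β ![v d])]
  -- reordering the arguments of `α` into increasing order
  have key : ∀ a b c : V, α ![a, c, b] = -α ![a, b, c] ∧ α ![b, a, c] = -α ![a, b, c] ∧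
      α ![b, c, a] = α ![a, b, c] ∧ α ![c, a, b] = α ![a, b, c] ∧
      α ![c, b, a] = -α ![a, b, c] := fun a b c => by
    have h1 := alt_three_swap_right α a b c
    have h2 := alt_three_swap_left α a b c
    have h3 := alt_three_swap_right α b a c
    have h4 := alt_three_swap_left α a c b
    have h5 := alt_three_swap_right α c a b
    refine ⟨h1, h2, ?_, ?_, ?_⟩
    · rw [h3, h2, neg_neg]
    · rw [h4, h1, neg_neg]
    · rw [h5, h4, h1, neg_neg]
  simp only [(key (v 0) (v 1) (v 2)).1, (key (v 0) (v 1) (v 2)).2.1, (key (v 0) (v 1) (v 2)).2.2.1,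
    (key (v 0) (v 1) (v 2)).2.2.2.1, (key (v 0) (v 1) (v 2)).2.2.2.2,
    (key (v 0) (v 1) (v 3)).1, (key (v 0) (v 1) (v 3)).2.1, (key (v 0) (v 1) (v 3)).2.2.1,
    (key (v 0) (v 1) (v 3)).2.2.2.1, (key (v 0) (v 1) (v 3)).2.2.2.2,
    (key (v 0) (v 2) (v 3)).1, (key (v 0) (v 2) (v 3)).2.1, (key (v 0) (v 2) (v 3)).2.2.1,
    (key (v 0) (v 2) (v 3)).2.2.2.1, (key (v 0) (v 2) (v 3)).2.2.2.2,
    (key (v 1) (v 2) (v 3)).1, (key (v 1) (v 2) (v 3)).2.1, (key (v 1) (v 2) (v 3)).2.2.1,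
    (key (v 1) (v 2) (v 3)).2.2.2.1, (key (v 1) (v 2) (v 3)).2.2.2.2]
  rw [inv_smul_eq_iff₀ (by positivity)]
  norm_num [Nat.factorial, ofNat_smul_eq_nsmul]
  ring

end WedgeEval

/-! ### Wedge products evaluated on a frame -/

section WedgeFrame

variable {V : Type*} [AddCommGroup V] [Module ℝ V] [TopologicalSpace V]
  {A : Type*} [NormedCommRing A] [NormedAlgebra ℝ A]

/-- The form `ℓ₁ ∧ … ∧ ℓ_k`. -/
def detForm {k : ℕ} (l : Fin k → V →L[ℝ] A) : V [⋀^Fin k]→L[ℝ] A :=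
  ContinuousMultilinearMap.alternatization
    ((ContinuousMultilinearMap.mkPiAlgebra ℝ (Fin k) A).compContinuousLinearMap l)

theorem detForm_apply {k : ℕ} (l : Fin k → V →L[ℝ] A) (v : Fin k → V) :
    detForm l v = (Matrix.of fun i j => l j (v i)).det := by
  rw [detForm, ContinuousMultilinearMap.alternatization_apply_apply, Matrix.det_apply]
  simp

/-- Evaluation of `α ∧ β` on a frame, when `β` is a combination of exterior monomials in the dual
coframe: each monomial picks out the value of `α` on the complementary vectors of the frame. -/
theorem wedge_apply_frame {p q : ℕ} (e : Fin (p + q) → V) (x : Fin (p + q) → V →L[ℝ] A)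
    (hx : ∀ i j, x i (e j) = if i = j then 1 else 0) (α : V [⋀^Fin p]→L[ℝ] A)
    (β : V [⋀^Fin q]→L[ℝ] A) {ι : Type*} [Fintype ι] (π : ι → Equiv.Perm (Fin (p + q)))
    (c : ι → A)
    (hβ : ∀ v : Fin q → V, β v
      = ∑ i, c i * (Matrix.of fun k j => x (π i (Fin.natAdd p j)) (v k)).det) :
    wedge α β e = ∑ i, c i * (((Equiv.Perm.sign (π i) : ℤˣ) : ℤ) •
      α (fun k => e (π i (Fin.castAdd q k)))) := by
  have h1 : ∀ i, wedge α (detForm fun j => x (π i (Fin.natAdd p j))) e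
      = ((Equiv.Perm.sign (π i) : ℤˣ) : ℤ) • α (fun k => e (π i (Fin.castAdd q k))) := by
    intro i
    have h2 := (wedge α (detForm fun j => x (π i (Fin.natAdd p j)))).toAlternatingMap.map_perm e
      (π i)
    have h3 : wedge α (detForm fun j => x (π i (Fin.natAdd p j))) (e ∘ π i)
      = Equiv.Perm.sign (π i) • wedge α (detForm fun j => x (π i (Fin.natAdd p j))) e := h2
    have h4 : wedge α (detForm fun j => x (π i (Fin.natAdd p j))) (e ∘ π i)
        = α (fun k => e (π i (Fin.castAdd q k))) := by
      rw [wedge_apply_of_block]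
      · have : (Matrix.of fun k j => x (π i (Fin.natAdd p j)) (e (π i (Fin.natAdd p k))))
            = (1 : Matrix (Fin q) (Fin q) A) := by
          ext k j
          simp [hx, Matrix.one_apply, eq_comm]
        simp only [detForm_apply, Function.comp, this, Matrix.det_one, mul_one]
      · rintro s ⟨j, k, hs⟩
        rw [detForm_apply]
        refine Matrix.det_eq_zero_of_row_eq_zero j fun l => ?_
        have hne : π i (Fin.natAdd p l) ≠ π i (Fin.castAdd q k) := fun h' => by
          have := congrArg Fin.val ((π i).injective h')
          simp at this
          omega
        simp only [Matrix.of_apply, Function.comp_apply, hs, hx, if_neg hne]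
    rw [h3] at h4
    rw [← h4]
    rw [← Units.smul_def, smul_smul, Int.units_mul_self, one_smul]
  have h5 : wedge α β e = ∑ i, c i * wedge α (detForm fun j => x (π i (Fin.natAdd p j))) e := by
    simp only [wedge_apply, hβ, detForm_apply, mul_smul_comm, ← Finset.smul_sum, Finset.mul_sum]
    congr 1
    rw [Finset.sum_comm]
    refine Finset.sum_congr rfl fun σ _ => ?_
    rw [← Finset.smul_sum]
    congr 1
    exact Finset.sum_congr rfl fun i _ => by ring
  rw [h5]
  exact Finset.sum_congr rfl fun i _ => by rw [h1 i]

/-- The permutation with values `f` and inverse `g`; giving the inverse explicitly lets `simp` and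
`decide` evaluate it. -/
abbrev permOf {n : ℕ} (f g : Fin n → Fin n) (h : ∀ i, g (f i) = i := by decide)
    (h' : ∀ i, f (g i) = i := by decide) : Equiv.Perm (Fin n) := ⟨f, g, h, h'⟩

/-- Two top-degree forms agreeing on a frame are equal. -/
theorem topForm_ext {n : ℕ} (e : Fin n → V) (x : Fin n → V →L[ℝ] ℝ)
    (hx : ∀ i j, x i (e j) = if i = j then 1 else 0) (hsum : ∀ u, u = ∑ i, x i u • e i)
    (α β : V [⋀^Fin n]→L[ℝ] A) (h : α e = β e) : α = β := by
  have h0 : α.toAlternatingMap = β.toAlternatingMap := by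
    let b : Module.Basis (Fin n) ℝ V := Module.Basis.ofEquivFun
      { toFun := fun u i => x i u
        invFun := fun c => ∑ i, c i • e i
        map_add' := fun u v => by ext i; simp
        map_smul' := fun c u => by ext i; simp
        left_inv := fun u => (hsum u).symm
        right_inv := fun c => by ext i; simp [hx] }
    have hb : ∀ i, b i = e i := fun i => by
      have : b i = ∑ j, (Pi.single i 1 : Fin n → ℝ) j • e j := by
        simp [b, Module.Basis.coe_ofEquivFun]
      rw [this]
      simp [Pi.single_apply]
    refine b.ext_alternating fun v hv => ?_
    have hv' : (fun i => b (v i))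
        = e ∘ Equiv.ofBijective v (Finite.injective_iff_bijective.1 hv) := by
      ext i; simp [hb]
    rw [hv', AlternatingMap.map_perm, AlternatingMap.map_perm]
    exact congrArg _ h
  ext v
  exact congrArg (fun γ : V [⋀^Fin n]→ₗ[ℝ] A => γ v) h0

/-- The value of `a ∧ b ∧ c` on three vectors. -/
def det3 (a b c : V →L[ℝ] A) (u v w : V) : A :=
  a u * (b v * c w - b w * c v) - a v * (b u * c w - b w * c u) + a w * (b u * c v - b v * c u)

theorem det_eq_det3 (a b c : V →L[ℝ] A) (v : Fin 3 → V) :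
    (Matrix.of fun (k j : Fin 3) => (![a, b, c] j) (v k)).det = det3 a b c (v 0) (v 1) (v 2) := by
  rw [Matrix.det_fin_three, det3]
  simp
  ring

end WedgeFrame

/-! ### The standard `G₂`-structure in a frame -/

section G2Frame

variable {V : Type*} [AddCommGroup V] [Module ℝ V] [TopologicalSpace V]

/-- The standard `3`-form of `G₂` in the coordinates `x₀, …, x₆` on `ℂ³ ⊕ ℝ`, where
`z_j = x_{2j} + i x_{2j+1}` for `j = 0, 1, 2`, i.e.
`Re(dz₀ ∧ dz₁ ∧ dz₂) + dx₆ ∧ (dx₀ ∧ dx₁ + dx₂ ∧ dx₃ + dx₄ ∧ dx₅)`. -/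
def stdPhi (x : Fin 7 → V →L[ℝ] ℝ) (u v w : V) : ℝ :=
  det3 (x 0) (x 2) (x 4) u v w + det3 (x 3) (x 0) (x 5) u v w + det3 (x 2) (x 1) (x 5) u v w
    + det3 (x 3) (x 1) (x 4) u v w + det3 (x 6) (x 0) (x 1) u v w + det3 (x 6) (x 2) (x 3) u v w
    + det3 (x 6) (x 4) (x 5) u v w

/-- Even permutations of `0, …, 6` whose last three values index the seven monomials of
`stdPhi`. -/
def stdPhiPerm : Fin 7 → Equiv.Perm (Fin (4 + 3)) :=
  ![permOf ![3, 1, 5, 6, 0, 2, 4] ![4, 1, 5, 0, 6, 2, 3],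
    permOf ![1, 2, 4, 6, 3, 0, 5] ![5, 0, 1, 4, 2, 6, 3],
    permOf ![0, 3, 4, 6, 2, 1, 5] ![0, 5, 4, 1, 2, 6, 3],
    permOf ![0, 2, 5, 6, 3, 1, 4] ![0, 5, 1, 4, 6, 2, 3],
    permOf ![2, 3, 4, 5, 6, 0, 1] ![5, 6, 0, 1, 2, 3, 4],
    permOf ![0, 1, 4, 5, 6, 2, 3] ![0, 1, 5, 6, 2, 3, 4],
    permOf ![0, 1, 2, 3, 6, 4, 5] ![0, 1, 2, 3, 5, 6, 4]]

theorem sign_stdPhiPerm (i : Fin 7) : Equiv.Perm.sign (stdPhiPerm i) = 1 := by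
  revert i; decide

theorem contract_apply {k : ℕ} (u : V) (α : V [⋀^Fin (k + 1)]→L[ℝ] ℝ) (v : Fin k → V) :
    contract u α v = α (Matrix.vecCons u v) := rfl

/-- In a coframe, the form `stdPhi` induces the inner product `∑ x_i²` and the volume form with
value `1` on the dual frame. Both sides of the defining identity are evaluated on the frame, and
the wedge product with `φ` picks out for each monomial of `φ` the four complementary frame vectors.
-/
theorem isG2Form_of_frame (e : Fin 7 → V) (x : Fin 7 → V →L[ℝ] ℝ)
    (hx : ∀ i j, x i (e j) = if i = j then 1 else 0) (hsum : ∀ u, u = ∑ i, x i u • e i)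
    (φ : V [⋀^Fin 3]→L[ℝ] ℝ) (hφ : ∀ u v w, φ ![u, v, w] = stdPhi x u v w)
    (g : V →L[ℝ] V →L[ℝ] ℝ) (hg : ∀ u v, g u v = ∑ i, x i u * x i v)
    (vol : V [⋀^Fin 7]→L[ℝ] ℝ) (hvol : vol e = 1) : IsG2Form φ g vol where
  symm u v := by simp only [hg, mul_comm]
  pos u hu := by
    rw [hg]
    have h : ∃ i, x i u ≠ 0 := by
      by_contra! h
      exact hu (by rw [hsum u]; simp [h])
    obtain ⟨i, hi⟩ := h
    exact Finset.sum_pos' (fun j _ => mul_self_nonneg _)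
      ⟨i, Finset.mem_univ _, mul_self_pos.2 hi⟩
  unit_vol := ⟨e, fun i j => by simp [hg, hx, eq_comm], hvol⟩
  metric u v := by
    refine topForm_ext e x hx hsum _ _ ?_
    have hβ : ∀ w : Fin 3 → V, φ w = ∑ i, (1 : ℝ) *
        (Matrix.of fun k j => x (stdPhiPerm i (Fin.natAdd 4 j)) (w k)).det := by
      intro w
      have hw : w = ![w 0, w 1, w 2] := by ext i; fin_cases i <;> rfl
      have ht : ∀ i, (Matrix.of fun k j => x (stdPhiPerm i (Fin.natAdd 4 j)) (w k)).det
          = det3 (x (stdPhiPerm i (Fin.natAdd 4 0))) (x (stdPhiPerm i (Fin.natAdd 4 1)))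
            (x (stdPhiPerm i (Fin.natAdd 4 2))) (w 0) (w 1) (w 2) := fun i => by
        rw [← det_eq_det3]
        congr 1
        ext k j
        fin_cases j <;> rfl
      simp only [ht, one_mul, Fin.sum_univ_succ, Fin.sum_univ_zero]
      rw [hw, hφ]
      simp only [stdPhi]
      show _ = det3 (x 0) (x 2) (x 4) (w 0) (w 1) (w 2) + (det3 (x 3) (x 0) (x 5) (w 0) (w 1) (w 2)
        + (det3 (x 2) (x 1) (x 5) (w 0) (w 1) (w 2) + (det3 (x 3) (x 1) (x 4) (w 0) (w 1) (w 2)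
        + (det3 (x 6) (x 0) (x 1) (w 0) (w 1) (w 2) + (det3 (x 6) (x 2) (x 3) (w 0) (w 1) (w 2)
        + (det3 (x 6) (x 4) (x 5) (w 0) (w 1) (w 2) + 0))))))
      simp
      ring
    rw [ContinuousAlternatingMap.smul_apply, ContinuousAlternatingMap.smul_apply, hvol,
      wedge_apply_frame (p := 4) (q := 3) e x hx _ φ stdPhiPerm (fun _ => 1) hβ]
    simp only [sign_stdPhiPerm, wedge_two_two, contract_apply, hφ, Units.val_one, one_smul, one_mul]
    rw [hg]
    simp only [Fin.sum_univ_succ, Fin.sum_univ_zero]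
    simp [stdPhiPerm, stdPhi, det3, hx]
    ring

/-- The value of `a ∧ b ∧ c ∧ d` on four vectors. -/
def det4 (a b c d : V →L[ℝ] ℝ) (u v w z : V) : ℝ :=
  a u * det3 b c d v w z - a v * det3 b c d u w z + a w * det3 b c d u v z - a z * det3 b c d u v w

theorem det_eq_det4 (a : Fin 4 → V →L[ℝ] ℝ) (v : Fin 4 → V) :
    (Matrix.of fun k j => a j (v k)).det
      = det4 (a 0) (a 1) (a 2) (a 3) (v 0) (v 1) (v 2) (v 3) := by
  rw [Matrix.det_succ_column_zero]
  simp only [Fin.sum_univ_four, Matrix.det_fin_three, det4, det3, Matrix.submatrix_apply,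
    Matrix.of_apply]
  simp [Fin.succAbove]
  ring

theorem det_unit_row {n : ℕ} (M : Matrix (Fin (n + 1)) (Fin (n + 1)) ℝ) (j : Fin (n + 1))
    (h : ∀ k, M 0 k = if k = j then 1 else 0) :
    M.det = (-1) ^ (j : ℕ) * (M.submatrix Fin.succ j.succAbove).det := by
  rw [Matrix.det_succ_row_zero]
  simp [h]

/-- The standard `4`-form of `G₂` in the coordinates `x₀, …, x₆` of `stdPhi`: half the square of the
Hermitian form of `ℂ³` plus `Im(dz₀ ∧ dz₁ ∧ dz₂) ∧ dx₆`. -/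
def stdPsi (x : Fin 7 → V →L[ℝ] ℝ) (u v w z : V) : ℝ :=
  det4 (x 0) (x 1) (x 2) (x 3) u v w z + det4 (x 0) (x 1) (x 4) (x 5) u v w z
    + det4 (x 2) (x 3) (x 4) (x 5) u v w z + det4 (x 1) (x 2) (x 4) (x 6) u v w z
    + det4 (x 0) (x 3) (x 4) (x 6) u v w z + det4 (x 0) (x 2) (x 5) (x 6) u v w z
    - det4 (x 1) (x 3) (x 5) (x 6) u v w z

/-- Contraction of a monomial `x_i ∧ x_j ∧ x_k` with an alternating array. -/
theorem sum_det3_mul (e : Fin 7 → V) (x : Fin 7 → V →L[ℝ] ℝ)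
    (hx : ∀ i j, x i (e j) = if i = j then 1 else 0) (X : Fin 7 → Fin 7 → Fin 7 → ℝ)
    (h1 : ∀ a b c, X b a c = -X a b c) (h2 : ∀ a b c, X a c b = -X a b c) (i j k : Fin 7) :
    ∑ a, ∑ b, ∑ c, det3 (x i) (x j) (x k) (e a) (e b) (e c) * X a b c = 6 * X i j k := by
  simp only [det3, hx, add_mul, sub_mul, mul_sub, Finset.sum_add_distrib, Finset.sum_sub_distrib]
  simp
  have e1 := h2 i j k
  have e2 := h1 i j k
  have e3 : X j k i = X i j k := by rw [h2 j i k, h1 i j k, neg_neg]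
  have e4 : X k i j = X i j k := by rw [h1 i k j, h2 i j k, neg_neg]
  have e5 : X k j i = -X i j k := by rw [h2 k i j, e4]
  rw [e1, e2, e3, e4, e5]
  ring

/-- In a coframe, `stdPsi` is the Hodge dual of `stdPhi`: contracting the volume form with a
monomial of `φ` leaves, up to sign, the complementary monomial of `ψ`. -/
theorem isHodgeDual_of_frame (e : Fin 7 → V) (x : Fin 7 → V →L[ℝ] ℝ)
    (hx : ∀ i j, x i (e j) = if i = j then 1 else 0) (hsum : ∀ u, u = ∑ i, x i u • e i)
    (φ : V [⋀^Fin 3]→L[ℝ] ℝ) (hφ : ∀ u v w, φ ![u, v, w] = stdPhi x u v w)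
    (ψ : V [⋀^Fin 4]→L[ℝ] ℝ) (hψ : ∀ u v w z, ψ ![u, v, w, z] = stdPsi x u v w z)
    (g : V →L[ℝ] V →L[ℝ] ℝ) (hg : ∀ u v, g u v = ∑ i, x i u * x i v)
    (vol : V [⋀^Fin 7]→L[ℝ] ℝ) (hvol : vol e = 1) : IsHodgeDual g vol φ ψ := by
  refine ⟨e, fun i j => by simp [hg, hx, eq_comm], fun v => ?_⟩
  have hv : v = ![v 0, v 1, v 2, v 3] := by ext i; fin_cases i <;> rfl
  have hvol' : vol = detForm x := by
    refine topForm_ext e x hx hsum _ _ ?_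
    have : (Matrix.of fun i j => x j (e i)) = 1 := by
      ext i j; simp [hx, Matrix.one_apply, eq_comm]
    rw [hvol, detForm_apply, this, Matrix.det_one]
  let X : Fin 7 → Fin 7 → Fin 7 → ℝ := fun a b c =>
    vol ![e a, e b, e c, v 0, v 1, v 2, v 3]
  have h1 : ∀ a b c, X b a c = -X a b c := fun a b c => by
    have h := vol.toAlternatingMap.map_swap ![e a, e b, e c, v 0, v 1, v 2, v 3]
      (show (0 : Fin 7) ≠ 1 by decide)
    have e : ![e a, e b, e c, v 0, v 1, v 2, v 3] ∘ Equiv.swap (0 : Fin 7) 1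
      = ![e b, e a, e c, v 0, v 1, v 2, v 3] := by
      ext i; fin_cases i <;> rfl
    rw [e] at h
    exact h
  have h2 : ∀ a b c, X a c b = -X a b c := fun a b c => by
    have h := vol.toAlternatingMap.map_swap ![e a, e b, e c, v 0, v 1, v 2, v 3]
      (show (1 : Fin 7) ≠ 2 by decide)
    have e : ![e a, e b, e c, v 0, v 1, v 2, v 3] ∘ Equiv.swap (1 : Fin 7) 2
      = ![e a, e c, e b, v 0, v 1, v 2, v 3] := by
      ext i; fin_cases i <;> rfl
    rw [e] at h
    exact h
  have h3 : ∀ a b c, φ ![e a, e b, e c] * vol ![e a, e b, e c, v 0, v 1, v 2, v 3]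
      = stdPhi x (e a) (e b) (e c) * X a b c := fun a b c => by rw [hφ]
  -- `e i ⌟ e j ⌟ e k ⌟ vol` by Laplace expansion along three rows of the identity matrix
  have hX : ∀ (i : Fin 7) (j : Fin 6) (k : Fin 5),
      X i (i.succAbove j) (i.succAbove (j.succAbove k)) = (-1) ^ (i.val + j.val + k.val) *
        (Matrix.of fun r c => x (i.succAbove (j.succAbove (k.succAbove c))) (v r)).det := by
    intro i j k
    have h0 : X i (i.succAbove j) (i.succAbove (j.succAbove k))
        = (Matrix.of fun r c => x c (![e i, e (i.succAbove j), e (i.succAbove (j.succAbove k)),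
          v 0, v 1, v 2, v 3] r)).det := by
      rw [← detForm_apply, ← hvol']
    rw [h0, det_unit_row (j := i), det_unit_row (j := j), det_unit_row (j := k),
      pow_add, pow_add, mul_assoc, mul_assoc]
    · congr 4
      ext r c
      fin_cases r <;> rfl
    · intro c
      simp [hx]
    · intro c
      simp [hx]
    · intro c
      simp [hx]
  simp only [h3, stdPhi, add_mul, Finset.sum_add_distrib, sum_det3_mul e x hx X h1 h2]
  rw [hv, hψ]
  have t : ∀ (i : Fin 7) (j : Fin 6) (k : Fin 5),
      X i (i.succAbove j) (i.succAbove (j.succAbove k)) = (-1) ^ (i.val + j.val + k.val) *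
        det4 (x (i.succAbove (j.succAbove (k.succAbove 0))))
          (x (i.succAbove (j.succAbove (k.succAbove 1))))
          (x (i.succAbove (j.succAbove (k.succAbove 2))))
          (x (i.succAbove (j.succAbove (k.succAbove 3)))) (v 0) (v 1) (v 2) (v 3) := fun i j k => by
    rw [hX, det_eq_det4 (fun c => x (i.succAbove (j.succAbove (k.succAbove c)))) v]
  have t0 : X 0 2 4 = (-1) ^ 3 * det4 (x 1) (x 3) (x 5) (x 6) (v 0) (v 1) (v 2) (v 3) := t 0 1 2
  have t1 : X 3 0 5 = (-1) ^ 6 * det4 (x 1) (x 2) (x 4) (x 6) (v 0) (v 1) (v 2) (v 3) := t 3 0 3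
  have t2 : X 2 1 5 = (-1) ^ 6 * det4 (x 0) (x 3) (x 4) (x 6) (v 0) (v 1) (v 2) (v 3) := t 2 1 3
  have t3 : X 3 1 4 = (-1) ^ 6 * det4 (x 0) (x 2) (x 5) (x 6) (v 0) (v 1) (v 2) (v 3) := t 3 1 2
  have t4 : X 6 0 1 = (-1) ^ 6 * det4 (x 2) (x 3) (x 4) (x 5) (v 0) (v 1) (v 2) (v 3) := t 6 0 0
  have t5 : X 6 2 3 = (-1) ^ 10 * det4 (x 0) (x 1) (x 4) (x 5) (v 0) (v 1) (v 2) (v 3) := t 6 2 2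
  have t6 : X 6 4 5 = (-1) ^ 14 * det4 (x 0) (x 1) (x 2) (x 3) (v 0) (v 1) (v 2) (v 3) := t 6 4 4
  rw [t0, t1, t2, t3, t4, t5, t6]
  simp only [stdPsi, det4, det3]
  ring

end G2Frame

/-! ### Linear algebra of `SU(3)`-structures -/

section SU3Algebra

open Complex ComplexConjugate

variable {W : Type*} [NormedAddCommGroup W] [NormedSpace ℝ W]

/-- The algebraic identities of an `SU(3)`-structure at one point. The condition `Ω ∧ ω = 0` is
automatic, as `Ω` is of type `(3,0)` and `ω` of type `(1,1)` in complex dimension three. -/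
structure IsSU3 (g : W →L[ℝ] W →L[ℝ] ℝ) (J : W →L[ℝ] W) (om : W [⋀^Fin 2]→L[ℝ] ℝ)
    (Ω : W [⋀^Fin 3]→L[ℝ] ℂ) (vol : W [⋀^Fin 6]→L[ℝ] ℝ) : Prop where
  symm : ∀ u v, g u v = g v u
  pos : ∀ u, u ≠ 0 → 0 < g u u
  J_sq : ∀ u, J (J u) = -u
  J_isometry : ∀ u v, g (J u) (J v) = g u v
  omega_eq : ∀ u v, om ![u, v] = g (J u) v
  Omega_type : ∀ u v w, Ω ![J u, v, w] = I * Ω ![u, v, w]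
  omega_cubed : wedge (wedge om om) om = (6 : ℝ) • vol
  Omega_wedge_conj : wedge Ω (conjForm Ω) = (-8 * I) • ofRealForm vol

/-- `z₀, z₁, z₂` is a unitary coframe of type `(1,0)` of `(W, g, J)`, and `E₀, E₁, E₂` is the dual
frame. -/
structure IsUnitaryFrame (g : W →L[ℝ] W →L[ℝ] ℝ) (J : W →L[ℝ] W)
    (z : Fin 3 → W →L[ℝ] ℂ) (E : Fin 3 → W) : Prop where
  dual : ∀ i j, z i (E j) = if i = j then 1 else 0
  map_J : ∀ i u, z i (J u) = I * z i u
  metric : ∀ u v, g u v = ∑ i, ((z i u).re * (z i v).re + (z i u).im * (z i v).im)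
  expand : ∀ u, u = ∑ i, ((z i u).re • E i + (z i u).im • J (E i))

/-- Multiplying the last covector of a unitary coframe by a complex number of modulus one. -/
theorem IsUnitaryFrame.rotate {g : W →L[ℝ] W →L[ℝ] ℝ} {J : W →L[ℝ] W}
    {z : Fin 3 → W →L[ℝ] ℂ} {E : Fin 3 → W} (h : IsUnitaryFrame g J z E)
    (hJ : ∀ u, J (J u) = -u) (μ : ℂ) (hμ : μ.re * μ.re + μ.im * μ.im = 1) :
    IsUnitaryFrame g J ![z 0, z 1, μ • z 2] ![E 0, E 1, μ.re • E 2 - μ.im • J (E 2)] where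
  dual i j := by
    fin_cases i <;> fin_cases j <;>
      simp [h.dual, h.map_J, Complex.ext_iff, mul_comm, hμ]
  map_J i u := by
    fin_cases i <;> simp [h.map_J]
    ring
  metric u v := by
    simp only [h.metric, Fin.sum_univ_three]
    simp
    linear_combination -((z 2 u).re * (z 2 v).re + (z 2 u).im * (z 2 v).im) * hμ
  expand u := by
    conv_lhs => rw [h.expand u]
    simp only [Fin.sum_univ_three]
    simp [hJ]
    have : (z 2 u).re • E 2 + (z 2 u).im • J (E 2)
      = (μ.re * μ.re + μ.im * μ.im) • ((z 2 u).re • E 2 + (z 2 u).im • J (E 2)) := by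
        rw [hμ, one_smul]
    rw [this]
    module

theorem exists_unit_orthogonal (hW : Module.finrank ℝ W = 6) [FiniteDimensional ℝ W]
    (g : W →L[ℝ] W →L[ℝ] ℝ) (pos : ∀ u, u ≠ 0 → 0 < g u u) {n : ℕ} (hn : n < 6)
    (f : Fin n → W) : ∃ u, g u u = 1 ∧ ∀ i, g (f i) u = 0 := by
  have h : LinearMap.ker (LinearMap.pi fun i => (g (f i)).toLinearMap) ≠ ⊥ :=
    LinearMap.ker_ne_bot_of_finrank_lt (by simpa [hW] using hn)
  obtain ⟨u, hu, hu0⟩ := Submodule.exists_mem_ne_zero_of_ne_bot h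
  have hu' : ∀ i, g (f i) u = 0 := fun i => congrFun (LinearMap.mem_ker.1 hu) i
  refine ⟨(√(g u u))⁻¹ • u, ?_, fun i => by simp [hu']⟩
  have := pos u hu0
  have h2 := Real.mul_self_sqrt this.le
  have h3 : √(g u u) ≠ 0 := (Real.sqrt_pos.2 this).ne'
  simp
  field_simp
  linarith [h2]

theorem orthonormal_expand (hW : Module.finrank ℝ W = 6) [FiniteDimensional ℝ W]
    (g : W →L[ℝ] W →L[ℝ] ℝ) (e : Fin 6 → W) (he : ∀ i j, g (e i) (e j) = if i = j then 1 else 0)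
    (u : W) : u = ∑ i, g (e i) u • e i := by
  let f : W →ₗ[ℝ] (Fin 6 → ℝ) := LinearMap.pi fun i => (g (e i)).toLinearMap
  have hf : ∀ v i, f v i = g (e i) v := fun _ _ => rfl
  have hs : ∀ c : Fin 6 → ℝ, f (∑ j, c j • e j) = c := fun c => by
    ext i
    simp [hf, he]
  have hsurj : Function.Surjective f := fun c => ⟨_, hs c⟩
  have hinj : Function.Injective f :=
    (LinearMap.injective_iff_surjective_of_finrank_eq_finrank (by simp [hW])).2 hsurj
  apply hinj
  rw [hs]
  rfl

/-- Unitary frames exist: each `E_k` is a unit vector orthogonal to the complex span of the previous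
ones. -/
theorem exists_unitaryFrame [FiniteDimensional ℝ W] (hW : Module.finrank ℝ W = 6)
    {g : W →L[ℝ] W →L[ℝ] ℝ} {J : W →L[ℝ] W} (symm : ∀ u v, g u v = g v u)
    (pos : ∀ u, u ≠ 0 → 0 < g u u) (J_sq : ∀ u, J (J u) = -u)
    (J_isometry : ∀ u v, g (J u) (J v) = g u v) : ∃ z E, IsUnitaryFrame g J z E := by
  have hJs : ∀ u v, g (J u) v = -g u (J v) := fun u v => by
    have := J_isometry u (J v)
    rw [J_sq, map_neg] at this
    linarith
  have hJ0 : ∀ u, g (J u) u = 0 := fun u => by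
    have := hJs u u
    rw [symm u] at this
    linarith
  obtain ⟨E0, n0, -⟩ := exists_unit_orthogonal hW g pos (show 0 < 6 by norm_num) ![]
  obtain ⟨E1, n1, o1⟩ := exists_unit_orthogonal hW g pos (show 2 < 6 by norm_num) ![E0, J E0]
  obtain ⟨E2, n2, o2⟩ := exists_unit_orthogonal hW g pos (show 4 < 6 by norm_num)
    ![E0, J E0, E1, J E1]
  have a1 : g E0 E1 = 0 := o1 0
  have a2 : g (J E0) E1 = 0 := o1 1
  have b1 : g E0 E2 = 0 := o2 0
  have b2 : g (J E0) E2 = 0 := o2 1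
  have b3 : g E1 E2 = 0 := o2 2
  have b4 : g (J E1) E2 = 0 := o2 3
  have a1' := (symm _ _).trans a1
  have a2' := (symm _ _).trans a2
  have b1' := (symm _ _).trans b1
  have b2' := (symm _ _).trans b2
  have b3' := (symm _ _).trans b3
  have b4' := (symm _ _).trans b4
  have hJs' : ∀ u v, g u (J v) = -g (J u) v := fun u v => by rw [hJs, neg_neg]
  set E : Fin 3 → W := ![E0, E1, E2] with hE
  have hEE : ∀ i j, g (E i) (E j) = if i = j then 1 else 0 := fun i j => by
    fin_cases i <;> fin_cases j <;> simp [*]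
  have hJE : ∀ i j, g (J (E i)) (E j) = 0 := fun i j => by
    fin_cases i <;> fin_cases j <;> simp [hE, hJ0, a2, b2, b4] <;>
      rw [hJs] <;> simp [a2', b2', b4']
  have hEJ : ∀ i j, g (E i) (J (E j)) = 0 := fun i j => by rw [hJs', hJE, neg_zero]
  let e : Fin 6 → W := ![E 0, J (E 0), E 1, J (E 1), E 2, J (E 2)]
  have he : ∀ i j, g (e i) (e j) = if i = j then 1 else 0 := fun i j => by
    fin_cases i <;> fin_cases j <;> simp [e, hEE, hJE, hEJ, J_isometry]
  have hexp := orthonormal_expand hW g e he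
  let z : Fin 3 → W →L[ℝ] ℂ := fun k =>
    Complex.ofRealCLM ∘L g (E k) + I • (Complex.ofRealCLM ∘L g (J (E k)))
  have hz : ∀ k u, z k u = g (E k) u + I * g (J (E k)) u := fun k u => rfl
  have hzre : ∀ k u, (z k u).re = g (E k) u := fun k u => by simp [hz]
  have hzim : ∀ k u, (z k u).im = g (J (E k)) u := fun k u => by simp [hz]
  have hdual : ∀ i j, z i (E j) = if i = j then 1 else 0 := fun i j => by
    rw [hz, hEE, hJE]; split_ifs <;> simp
  have hzJ : ∀ i u, z i (J u) = I * z i u := fun i u => by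
    rw [hz, hz, hJs', J_isometry]
    push_cast
    linear_combination -(g (J (E i)) u : ℂ) * I_mul_I
  have hexp' : ∀ u, u = ∑ i, ((z i u).re • E i + (z i u).im • J (E i)) := fun u => by
    conv_lhs => rw [hexp u]
    simp only [Fin.sum_univ_succ, Fin.sum_univ_zero, hzre, hzim]
    simp [e]
    abel
  have hmet : ∀ u v, g u v = ∑ i, ((z i u).re * (z i v).re + (z i u).im * (z i v).im) :=
    fun u v => by
      conv_lhs => rw [hexp' v]
      simp only [map_sum, map_add, map_smul, smul_eq_mul, hzre, hzim]
      refine Finset.sum_congr rfl fun i _ => ?_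
      rw [symm u, symm u]
      ring
  exact ⟨z, E, hdual, hzJ, hmet, hexp'⟩

/-- A form of type `(3,0)` is a multiple of `z₀ ∧ z₁ ∧ z₂`. -/
theorem IsUnitaryFrame.form_eq {g : W →L[ℝ] W →L[ℝ] ℝ} {J : W →L[ℝ] W}
    {z : Fin 3 → W →L[ℝ] ℂ} {E : Fin 3 → W} (h : IsUnitaryFrame g J z E)
    (Ω : W [⋀^Fin 3]→L[ℝ] ℂ) (hΩ : ∀ u v w, Ω ![J u, v, w] = I * Ω ![u, v, w]) (u v w : W) :
    Ω ![u, v, w] = Ω ![E 0, E 1, E 2] * det3 (z 0) (z 1) (z 2) u v w := by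
  set c := Ω ![E 0, E 1, E 2] with hc
  -- `Ω` is complex linear in each argument, so only its values on the `E_i` matter
  have hΩ1 : ∀ u v w, Ω ![u, v, w] = ∑ i, z i u * Ω ![E i, v, w] := fun u v w => by
    have hl : ∀ (f : W →L[ℝ] ℂ), f u = ∑ i, ((z i u).re • f (E i) + (z i u).im • f (J (E i))) :=
      fun f => by
        conv_lhs => rw [h.expand u]
        simp only [map_sum, map_add, map_smul]
    let f : W →L[ℝ] ℂ := Ω.toContinuousMultilinearMap.toContinuousLinearMap ![u, v, w] 0
    have hh : ∀ a, f a = Ω ![a, v, w] := fun a => by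
      change Ω (Function.update ![u, v, w] 0 a) = Ω ![a, v, w]
      congr 1
      ext i; fin_cases i <;> rfl
    rw [← hh u, hl f]
    refine Finset.sum_congr rfl fun i _ => ?_
    rw [hh, hh, hΩ]
    conv_rhs => rw [← Complex.re_add_im (z i u)]
    simp only [Complex.real_smul]
    ring
  have hΩ2 : ∀ u v w, Ω ![u, v, w] = ∑ i, z i v * Ω ![u, E i, w] := fun u v w => by
    rw [← neg_neg (Ω ![u, v, w]), ← alt_three_swap_left, hΩ1, ← Finset.sum_neg_distrib]
    refine Finset.sum_congr rfl fun i _ => ?_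
    rw [alt_three_swap_left, mul_neg, neg_neg]
  have hΩ3 : ∀ u v w, Ω ![u, v, w] = ∑ i, z i w * Ω ![u, v, E i] := fun u v w => by
    rw [← neg_neg (Ω ![u, v, w]), ← alt_three_swap_right, hΩ2, ← Finset.sum_neg_distrib]
    refine Finset.sum_congr rfl fun i _ => ?_
    rw [alt_three_swap_right, mul_neg, neg_neg]
  have hself1 : ∀ u w, Ω ![u, u, w] = 0 := fun u w =>
    Ω.map_eq_zero_of_eq _ (i := 0) (j := 1) rfl (by decide)
  have hself2 : ∀ u w, Ω ![w, u, u] = 0 := fun u w =>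
    Ω.map_eq_zero_of_eq _ (i := 1) (j := 2) rfl (by decide)
  have hself3 : ∀ u w, Ω ![u, w, u] = 0 := fun u w =>
    Ω.map_eq_zero_of_eq _ (i := 0) (j := 2) rfl (by decide)
  have p1 : Ω ![E 0, E 2, E 1] = -c := alt_three_swap_right _ _ _ _
  have p2 : Ω ![E 1, E 0, E 2] = -c := alt_three_swap_left _ _ _ _
  have p3 : Ω ![E 1, E 2, E 0] = c := by rw [alt_three_swap_right, p2, neg_neg]
  have p4 : Ω ![E 2, E 0, E 1] = c := by rw [alt_three_swap_left, p1, neg_neg]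
  have p5 : Ω ![E 2, E 1, E 0] = -c := by rw [alt_three_swap_right, p4]
  have p0 : Ω ![E 0, E 1, E 2] = c := hc.symm
  rw [hΩ1]
  simp only [hΩ2 _ v, hΩ3 _ _ w, Fin.sum_univ_three, hself1, hself2, hself3, p0, p1, p2, p3, p4, p5,
    det3]
  ring

/-- Permutations of `0, …, 5` whose last three values index the eight monomials of
`z₀ ∧ z₁ ∧ z₂`, the first three values being the complementary indices. -/
def su3Perm : Fin 8 → Equiv.Perm (Fin (3 + 3)) :=
  ![permOf ![1, 3, 5, 0, 2, 4] ![3, 0, 4, 1, 5, 2],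
    permOf ![1, 3, 4, 0, 2, 5] ![3, 0, 4, 1, 2, 5],
    permOf ![1, 2, 5, 0, 3, 4] ![3, 0, 1, 4, 5, 2],
    permOf ![1, 2, 4, 0, 3, 5] ![3, 0, 1, 4, 2, 5],
    permOf ![0, 3, 5, 1, 2, 4] ![0, 3, 4, 1, 5, 2],
    permOf ![0, 3, 4, 1, 2, 5] ![0, 3, 4, 1, 2, 5],
    permOf ![0, 2, 5, 1, 3, 4] ![0, 3, 1, 4, 5, 2],
    permOf ![0, 2, 4, 1, 3, 5] ![0, 3, 1, 4, 2, 5]]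

theorem sign_su3Perm (i : Fin 8) :
    Equiv.Perm.sign (su3Perm i) = ![1, -1, -1, 1, -1, 1, 1, -1] i := by
  revert i; decide

/-- Permutations of `0, …, 5` whose last two values index the three monomials of the Hermitian
form. -/
def omegaPerm : Fin 3 → Equiv.Perm (Fin (2 + 2 + 2)) :=
  ![permOf ![2, 3, 4, 5, 0, 1] ![4, 5, 0, 1, 2, 3],
    permOf ![0, 1, 4, 5, 2, 3] ![0, 1, 4, 5, 2, 3],
    permOf ![0, 1, 2, 3, 4, 5] ![0, 1, 2, 3, 4, 5]]

theorem sign_omegaPerm (i : Fin 3) : Equiv.Perm.sign (omegaPerm i) = 1 := by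
  revert i; decide

/-- The coordinates `Re z₀, Im z₀, …, Im z₂`. -/
def realCoords (z : Fin 3 → W →L[ℝ] ℂ) : Fin 6 → W →L[ℝ] ℝ :=
  ![reCLM ∘L z 0, imCLM ∘L z 0, reCLM ∘L z 1, imCLM ∘L z 1, reCLM ∘L z 2, imCLM ∘L z 2]

/-- The frame `E₀, JE₀, E₁, JE₁, E₂, JE₂`. -/
def realFrame (J : W →L[ℝ] W) (E : Fin 3 → W) : Fin 6 → W :=
  ![E 0, J (E 0), E 1, J (E 1), E 2, J (E 2)]

theorem IsUnitaryFrame.realCoords_realFrame {g : W →L[ℝ] W →L[ℝ] ℝ} {J : W →L[ℝ] W}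
    {z : Fin 3 → W →L[ℝ] ℂ} {E : Fin 3 → W} (h : IsUnitaryFrame g J z E) (i j : Fin 6) :
    realCoords z i (realFrame J E j) = if i = j then 1 else 0 := by
  fin_cases i <;> fin_cases j <;> simp [realCoords, realFrame, h.dual, h.map_J]

/-- The condition `ω³ = 6 vol` says that `vol` is the volume form of the complex orientation. -/
theorem IsUnitaryFrame.vol_eq_one {g : W →L[ℝ] W →L[ℝ] ℝ} {J : W →L[ℝ] W}
    {om : W [⋀^Fin 2]→L[ℝ] ℝ} {Ω : W [⋀^Fin 3]→L[ℝ] ℂ} {vol : W [⋀^Fin 6]→L[ℝ] ℝ}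
    {z : Fin 3 → W →L[ℝ] ℂ} {E : Fin 3 → W} (h : IsUnitaryFrame g J z E)
    (hs : IsSU3 g J om Ω vol) : vol (realFrame J E) = 1 := by
  have h2 : wedge (wedge om om) om (realFrame J E) = (6 : ℝ) • vol (realFrame J E) :=
    congrArg (fun β : W [⋀^Fin 6]→L[ℝ] ℝ => β (realFrame J E)) hs.omega_cubed
  have hβ : ∀ w : Fin 2 → W, om w = ∑ i, (1 : ℝ) *
      (Matrix.of fun k j => realCoords z (omegaPerm i (Fin.natAdd 4 j)) (w k)).det := fun w => by
    have hw : w = ![w 0, w 1] := by ext i; fin_cases i <;> rfl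
    have hw' : om w = g (J (w 0)) (w 1) := by rw [← hs.omega_eq, ← hw]
    rw [hw', h.metric]
    simp only [Fin.sum_univ_three, Matrix.det_fin_two, h.map_J]
    simp [realCoords, omegaPerm]
    ring
  have hd : ∀ i j : Fin (2 + 2 + 2), realCoords z i (realFrame J E j) = if i = j then 1 else 0 := by
    intro i j
    have := h.realCoords_realFrame i j
    convert this
  have h3 := wedge_apply_frame (p := 2 + 2) (q := 2) (realFrame J E) (realCoords z) hd
    (wedge om om) om omegaPerm (fun _ => 1) hβ
  replace h2 := h3.symm.trans h2
  simp only [sign_omegaPerm, Fin.sum_univ_three, wedge_two_two, hs.omega_eq, h.metric] at h2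
  simp [omegaPerm, realFrame, h.dual, h.map_J] at h2
  change vol ![E 0, J (E 0), E 1, J (E 1), E 2, J (E 2)] = 1
  linarith

/-- The condition `Ω ∧ Ω̄ = -8i vol` says that `Ω` has modulus one on unitary frames. -/
theorem IsUnitaryFrame.normSq_eq_one {g : W →L[ℝ] W →L[ℝ] ℝ} {J : W →L[ℝ] W}
    {om : W [⋀^Fin 2]→L[ℝ] ℝ} {Ω : W [⋀^Fin 3]→L[ℝ] ℂ} {vol : W [⋀^Fin 6]→L[ℝ] ℝ}
    {z : Fin 3 → W →L[ℝ] ℂ} {E : Fin 3 → W} (h : IsUnitaryFrame g J z E)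
    (hs : IsSU3 g J om Ω vol) : conj (Ω ![E 0, E 1, E 2]) * Ω ![E 0, E 1, E 2] = 1 := by
  have hΩ := h.form_eq Ω hs.Omega_type
  set c := Ω ![E 0, E 1, E 2]
  have h2 : wedge Ω (conjForm Ω) (realFrame J E) = ((-8 * I) • ofRealForm vol) (realFrame J E) :=
    congrArg (fun β : W [⋀^Fin 6]→L[ℝ] ℂ => β (realFrame J E)) hs.Omega_wedge_conj
  have h3 : ((-8 * I) • ofRealForm vol) (realFrame J E) = -8 * I := by
    change (-8 * I) * ((vol (realFrame J E) : ℝ) : ℂ) = _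
    rw [h.vol_eq_one hs]; simp
  have hβ : ∀ w : Fin 3 → W, conjForm Ω w
      = ∑ i, (conj c * ![1, -I, -I, -1, -I, -1, -1, I] i) *
        (Matrix.of fun k j => (ofRealCLM ∘L realCoords z (su3Perm i (Fin.natAdd 3 j)))
          (w k)).det := fun w => by
    have hw : w = ![w 0, w 1, w 2] := by ext i; fin_cases i <;> rfl
    have : conjForm Ω w = conj (Ω ![w 0, w 1, w 2]) := by rw [← hw]; rfl
    rw [this, hΩ]
    simp only [Fin.sum_univ_succ, Fin.sum_univ_zero, Matrix.det_fin_three, det3]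
    apply Complex.ext <;> simp [su3Perm, realCoords] <;> ring
  rw [h3, wedge_apply_frame (p := 3) (q := 3) (A := ℂ) (realFrame J E)
    (fun i => ofRealCLM ∘L realCoords z i)
    (fun i j => by
      simp only [ContinuousLinearMap.comp_apply, h.realCoords_realFrame]; split_ifs <;> simp)
    Ω (conjForm Ω) _ _ hβ] at h2
  have hv : ∀ i, (fun k : Fin 3 => realFrame J E (su3Perm i (Fin.castAdd 3 k)))
      = ![realFrame J E (su3Perm i 0), realFrame J E (su3Perm i 1),
        realFrame J E (su3Perm i 2)] := fun i => by
    ext k; fin_cases k <;> rfl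
  simp only [sign_su3Perm, hv, hΩ, Fin.sum_univ_succ, Fin.sum_univ_zero] at h2
  simp [su3Perm, realFrame, det3, h.dual, h.map_J] at h2
  exact mul_left_cancel₀ I_ne_zero (by linear_combination -(1 / 8) * h2)

/-- Any unit multiple of `Ω` is `z₀ ∧ z₁ ∧ z₂` for a unitary coframe: rotate the last covector of an
arbitrary one by the value of the form on the dual frame. -/
theorem IsSU3.exists_unitaryFrame [FiniteDimensional ℝ W] (hW : Module.finrank ℝ W = 6)
    {g : W →L[ℝ] W →L[ℝ] ℝ} {J : W →L[ℝ] W} {om : W [⋀^Fin 2]→L[ℝ] ℝ}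
    {Ω : W [⋀^Fin 3]→L[ℝ] ℂ} {vol : W [⋀^Fin 6]→L[ℝ] ℝ} (h : IsSU3 g J om Ω vol)
    (μ : ℂ) (hμ : conj μ * μ = 1) :
    ∃ z E, IsUnitaryFrame g J z E ∧
      ∀ u v w, μ * Ω ![u, v, w] = det3 (z 0) (z 1) (z 2) u v w := by
  obtain ⟨z, E, hz⟩ := G2Warped.exists_unitaryFrame hW h.symm h.pos h.J_sq h.J_isometry
  have hc := hz.normSq_eq_one h
  have h1 : conj (μ * Ω ![E 0, E 1, E 2]) * (μ * Ω ![E 0, E 1, E 2]) = 1 := by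
    rw [map_mul]
    linear_combination (conj (Ω ![E 0, E 1, E 2]) * Ω ![E 0, E 1, E 2]) * hμ + hc
  refine ⟨_, _, hz.rotate h.J_sq (μ * Ω ![E 0, E 1, E 2]) ?_, fun u v w => ?_⟩
  · rw [mul_comm, mul_conj, ofReal_eq_one] at h1
    exact h1
  · rw [hz.form_eq Ω h.Omega_type]
    simp [det3]
    ring

end SU3Algebra

/-! ### Nearly Kähler structures at a point -/

section NearlyKahlerAlgebra

open Complex ComplexConjugate

variable {W : Type*} [NormedAddCommGroup W] [NormedSpace ℝ W]
  {g : W →L[ℝ] W →L[ℝ] ℝ} {J : W →L[ℝ] W} {om : W [⋀^Fin 2]→L[ℝ] ℝ}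
  {Ω : W [⋀^Fin 3]→L[ℝ] ℂ} {vol : W [⋀^Fin 6]→L[ℝ] ℝ}
  {z : Fin 3 → W →L[ℝ] ℂ} {E : Fin 3 → W}

/-- The Hermitian form `g - i ω`, complex linear in the first argument. -/
def herm (g : W →L[ℝ] W →L[ℝ] ℝ) (J : W →L[ℝ] W) (u v : W) : ℂ := g u v - I * g (J u) v

theorem IsUnitaryFrame.herm_eq (h : IsUnitaryFrame g J z E) (u v : W) :
    herm g J u v = ∑ i, z i u * conj (z i v) := by
  simp only [herm, h.metric, h.map_J, Fin.sum_univ_three]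
  apply Complex.ext <;> simp
  ring

/-- `|Ω(a, b, c)|²` is the Gram determinant of the Hermitian form: this expresses the normalization
of `Ω` without reference to a frame, so that it can be differentiated. -/
theorem IsUnitaryFrame.normSq_form (h : IsUnitaryFrame g J z E)
    (hΩ : ∀ u v w, Ω ![u, v, w] = det3 (z 0) (z 1) (z 2) u v w) (a b c : W) :
    Ω ![a, b, c] * conj (Ω ![a, b, c])
      = herm g J a a * (herm g J b b * herm g J c c - herm g J b c * herm g J c b)
        - herm g J a b * (herm g J b a * herm g J c c - herm g J b c * herm g J c a)
        + herm g J a c * (herm g J b a * herm g J c b - herm g J b b * herm g J c a) := by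
  simp only [hΩ, det3, h.herm_eq, Fin.sum_univ_three, map_add, map_sub, map_mul]
  ring

/-- The cross product `P = P(u, v)` of an `SU(3)`-structure, given by `g(P, ·) = Re Ω(u, v, ·)`, and
the form `P ⌟ Ω`. -/
theorem IsUnitaryFrame.exists_cross (h : IsUnitaryFrame g J z E)
    (hΩ : ∀ u v w, Ω ![u, v, w] = det3 (z 0) (z 1) (z 2) u v w) (u v : W) :
    ∃ P, (∀ w, g P w = (Ω ![u, v, w]).re) ∧ ∀ w x, Ω ![P, w, x]
      = herm g J w u * herm g J x v - herm g J x u * herm g J w v := by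
  let p : Fin 3 → ℂ := ![conj (z 1 u * z 2 v - z 2 u * z 1 v),
    conj (z 2 u * z 0 v - z 0 u * z 2 v), conj (z 0 u * z 1 v - z 1 u * z 0 v)]
  refine ⟨∑ i, ((p i).re • E i + (p i).im • J (E i)), ?_⟩
  have hP : ∀ k, z k (∑ i, ((p i).re • E i + (p i).im • J (E i))) = p k := fun k => by
    simp only [Fin.sum_univ_three, map_add, map_smul, h.map_J, h.dual]
    fin_cases k <;> apply Complex.ext <;> simp
  generalize (∑ i, ((p i).re • E i + (p i).im • J (E i))) = P at hP
  refine ⟨fun w => ?_, fun w x => ?_⟩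
  · simp only [h.metric, hΩ, det3, hP, Fin.sum_univ_three]
    simp [p]
    ring
  · simp only [hΩ, det3, h.herm_eq, hP, Fin.sum_univ_three]
    simp [p]
    ring

/-- The form `Ω` is nondegenerate. -/
theorem IsUnitaryFrame.eq_zero_of_form (h : IsUnitaryFrame g J z E)
    (hΩ : ∀ u v w, Ω ![u, v, w] = det3 (z 0) (z 1) (z 2) u v w) (X : W)
    (hX : ∀ v w, Ω ![X, v, w] = 0) : X = 0 := by
  have h0 := hX (E 1) (E 2)
  have h1 := hX (E 0) (E 2)
  have h2 := hX (E 0) (E 1)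
  simp only [hΩ, det3, h.dual] at h0 h1 h2
  simp at h0 h1 h2
  rw [h.expand X]
  simp [Fin.sum_univ_three, h0, h1, h2]

/-- The covariant derivative `∇_u Ω = λ (u + i Ju)♭ ∧ ω` of `Ω` on a nearly Kähler manifold,
evaluated on `v, w, x`. -/
def nablaOmega (g : W →L[ℝ] W →L[ℝ] ℝ) (J : W →L[ℝ] W) (lam : ℝ) (u v w x : W) : ℂ :=
  lam * (herm g J v u * g (J w) x + herm g J w u * g (J x) v + herm g J x u * g (J v) w)

/-- The derivatives of `ω` and `Ω` on a nearly Kähler manifold are determined by `dω` and `dΩ`.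
Here `a u` and `B u` stand for `∇_u ω` and `∇_u Ω`, and `K u` for `∇_u J`. The hypotheses are the
derivatives of the algebraic identities between `g`, `J`, `ω` and `Ω` and the two structure
equations; `hN` is the derivative of the normalization of `Ω`. The conclusion is that the
differences `C` and `B'` between these derivatives and the claimed values, which satisfy
homogeneous equations of the same kind, vanish. -/
theorem nearlyKahler_pointwise [FiniteDimensional ℝ W] (hW : Module.finrank ℝ W = 6)
    (h : IsSU3 g J om Ω vol) (lam : ℝ) (a : W → W [⋀^Fin 2]→L[ℝ] ℝ) (B : W → W [⋀^Fin 3]→L[ℝ] ℂ)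
    (K : W → W → W) (haK : ∀ u v w, a u ![v, w] = g (K u v) w)
    (haJ : ∀ u v w, a u ![J v, w] = a u ![v, J w])
    (hBK : ∀ u v w x, B u ![J v, w, x] + Ω ![K u v, w, x] = I * B u ![v, w, x])
    (hda : ∀ u v w, a u ![v, w] - a v ![u, w] + a w ![u, v] = -3 * lam * (Ω ![u, v, w]).re)
    (hdB : ∀ u v w x, B u ![v, w, x] - B v ![u, w, x] + B w ![u, v, x] - B x ![u, v, w]
      = 4 * lam * I * (om ![u, v] * om ![w, x] - om ![u, w] * om ![v, x] + om ![u, x] * om ![v, w]))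
    (hN : ∀ z E, IsUnitaryFrame g J z E →
      (∀ u v w, Ω ![u, v, w] = det3 (z 0) (z 1) (z 2) u v w) → ∀ u, (B u ![E 0, E 1, E 2]).re = 0) :
    (∀ u v w, a u ![v, w] = -lam * (Ω ![u, v, w]).re) ∧
      ∀ u v w x, B u ![v, w, x] = nablaOmega g J lam u v w x := by
  obtain ⟨z, E, hz, hΩ'⟩ := h.exists_unitaryFrame hW 1 (by simp)
  simp only [one_mul] at hΩ'
  have hJs : ∀ u v, g u (J v) = -g (J u) v := fun u v => by
    have := h.J_isometry (J u) v
    rw [h.J_sq, map_neg] at this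
    simpa [neg_eq_iff_eq_neg] using this
  have hΩ1 := h.Omega_type
  have hΩ2 : ∀ u v w, Ω ![u, J v, w] = I * Ω ![u, v, w] := fun u v w => by
    rw [alt_three_swap_left, hΩ1, alt_three_swap_left Ω u v]; ring
  have hΩ3 : ∀ u v w, Ω ![u, v, J w] = I * Ω ![u, v, w] := fun u v w => by
    rw [alt_three_swap_right, hΩ2, alt_three_swap_right Ω u v]; ring
  choose P hP hPΩ using fun u v => hz.exists_cross hΩ' u v
  -- `C` measures the failure of the first formula
  let C : W → W → W → ℝ := fun u v w => a u ![v, w] + lam * (Ω ![u, v, w]).re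
  have hC : ∀ u v w, C u v w = a u ![v, w] + lam * (Ω ![u, v, w]).re := fun _ _ _ => rfl
  let K' : W → W → W := fun u v => K u v + lam • P u v
  have hK' : ∀ u v w, g (K' u v) w = C u v w := fun u v w => by
    simp [K', hC, haK, hP]
  have hCalt : ∀ u v w, C u w v = -C u v w := fun u v w => by
    rw [hC, hC, alt_two_swap, alt_three_swap_right]; simp; ring
  have hCJ : ∀ u v w, C u (J v) w = C u v (J w) := fun u v w => by
    rw [hC, hC, haJ, hΩ2, hΩ3]
  have hCJJ : ∀ u v w, C u (J v) (J w) = -C u v w := fun u v w => by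
    rw [hCJ, h.J_sq, hC, hC]
    have h1 : a u ![v, -w] = -a u ![v, w] := by
      have := alt_two_swap (a u) v w
      rw [haK, haK]; simp
    have h2 : Ω ![u, v, -w] = -Ω ![u, v, w] := by
      rw [hΩ', hΩ']; simp [det3]; ring
    rw [h1, h2]; simp; ring
  -- the equation for `dω`
  have hcyc : ∀ u v w, C u v w + C v w u + C w u v = 0 := fun u v w => by
    have e1 := hda u v w
    rw [hC, hC, hC, alt_three_swap_right Ω v u w, alt_three_swap_left Ω u v w,
      alt_three_swap_left Ω u w v, alt_three_swap_right Ω u v w, alt_two_swap (a v) u w]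
    simp only [neg_neg]
    linear_combination e1
  -- the cyclic identity at `(Ju, v, w)`, `(u, Jv, w)`, `(u, v, Jw)` and `(Ju, Jv, Jw)`
  have hCtype : ∀ u v w, C (J u) v w = C u (J v) w := fun u v w => by
    have e1 := hcyc (J u) v w
    have e2 := hcyc u (J v) w
    have e3 := hcyc u v (J w)
    have e4 := hcyc (J u) (J v) (J w)
    simp only [hCJJ] at e1 e2 e3 e4
    simp only [← hCJ] at e1 e2 e3 e4
    linarith
  let B' : W → W → W → W → ℂ := fun u v w x => B u ![v, w, x] - nablaOmega g J lam u v w x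
  have hω : ∀ u v, g (J v) u = -g (J u) v := fun u v => by rw [← hJs, h.symm]
  have hB' : ∀ u v w x, B' u v w x = B u ![v, w, x] - nablaOmega g J lam u v w x :=
    fun _ _ _ _ => rfl
  have hωH : ∀ u v, om ![u, v] = g (J u) v := h.omega_eq
  -- `B' u` fails to be of type `(3,0)` by the term `K'`
  have hB1 : ∀ u v w x, B' u (J v) w x = I * B' u v w x - Ω ![K' u v, w, x] := fun u v w x => by
    have e1 := hBK u v w x
    have e2 : Ω ![K' u v, w, x] = Ω ![K u v, w, x] + lam * Ω ![P u v, w, x] := by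
      simp only [hΩ', K', det3, map_add, map_smul, Complex.real_smul]; ring
    rw [e2, hPΩ, hB', hB']
    simp only [nablaOmega, herm, h.J_sq, hJs, map_neg, neg_apply,
      ofReal_neg]
    rw [h.symm x v, h.symm w v, h.symm w u, h.symm x u, h.symm v u]
    rw [hω w v]
    push_cast
    linear_combination e1 - lam * g (J v) u * g (J w) x * I_mul_I
  -- the equation for `dΩ`
  have hBalt : ∀ u v w x, B' u v w x - B' v u w x + B' w u v x - B' x u v w = 0 :=
    fun u v w x => by
      have e1 := hdB u v w x
      simp only [hωH] at e1
      rw [hB', hB', hB', hB']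
      simp only [nablaOmega, herm]
      rw [h.symm v u, h.symm w u, h.symm w v, h.symm x u, h.symm x v, h.symm x w, hω u v, hω u w,
        hω v w, hω u x, hω v x, hω w x]
      push_cast
      linear_combination e1
  have hB2 : ∀ u v w x, B' u w v x = -B' u v w x := fun u v w x => by
    rw [hB', hB', alt_three_swap_left]
    simp only [nablaOmega]
    rw [hω v x, hω x w, hω v w]
    push_cast
    ring
  have hB3 : ∀ u v w x, B' u v (J w) x = I * B' u v w x + Ω ![K' u w, v, x] := fun u v w x => by
    rw [hB2, hB1, hB2]; ring
  have ginj : ∀ X Y, (∀ w, g X w = g Y w) → X = Y := fun X Y hXY => by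
    by_contra hne
    have h1 := h.pos _ (sub_ne_zero.2 hne)
    have h2 : g (X - Y) (X - Y) = g X (X - Y) - g Y (X - Y) := by
      simp only [map_sub g, sub_apply]
    rw [h2, hXY, sub_self] at h1
    exact lt_irrefl _ h1
  have hK1 : ∀ u v, K' u (J v) = -J (K' u v) := fun u v => ginj _ _ fun w => by
    rw [hK', hCJ, ← hK', hJs]; simp
  have hK2 : ∀ u v, K' (J u) v = -J (K' u v) := fun u v => ginj _ _ fun w => by
    rw [hK', hCtype, ← hK', hK1]
  have hΩneg : ∀ u v w, Ω ![-J u, v, w] = -(I * Ω ![u, v, w]) := fun u v w => by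
    rw [← hΩ1, hΩ', hΩ']; simp [det3]; ring
  -- the equation for `dΩ` at `(Ju, Jv)`, `(Ju, v)`, `(u, Jv)` and `(u, v)`, combined so that all
  -- terms with `B'` cancel, leaves only the skew part of `K'`
  have hKsymm : ∀ u v, K' u v = K' v u := fun u v => by
    rw [← sub_eq_zero]
    refine hz.eq_zero_of_form hΩ' _ fun w x => ?_
    have X1 := hBalt (J u) (J v) w x
    have X2 := hBalt (J u) v w x
    have X3 := hBalt u (J v) w x
    have X4 := hBalt u v w x
    simp only [hB1, hB3, hK2, hΩneg, hΩ2] at X1 X2 X3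
    have e : Ω ![K' u v - K' v u, w, x] = Ω ![K' u v, w, x] - Ω ![K' v u, w, x] := by
      simp only [hΩ', det3, map_sub]; ring
    rw [e]
    refine (mul_eq_zero.1 (?_ : (2 * I) * (Ω ![K' u v, w, x] - Ω ![K' v u, w, x]) = 0)).resolve_left
      (by simp)
    linear_combination X1 - I * X2 - I * X3 - X4
      + (B' u v w x - B' v u w x + B' w u v x - B' x u v w) * I_mul_I
  -- a trilinear form symmetric in two arguments and skew in two arguments vanishes
  have hC0 : ∀ u v w, C u v w = 0 := fun u v w => by
    have hs : ∀ u v w, C u v w = C v u w := fun u v w => by rw [← hK', hKsymm, hK']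
    have e1 := hs u v w
    have e2 := hCalt v u w
    have e3 := hs v w u
    have e4 := hCalt w v u
    have e5 := hs w u v
    have e6 := hCalt u v w
    linarith
  have hK0 : ∀ u v, K' u v = 0 := fun u v => ginj _ _ fun w => by
    rw [hK', hC0]; simp
  refine ⟨fun u v w => by linarith [hC0 u v w, hC u v w], ?_⟩
  have hΩ0 : ∀ v w, Ω ![0, v, w] = 0 := fun v w => by rw [hΩ']; simp [det3]
  have hE : ∀ i j, g (J (E i)) (E j) = 0 := fun i j => by
    rw [hz.metric, Fin.sum_univ_three]
    fin_cases i <;> fin_cases j <;> simp [hz.map_J, hz.dual]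
  -- `B' u` is now of type `(3,0)`, hence a multiple of `Ω`
  have hBΩ : ∀ u v w x, B' u v w x = B u ![E 0, E 1, E 2] * Ω ![v, w, x] := fun u => by
    let α : W →L[ℝ] ℂ := ofRealCLM ∘L g u - I • (ofRealCLM ∘L g u ∘L J)
    let β : W [⋀^Fin 3]→L[ℝ] ℂ := B u - (lam : ℂ) •
      (wedge (ContinuousAlternatingMap.ofSubsingleton ℝ W ℂ (0 : Fin 1) α) (ofRealForm om) :
        W [⋀^Fin (1 + 2)]→L[ℝ] ℂ)
    have hβ : ∀ v w x, β ![v, w, x] = B' u v w x := fun v w x => by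
      have e1 : (wedge (ContinuousAlternatingMap.ofSubsingleton ℝ W ℂ (0 : Fin 1) α)
          (ofRealForm om) : W [⋀^Fin (1 + 2)]→L[ℝ] ℂ) ![v, w, x]
          = α v * (om ![w, x] : ℝ) - α w * (om ![v, x] : ℝ) + α x * (om ![v, w] : ℝ) :=
        wedge_one_two _ _ _
      have e2 : ∀ v, α v = herm g J v u := fun v => by
        rw [herm, h.symm v, h.symm (J v)]; rfl
      have e3 : β ![v, w, x] = B u ![v, w, x]
          - lam * (α v * (om ![w, x] : ℝ) - α w * (om ![v, x] : ℝ) + α x * (om ![v, w] : ℝ)) := by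
        rw [← e1]; rfl
      rw [e3, hB', nablaOmega, e2, e2, e2, hωH, hωH, hωH, hω v x]
      push_cast
      ring
    intro v w x
    have e1 := hz.form_eq β (fun v w x => by rw [hβ, hβ, hB1, hK0, hΩ0, sub_zero]) v w x
    rw [hβ, hβ, ← hΩ'] at e1
    rw [e1, hB']
    simp [nablaOmega, hE]
  -- the factor is complex linear in `u` by the equation for `dΩ`, and imaginary by `hN`
  have hcJ : ∀ u, B (J u) ![E 0, E 1, E 2] = I * B u ![E 0, E 1, E 2] := fun u => by
    have X1 := hBalt (J u) (E 0) (E 1) (E 2)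
    have X2 := hBalt u (E 0) (E 1) (E 2)
    have hE1 : Ω ![E 0, E 1, E 2] = 1 := by rw [hΩ']; simp [det3, hz.dual]
    simp only [hBΩ, hE1, hΩ1] at X1 X2
    linear_combination X1 - I * X2
  have hre := hN z E hz hΩ'
  have hB0 : ∀ u, B u ![E 0, E 1, E 2] = 0 := fun u => by
    have h1 := hre (J u)
    rw [hcJ] at h1
    simp at h1
    exact Complex.ext (hre u) h1
  intro u v w x
  have h1 := hBΩ u v w x
  rw [hB0, zero_mul, hB', sub_eq_zero] at h1
  exact h1

end NearlyKahlerAlgebra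

/-! ### The derivatives of `ω` and `Ω` in coordinates -/

section NearlyKahlerDerivative

open Complex ComplexConjugate

variable {W : Type*} [NormedAddCommGroup W] [NormedSpace ℝ W]

/-- The action of an endomorphism on a form, as a derivation. -/
def derivationForm {k : ℕ} {A : Type*} [NormedAddCommGroup A] [NormedSpace ℝ A]
    (α : W [⋀^Fin k]→L[ℝ] A) (S : W →L[ℝ] W) : W [⋀^Fin k]→L[ℝ] A :=
  α.fderivCompContinuousLinearMap (ContinuousLinearMap.id ℝ W) S

theorem derivationForm_two {A : Type*} [NormedAddCommGroup A] [NormedSpace ℝ A]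
    (α : W [⋀^Fin 2]→L[ℝ] A) (S : W →L[ℝ] W) (v w : W) :
    derivationForm α S ![v, w] = α ![S v, w] + α ![v, S w] := by
  rw [derivationForm, ContinuousAlternatingMap.fderivCompContinuousLinearMap_apply,
    Fin.sum_univ_two]
  congr 2 <;> ext i <;> fin_cases i <;> simp

theorem derivationForm_three {A : Type*} [NormedAddCommGroup A] [NormedSpace ℝ A]
    (α : W [⋀^Fin 3]→L[ℝ] A) (S : W →L[ℝ] W) (v w x : W) :
    derivationForm α S ![v, w, x] = α ![S v, w, x] + α ![v, S w, x] + α ![v, w, S x] := by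
  rw [derivationForm, ContinuousAlternatingMap.fderivCompContinuousLinearMap_apply,
    Fin.sum_univ_three]
  congr 2
  · congr 1; ext i; fin_cases i <;> simp
  · congr 1; ext i; fin_cases i <;> simp
  · ext i; fin_cases i <;> simp

/-- A function with values in the operators on a finite-dimensional space is differentiable if its
values at each vector are. -/
theorem differentiableAt_clm_of_apply {D F : Type*} [NormedAddCommGroup D] [NormedSpace ℝ D]
    [NormedAddCommGroup F] [NormedSpace ℝ F] [FiniteDimensional ℝ W] {f : D → W →L[ℝ] F} {c : D}
    (h : ∀ v, DifferentiableAt ℝ (fun η => f η v) c) : DifferentiableAt ℝ f c := by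
  let b := Module.finBasis ℝ W
  have e : f = fun η =>
      ∑ i, (LinearMap.toContinuousLinearMap (b.coord i)).smulRight (f η (b i)) := by
    ext η v
    conv_lhs => rw [← b.sum_repr v, map_sum]
    simp
  rw [e]
  refine DifferentiableAt.fun_sum fun i _ => ?_
  exact ((ContinuousLinearMap.smulRightL ℝ W F
    (LinearMap.toContinuousLinearMap (b.coord i))).differentiableAt).comp c (h (b i))

/-- The derivative of a `3 × 3` determinant at the identity matrix is the trace. -/
theorem hasDerivAt_det_three {H : Fin 3 → Fin 3 → ℝ → ℂ} {H' : Fin 3 → Fin 3 → ℂ}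
    (hH : ∀ i j, HasDerivAt (H i j) (H' i j) 0) (h0 : ∀ i j, H i j 0 = if i = j then 1 else 0) :
    HasDerivAt (fun t => H 0 0 t * (H 1 1 t * H 2 2 t - H 1 2 t * H 2 1 t)
        - H 0 1 t * (H 1 0 t * H 2 2 t - H 1 2 t * H 2 0 t)
        + H 0 2 t * (H 1 0 t * H 2 1 t - H 1 1 t * H 2 0 t)) (H' 0 0 + H' 1 1 + H' 2 2) 0 := by
  have := (((hH 0 0).mul (((hH 1 1).mul (hH 2 2)).sub ((hH 1 2).mul (hH 2 1)))).sub
    ((hH 0 1).mul (((hH 1 0).mul (hH 2 2)).sub ((hH 1 2).mul (hH 2 0))))).add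
    ((hH 0 2).mul (((hH 1 0).mul (hH 2 1)).sub ((hH 1 1).mul (hH 2 0))))
  convert! this using 1
  simp [h0, add_assoc]

variable {gh : W → W →L[ℝ] W →L[ℝ] ℝ} {Jh : W → W →L[ℝ] W} {oh : W → W [⋀^Fin 2]→L[ℝ] ℝ}
  {Oh : W → W [⋀^Fin 3]→L[ℝ] ℂ} {vol : W [⋀^Fin 6]→L[ℝ] ℝ} {c : W}

/-- The almost complex structure is differentiable, since it is determined by `g` and `ω` through
`ω = g(J ·, ·)`. Its smoothness is not part of the definition of an `SU(3)`-structure. -/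
theorem differentiableAt_complexStructure [FiniteDimensional ℝ W] (hdg : DifferentiableAt ℝ gh c)
    (hdo : DifferentiableAt ℝ oh c) (pos : ∀ u, u ≠ 0 → 0 < gh c u u)
    (hom : ∀ᶠ η in 𝓝 c, ∀ u v, oh η ![u, v] = gh η (Jh η u) v) : DifferentiableAt ℝ Jh c := by
  have : CompleteSpace W := FiniteDimensional.complete ℝ W
  have hinj : Function.Injective (gh c) := by
    refine (injective_iff_map_eq_zero (gh c)).2 fun u hu => ?_
    by_contra hne
    have := pos u hne
    rw [hu] at this
    exact lt_irrefl _ this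
  have hfr : Module.finrank ℝ W = Module.finrank ℝ (W →L[ℝ] ℝ) := by
    rw [← (LinearMap.toContinuousLinearMap (𝕜 := ℝ) (E := W) (F' := ℝ)).finrank_eq]
    exact (Subspace.dual_finrank_eq (K := ℝ) (V := W)).symm
  let e : W ≃L[ℝ] (W →L[ℝ] ℝ) :=
    (LinearEquiv.ofInjectiveOfFinrankEq (gh c).toLinearMap hinj hfr).toContinuousLinearEquiv
  have he : (e : W →L[ℝ] (W →L[ℝ] ℝ)) = gh c := by ext; rfl
  have hev : ∀ᶠ η in 𝓝 c, ∃ e' : W ≃L[ℝ] (W →L[ℝ] ℝ), (e' : W →L[ℝ] (W →L[ℝ] ℝ)) = gh η := by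
    have := e.nhds
    rw [he] at this
    exact hdg.continuousAt this
  have hinv : DifferentiableAt ℝ (fun η => ContinuousLinearMap.inverse (gh η)) c := by
    have h1 : DifferentiableAt ℝ ContinuousLinearMap.inverse (gh c) := by
      rw [← he]
      exact (contDiffAt_map_inverse (n := 1) e).differentiableAt (by simp)
    exact DifferentiableAt.comp (𝕜 := ℝ) (E := W) (F := W →L[ℝ] W →L[ℝ] ℝ)
      (G := (W →L[ℝ] ℝ) →L[ℝ] W) (f := gh) c h1 hdg
  refine differentiableAt_clm_of_apply fun u => ?_
  have hq : DifferentiableAt ℝ (fun η => gh η (Jh η u)) c := by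
    refine differentiableAt_clm_of_apply fun v => ?_
    refine DifferentiableAt.congr_of_eventuallyEq
      (hdo.continuousAlternatingMap_apply (g := fun i _ => ![u, v] i)
        fun i => differentiableAt_const _) ?_
    filter_upwards [hom] with η h1
    exact (h1 u v).symm
  refine (hinv.clm_apply hq).congr_of_eventuallyEq ?_
  filter_upwards [hev] with η ⟨e', he'⟩
  rw [← he', ContinuousLinearMap.inverse_equiv]
  exact (e'.symm_apply_apply _).symm

/-- The derivatives of `ω` and `Ω` on a nearly Kähler manifold, in a chart. Here `γ` is the
Christoffel tensor at the point `c` of the chart. The identities `hsq`, `hom`, `hOm` and `hN`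
between the tensor fields are differentiated at `c` and corrected by `γ`, which turns them into the
hypotheses of `nearlyKahler_pointwise` for the covariant derivatives. -/
theorem nearlyKahler_chart [FiniteDimensional ℝ W] (hW : Module.finrank ℝ W = 6)
    (h : IsSU3 (gh c) (Jh c) (oh c) (Oh c) vol) (hdg : DifferentiableAt ℝ gh c)
    (hdo : DifferentiableAt ℝ oh c) (hdO : DifferentiableAt ℝ Oh c)
    (hsq : ∀ᶠ η in 𝓝 c, ∀ u, Jh η (Jh η u) = -u)
    (hom : ∀ᶠ η in 𝓝 c, ∀ u v, oh η ![u, v] = gh η (Jh η u) v)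
    (hOm : ∀ᶠ η in 𝓝 c, ∀ u v w, Oh η ![Jh η u, v, w] = I * Oh η ![u, v, w])
    (hN : ∀ᶠ η in 𝓝 c, ∀ u v w, Oh η ![u, v, w] * conj (Oh η ![u, v, w])
      = herm (gh η) (Jh η) u u * (herm (gh η) (Jh η) v v * herm (gh η) (Jh η) w w
            - herm (gh η) (Jh η) v w * herm (gh η) (Jh η) w v)
        - herm (gh η) (Jh η) u v * (herm (gh η) (Jh η) v u * herm (gh η) (Jh η) w w
            - herm (gh η) (Jh η) v w * herm (gh η) (Jh η) w u)
        + herm (gh η) (Jh η) u w * (herm (gh η) (Jh η) v u * herm (gh η) (Jh η) w v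
            - herm (gh η) (Jh η) v v * herm (gh η) (Jh η) w u))
    (γ : W →L[ℝ] W →L[ℝ] W) (γsymm : ∀ u v, γ u v = γ v u)
    (hγ : ∀ u v w, fderiv ℝ gh c u v w = gh c (γ v u) w + gh c v (γ w u)) (lam : ℝ)
    (hd2 : ∀ u v w, fderiv ℝ oh c u ![v, w] - fderiv ℝ oh c v ![u, w] + fderiv ℝ oh c w ![u, v]
      = -3 * lam * (Oh c ![u, v, w]).re)
    (hd3 : ∀ u v w x, fderiv ℝ Oh c u ![v, w, x] - fderiv ℝ Oh c v ![u, w, x]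
        + fderiv ℝ Oh c w ![u, v, x] - fderiv ℝ Oh c x ![u, v, w]
      = 4 * lam * I * (oh c ![u, v] * oh c ![w, x] - oh c ![u, w] * oh c ![v, x]
        + oh c ![u, x] * oh c ![v, w])) :
    (∀ u v w, fderiv ℝ oh c u ![v, w]
      = oh c ![γ v u, w] + oh c ![v, γ w u] - lam * (Oh c ![u, v, w]).re) ∧
    ∀ u v w x, fderiv ℝ Oh c u ![v, w, x]
      = Oh c ![γ v u, w, x] + Oh c ![v, γ w u, x] + Oh c ![v, w, γ x u]
        + nablaOmega (gh c) (Jh c) lam u v w x := by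
  have hdJ := differentiableAt_complexStructure hdg hdo h.pos hom
  have hsq' : ∀ u v, fderiv ℝ Jh c u (Jh c v) + Jh c (fderiv ℝ Jh c u v) = 0 := fun u v => by
    have e1 : (fun η => Jh η (Jh η v)) =ᶠ[𝓝 c] fun _ => -v := by
      filter_upwards [hsq] with η hη using hη v
    have e2 := (hdJ.hasFDerivAt.clm_apply (hdJ.hasFDerivAt.clm_apply (hasFDerivAt_const v c)))
    have e3 := congrArg (fun T : W →L[ℝ] W => T u) (e2.unique
      ((hasFDerivAt_const (-v) c).congr_of_eventuallyEq e1))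
    simpa [add_comm] using e3
  have hom' : ∀ u v w, fderiv ℝ oh c u ![v, w]
      = fderiv ℝ gh c u (Jh c v) w + gh c (fderiv ℝ Jh c u v) w := fun u v w => by
    have e1 : (fun η => oh η ![v, w]) =ᶠ[𝓝 c] fun η => gh η (Jh η v) w := by
      filter_upwards [hom] with η hη using hη v w
    have e2 := (hdg.hasFDerivAt.clm_apply (hdJ.hasFDerivAt.clm_apply
      (hasFDerivAt_const v c))).clm_apply (hasFDerivAt_const w c)
    have e4 := (hdo.hasFDerivAt.continuousAlternatingMap_apply
      (fun i => hasFDerivAt_const (![v, w] i) c))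
    have e3 := congrArg (fun T : W →L[ℝ] ℝ => T u) (e4.unique (e2.congr_of_eventuallyEq e1))
    simpa [add_comm] using e3
  have hOm' : ∀ u v w x, fderiv ℝ Oh c u ![Jh c v, w, x] + Oh c ![fderiv ℝ Jh c u v, w, x]
      = I * fderiv ℝ Oh c u ![v, w, x] := fun u v w x => by
    have e1 : (fun η => Oh η ![Jh η v, w, x]) =ᶠ[𝓝 c] fun η => I * Oh η ![v, w, x] := by
      filter_upwards [hOm] with η hη using hη v w x
    have e2 := e1.fderiv_eq (𝕜 := ℝ)
    have e3 := congrArg (fun T : W →L[ℝ] ℂ => T u) e2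
    have hv : ∀ η, ![Jh η v, w, x] = fun i => ![fun η => Jh η v, fun _ => w, fun _ => x] i η :=
      fun η => by ext i; fin_cases i <;> rfl
    have hdi : ∀ i, DifferentiableAt ℝ (![fun η => Jh η v, fun _ => w, fun _ => x] i) c := by
      intro i
      fin_cases i
      · exact hdJ.clm_apply (differentiableAt_const _)
      · exact differentiableAt_const _
      · exact differentiableAt_const _
    simp only [hv] at e3
    rw [fderiv_continuousAlternatingMap_apply_apply hdO hdi, fderiv_const_mul
      (hdO.continuousAlternatingMap_apply (g := fun i _ => ![v, w, x] i)
        fun i => differentiableAt_const _)] at e3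
    have e4 := fderiv_continuousAlternatingMap_apply_apply hdO
      (g := fun i _ => ![v, w, x] i) (fun i => differentiableAt_const _) u
    have e5 : fderiv ℝ (fun η => Jh η v) c u = fderiv ℝ Jh c u v := by
      rw [fderiv_clm_apply hdJ (differentiableAt_const _)]
      simp
    rw [← hv, Fin.sum_univ_three] at e3
    simp at e3 e4
    rw [e4, e5] at e3
    rw [← e3]
    congr 2
    ext i; fin_cases i <;> rfl
  -- the derivative of `|Ω(E₀, E₁, E₂)|²` along the line `c + t u`, with `E` constant in the chart
  have hNre : ∀ z E, IsUnitaryFrame (gh c) (Jh c) z E →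
      (∀ u v w, Oh c ![u, v, w] = det3 (z 0) (z 1) (z 2) u v w) →
      ∀ u, (fderiv ℝ Oh c u ![E 0, E 1, E 2]).re
        = gh c (γ (E 0) u) (E 0) + gh c (γ (E 1) u) (E 1) + gh c (γ (E 2) u) (E 2) := by
    intro z E hz hΩ u
    have ho : HasDerivAt (fun t : ℝ => Oh (c + t • u) ![E 0, E 1, E 2])
        (fderiv ℝ Oh c u ![E 0, E 1, E 2]) 0 := by
      have e1 := (hdO.continuousAlternatingMap_apply (g := fun i _ => ![E 0, E 1, E 2] i)
        fun i => differentiableAt_const _).hasFDerivAt.hasLineDerivAt u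
      rw [fderiv_continuousAlternatingMap_apply_apply hdO
        (g := fun i _ => ![E 0, E 1, E 2] i) (fun i => differentiableAt_const _) u] at e1
      simpa [HasLineDerivAt] using e1
    let H : Fin 3 → Fin 3 → ℝ → ℂ := fun i j t =>
      (gh (c + t • u) (E i) (E j) : ℂ) - I * (oh (c + t • u) ![E i, E j] : ℝ)
    have hH : ∀ i j, HasDerivAt (H i j) ((fderiv ℝ gh c u (E i) (E j) : ℝ)
        - I * (fderiv ℝ oh c u ![E i, E j] : ℝ)) 0 := fun i j => by
      have e1 : HasDerivAt (fun t : ℝ => gh (c + t • u) (E i) (E j))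
          (fderiv ℝ gh c u (E i) (E j)) 0 := by
        have := (((hdg.hasFDerivAt.clm_apply (hasFDerivAt_const (E i) c)).clm_apply
          (hasFDerivAt_const (E j) c))).hasLineDerivAt u
        simpa [HasLineDerivAt] using this
      have e2 : HasDerivAt (fun t : ℝ => oh (c + t • u) ![E i, E j])
          (fderiv ℝ oh c u ![E i, E j]) 0 := by
        have e1 := (hdo.continuousAlternatingMap_apply (g := fun k _ => ![E i, E j] k)
          fun i => differentiableAt_const _).hasFDerivAt.hasLineDerivAt u
        rw [fderiv_continuousAlternatingMap_apply_apply hdo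
          (g := fun k _ => ![E i, E j] k) (fun i => differentiableAt_const _) u] at e1
        simpa [HasLineDerivAt] using e1
      exact e1.ofReal_comp.sub (e2.ofReal_comp.const_mul I)
    have h0 : ∀ i j, H i j 0 = if i = j then 1 else 0 := fun i j => by
      have : H i j 0 = herm (gh c) (Jh c) (E i) (E j) := by
        simp [H, herm, h.omega_eq]
      rw [this, hz.herm_eq]
      simp [hz.dual, eq_comm]
    have hev : (fun t : ℝ => Oh (c + t • u) ![E 0, E 1, E 2]
        * conj (Oh (c + t • u) ![E 0, E 1, E 2])) =ᶠ[𝓝 0] fun t =>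
          H 0 0 t * (H 1 1 t * H 2 2 t - H 1 2 t * H 2 1 t)
        - H 0 1 t * (H 1 0 t * H 2 2 t - H 1 2 t * H 2 0 t)
        + H 0 2 t * (H 1 0 t * H 2 1 t - H 1 1 t * H 2 0 t) := by
      have hl : Filter.Tendsto (fun t : ℝ => c + t • u) (𝓝 0) (𝓝 c) := by
        have : Continuous fun t : ℝ => c + t • u := by fun_prop
        simpa using this.tendsto 0
      filter_upwards [hl.eventually hN, hl.eventually hom] with t h1 h2
      rw [h1]
      simp only [H, herm, h2]
    have hoc : HasDerivAt (fun t : ℝ => conj (Oh (c + t • u) ![E 0, E 1, E 2]))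
        (conj (fderiv ℝ Oh c u ![E 0, E 1, E 2])) 0 :=
      (conjCLE.toContinuousLinearMap.hasFDerivAt).comp_hasDerivAt 0 ho
    have e1 := congrArg re ((ho.mul hoc).unique
      ((hasDerivAt_det_three hH h0).congr_of_eventuallyEq hev))
    have hΩ1 : Oh (c + (0 : ℝ) • u) ![E 0, E 1, E 2] = 1 := by
      rw [zero_smul, add_zero, hΩ]; simp [det3, hz.dual]
    have hself : ∀ X : W, fderiv ℝ gh c u X X = 2 * gh c (γ X u) X := fun X => by
      rw [hγ, h.symm X]; ring
    rw [hΩ1] at e1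
    simp [hself] at e1
    linarith
  -- the covariant derivatives of `ω`, `Ω` and `J`
  let a : W → W [⋀^Fin 2]→L[ℝ] ℝ := fun u => fderiv ℝ oh c u - derivationForm (oh c) (γ.flip u)
  let B : W → W [⋀^Fin 3]→L[ℝ] ℂ := fun u => fderiv ℝ Oh c u - derivationForm (Oh c) (γ.flip u)
  let K : W → W → W := fun u v => fderiv ℝ Jh c u v + γ (Jh c v) u - Jh c (γ v u)
  have ha : ∀ u v w, a u ![v, w]
      = fderiv ℝ oh c u ![v, w] - (oh c ![γ v u, w] + oh c ![v, γ w u]) := fun u v w => by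
    rw [← γ.flip_apply, ← γ.flip_apply, ← derivationForm_two]; rfl
  have hB : ∀ u v w x, B u ![v, w, x] = fderiv ℝ Oh c u ![v, w, x]
      - (Oh c ![γ v u, w, x] + Oh c ![v, γ w u, x] + Oh c ![v, w, γ x u]) := fun u v w x => by
    rw [← γ.flip_apply, ← γ.flip_apply, ← γ.flip_apply, ← derivationForm_three]; rfl
  have haK : ∀ u v w, a u ![v, w] = gh c (K u v) w := fun u v w => by
    rw [ha, hom', hγ, h.omega_eq, h.omega_eq]
    simp [K]
    ring
  have key := nearlyKahler_pointwise hW h lam a B K haK ?_ ?_ ?_ ?_ ?_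
  · refine ⟨fun u v w => ?_, fun u v w x => ?_⟩
    · linear_combination key.1 u v w - ha u v w
    · linear_combination key.2 u v w x - hB u v w x
  · intro u v w
    have e1 := congrArg (fun X => gh c X w) (hsq' u v)
    simp only [map_add, add_apply, map_zero, zero_apply] at e1
    have hskew : ∀ u v, gh c u (Jh c v) = -gh c (Jh c u) v := fun u v => by
      have := h.J_isometry (Jh c u) v
      rw [h.J_sq, map_neg] at this
      simpa [neg_eq_iff_eq_neg] using this
    rw [haK, haK, hskew]
    simp only [K, map_add, map_sub, add_apply, sub_apply, h.J_sq, map_neg, neg_apply]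
    linarith
  · intro u v w x
    rw [hB, hB]
    have hΩ2 : ∀ u v w, Oh c ![u, Jh c v, w] = I * Oh c ![u, v, w] := fun u v w => by
      rw [alt_three_swap_left, h.Omega_type, alt_three_swap_left (Oh c) u v w]; ring
    have hsub : ∀ a b d, Oh c ![a + b - d, w, x]
        = Oh c ![a, w, x] + Oh c ![b, w, x] - Oh c ![d, w, x] := fun a b d => by
      have e1 := (Oh c).vecCons_add ![w, x] (a + b - d) d
      have e2 := (Oh c).vecCons_add ![w, x] a b
      rw [sub_add_cancel, e2] at e1
      exact eq_sub_of_add_eq e1.symm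
    rw [hsub, h.Omega_type, h.Omega_type, h.Omega_type]
    linear_combination hOm' u v w x
  · intro u v w
    rw [ha, ha, ha, γsymm v u, γsymm w u, γsymm w v, alt_two_swap (oh c) v (γ u w)]
    linear_combination hd2 u v w
  · intro u v w x
    rw [hB, hB, hB, hB, γsymm v u, γsymm w u, γsymm w v, γsymm x u, γsymm x v, γsymm x w]
    rw [alt_three_swap_left (Oh c) v (γ u w) x, alt_three_swap_left (Oh c) v (γ u x) w,
      alt_three_swap_right (Oh c) v w (γ u x), alt_three_swap_right (Oh c) u w (γ v x)]
    linear_combination hd3 u v w x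
  · intro z E hz hΩ u
    have e1 : ∀ X, (z 0 X).re = gh c X (E 0) ∧ (z 1 X).re = gh c X (E 1)
        ∧ (z 2 X).re = gh c X (E 2) := fun X => by
      simp only [hz.metric, Fin.sum_univ_three, hz.dual]
      simp
    rw [hB, hΩ, hΩ, hΩ]
    simp only [det3, hz.dual]
    simp [hNre z E hz hΩ u, e1]

end NearlyKahlerDerivative

/-! ### The derivatives of `ω` and `Ω` on the manifold -/

section Base

set_option linter.unusedSectionVars false

open Complex ComplexConjugate

variable {N : Type*} [TopologicalSpace N] [ChartedSpace (EuclideanSpace ℝ (Fin 6)) N]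
  [IsManifold (𝓡 6) ∞ N] (σ : SU3Structure N)

theorem SU3Structure.isSU3 (y : N) :
    IsSU3 (W := EuclideanSpace ℝ (Fin 6)) (σ.g.inner y) (σ.J y) (σ.omega y) (σ.Omega y)
      (σ.vol y) where
  symm := σ.g.symm y
  pos := σ.g.pos y
  J_sq := σ.J_sq y
  J_isometry := σ.J_isometry y
  omega_eq := σ.omega_eq y
  Omega_type := σ.Omega_type y
  omega_cubed := σ.omega_cubed y
  Omega_wedge_conj := σ.Omega_wedge_conj y

/-- The metric in the chart at `x`. -/
def SU3Structure.metricChart (x : N) (η : EuclideanSpace ℝ (Fin 6)) :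
    EuclideanSpace ℝ (Fin 6) →L[ℝ] EuclideanSpace ℝ (Fin 6) →L[ℝ] ℝ :=
  (ContinuousLinearMap.precomp ℝ (chartSymmDeriv (𝓡 6) x η)) ∘L
    (σ.g.inner ((extChartAt (𝓡 6) x).symm η)) ∘L chartSymmDeriv (𝓡 6) x η

/-- The almost complex structure in the chart at `x`. -/
def SU3Structure.complexChart (x : N) (η : EuclideanSpace ℝ (Fin 6)) :
    EuclideanSpace ℝ (Fin 6) →L[ℝ] EuclideanSpace ℝ (Fin 6) :=
  (mfderiv (𝓡 6) 𝓘(ℝ, EuclideanSpace ℝ (Fin 6)) (extChartAt (𝓡 6) x)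
    ((extChartAt (𝓡 6) x).symm η)) ∘L (σ.J ((extChartAt (𝓡 6) x).symm η)) ∘L
      chartSymmDeriv (𝓡 6) x η

theorem SU3Structure.metricChart_apply (x : N) (η v w : EuclideanSpace ℝ (Fin 6)) :
    σ.metricChart x η v w = bilinInChart (I := 𝓡 6) (fun y => σ.g.inner y) x η v w := rfl

theorem SU3Structure.differentiableAt_metricChart (x : N) :
    DifferentiableAt ℝ (σ.metricChart x) (extChartAt (𝓡 6) x x) := by
  refine differentiableAt_clm_of_apply fun v => differentiableAt_clm_of_apply fun w => ?_
  have h1 : MDifferentiableAt (𝓡 6) 𝓘(ℝ, ℝ) (fun y => σ.g.inner y (coordField (𝓡 6) x v y)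
      (coordField (𝓡 6) x w y)) x := by
    have hg := (σ.g.contMDiff x).mdifferentiableAt (by simp)
    have := MDifferentiableAt.clm_bundle_apply₂ (F₁ := EuclideanSpace ℝ (Fin 6))
      (F₂ := EuclideanSpace ℝ (Fin 6)) (E₃ := Bundle.Trivial N ℝ) (F₃ := ℝ)
      hg (vfDiffAt_coordField (I := 𝓡 6) x v) (vfDiffAt_coordField (I := 𝓡 6) x w)
    exact ((mdifferentiableAt_totalSpace _ _).1 this).2
  refine (MDifferentiableAt.differentiableAt_comp_symm h1).congr_of_eventuallyEq ?_
  filter_upwards [chartRep_coordField_symm_eventuallyEq (I := 𝓡 6) x v,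
    chartRep_coordField_symm_eventuallyEq (I := 𝓡 6) x w] with η e1 e2
  simp only [Function.comp, σ.metricChart_apply, bilinInChart]
  rw [e1, e2]

theorem chartSymmDeriv_mfderiv (x : N) {η : EuclideanSpace ℝ (Fin 6)}
    (hη : η ∈ (extChartAt (𝓡 6) x).target)
    (v : TangentSpace (𝓡 6) ((extChartAt (𝓡 6) x).symm η)) :
    chartSymmDeriv (𝓡 6) x η (mfderiv (𝓡 6) 𝓘(ℝ, EuclideanSpace ℝ (Fin 6)) (extChartAt (𝓡 6) x)
      ((extChartAt (𝓡 6) x).symm η) v) = v :=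
  congrArg (fun T : TangentSpace (𝓡 6) ((extChartAt (𝓡 6) x).symm η) →L[ℝ]
    TangentSpace (𝓡 6) ((extChartAt (𝓡 6) x).symm η) => T v)
      (mfderivWithin_extChartAt_symm_comp_mfderiv_extChartAt (I := 𝓡 6) hη)

theorem mfderiv_chartSymmDeriv (x : N) {η : EuclideanSpace ℝ (Fin 6)}
    (hη : η ∈ (extChartAt (𝓡 6) x).target) (v : EuclideanSpace ℝ (Fin 6)) :
    mfderiv (𝓡 6) 𝓘(ℝ, EuclideanSpace ℝ (Fin 6)) (extChartAt (𝓡 6) x)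
      ((extChartAt (𝓡 6) x).symm η) (chartSymmDeriv (𝓡 6) x η v) = v :=
  congrArg (fun T : EuclideanSpace ℝ (Fin 6) →L[ℝ] EuclideanSpace ℝ (Fin 6) => T v)
      (mfderiv_extChartAt_comp_mfderivWithin_extChartAt_symm (I := 𝓡 6) hη)

theorem SU3Structure.chartSymmDeriv_complexChart (x : N) {η : EuclideanSpace ℝ (Fin 6)}
    (hη : η ∈ (extChartAt (𝓡 6) x).target) (v : EuclideanSpace ℝ (Fin 6)) :
    chartSymmDeriv (𝓡 6) x η (σ.complexChart x η v)
      = σ.J ((extChartAt (𝓡 6) x).symm η) (chartSymmDeriv (𝓡 6) x η v) :=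
  chartSymmDeriv_mfderiv x hη _

theorem DForm.inChart_two {A : Type*} [NormedAddCommGroup A] [NormedSpace ℝ A]
    (α : DForm (𝓡 6) N 2 A) (x : N) (η u v : EuclideanSpace ℝ (Fin 6)) :
    α.inChart x η ![u, v] = α ((extChartAt (𝓡 6) x).symm η)
      ![chartSymmDeriv (𝓡 6) x η u, chartSymmDeriv (𝓡 6) x η v] := by
  refine congrArg (α ((extChartAt (𝓡 6) x).symm η)) ?_
  ext i; fin_cases i <;> rfl

theorem DForm.inChart_three {A : Type*} [NormedAddCommGroup A] [NormedSpace ℝ A]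
    (α : DForm (𝓡 6) N 3 A) (x : N) (η u v w : EuclideanSpace ℝ (Fin 6)) :
    α.inChart x η ![u, v, w] = α ((extChartAt (𝓡 6) x).symm η)
      ![chartSymmDeriv (𝓡 6) x η u, chartSymmDeriv (𝓡 6) x η v,
        chartSymmDeriv (𝓡 6) x η w] := by
  refine congrArg (α ((extChartAt (𝓡 6) x).symm η)) ?_
  ext i; fin_cases i <;> rfl

theorem SU3Structure.metricChart_self (x : N) :
    σ.metricChart x (extChartAt (𝓡 6) x x) = σ.g.inner x := by
  ext v w
  exact bilinInChart_self (I := 𝓡 6) (fun y => σ.g.inner y) x v w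

theorem SU3Structure.complexChart_self (x : N) :
    σ.complexChart x (extChartAt (𝓡 6) x x) = σ.J x := by
  ext1 v
  have hv := (chartRep_coordField_symm_eventuallyEq (I := 𝓡 6) x v).self_of_nhds
  have e1 : σ.complexChart x (extChartAt (𝓡 6) x x) v
      = mfderiv (𝓡 6) 𝓘(ℝ, EuclideanSpace ℝ (Fin 6)) (extChartAt (𝓡 6) x)
    ((extChartAt (𝓡 6) x).symm (extChartAt (𝓡 6) x x))
      (σ.J ((extChartAt (𝓡 6) x).symm (extChartAt (𝓡 6) x x)) (chartSymmDeriv (𝓡 6) x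
        (extChartAt (𝓡 6) x x) v)) := rfl
  rw [e1, ← hv, extChartAt_to_inv, coordField_self, mfderiv_extChartAt_self]
  rfl

theorem DForm.inChart_center {k : ℕ} {A : Type*} [NormedAddCommGroup A] [NormedSpace ℝ A]
    (α : DForm (𝓡 6) N k A) (x : N) : α.inChart x (extChartAt (𝓡 6) x x) = α x := by
  ext v
  exact DForm.inChart_self α x v

theorem DForm.d_two {A : Type*} [NormedAddCommGroup A] [NormedSpace ℝ A]
    (α : DForm (𝓡 6) N 2 A) (x : N) (u v w : EuclideanSpace ℝ (Fin 6)) :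
    α.d x ![u, v, w] = fderiv ℝ (α.inChart x) (extChartAt (𝓡 6) x x) u ![v, w]
      - fderiv ℝ (α.inChart x) (extChartAt (𝓡 6) x x) v ![u, w]
      + fderiv ℝ (α.inChart x) (extChartAt (𝓡 6) x x) w ![u, v] := by
  refine ((DForm.d_apply α x ![u, v, w]).trans (Fin.sum_univ_three _)).trans ?_
  have r0 : Fin.removeNth (0 : Fin 3) ![u, v, w] = ![v, w] := by ext i; fin_cases i <;> rfl
  have r1 : Fin.removeNth (1 : Fin 3) ![u, v, w] = ![u, w] := by ext i; fin_cases i <;> rfl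
  have r2 : Fin.removeNth (2 : Fin 3) ![u, v, w] = ![u, v] := by ext i; fin_cases i <;> rfl
  rw [r0, r1, r2]
  simp [sub_eq_add_neg]

theorem DForm.d_three {A : Type*} [NormedAddCommGroup A] [NormedSpace ℝ A]
    (α : DForm (𝓡 6) N 3 A) (x : N) (u v w y : EuclideanSpace ℝ (Fin 6)) :
    α.d x ![u, v, w, y] = fderiv ℝ (α.inChart x) (extChartAt (𝓡 6) x x) u ![v, w, y]
      - fderiv ℝ (α.inChart x) (extChartAt (𝓡 6) x x) v ![u, w, y]
      + fderiv ℝ (α.inChart x) (extChartAt (𝓡 6) x x) w ![u, v, y]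
      - fderiv ℝ (α.inChart x) (extChartAt (𝓡 6) x x) y ![u, v, w] := by
  refine ((DForm.d_apply α x ![u, v, w, y]).trans (Fin.sum_univ_four _)).trans ?_
  have r0 : Fin.removeNth (0 : Fin 4) ![u, v, w, y] = ![v, w, y] := by
    ext i; fin_cases i <;> rfl
  have r1 : Fin.removeNth (1 : Fin 4) ![u, v, w, y] = ![u, w, y] := by
    ext i; fin_cases i <;> rfl
  have r2 : Fin.removeNth (2 : Fin 4) ![u, v, w, y] = ![u, v, y] := by
    ext i; fin_cases i <;> rfl
  have r3 : Fin.removeNth (3 : Fin 4) ![u, v, w, y] = ![u, v, w] := by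
    ext i; fin_cases i <;> rfl
  rw [r0, r1, r2, r3]
  simp [sub_eq_add_neg, pow_succ]

/-- The derivatives of `ω` and `Ω` at `x` in the chart at `x`, for a Calabi–Yau or nearly Kähler
structure and any symmetric `γ` that is compatible with the metric at `x`. -/
theorem SU3Structure.IsOfType.fderiv_inChart {lam : ℝ} (hσ : σ.IsOfType lam) (x : N)
    (γ : EuclideanSpace ℝ (Fin 6) →L[ℝ] EuclideanSpace ℝ (Fin 6) →L[ℝ] EuclideanSpace ℝ (Fin 6))
    (γsymm : ∀ u v, γ u v = γ v u)
    (hγ : ∀ u v w, fderiv ℝ (σ.metricChart x) (extChartAt (𝓡 6) x x) u v w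
      = σ.g.inner x (γ v u) w + σ.g.inner x v (γ w u)) :
    (∀ u v w, fderiv ℝ (σ.omega.inChart x) (extChartAt (𝓡 6) x x) u ![v, w]
      = σ.omega x ![γ v u, w] + σ.omega x ![v, γ w u] - lam * (σ.Omega x ![u, v, w]).re) ∧
    ∀ u v w y, fderiv ℝ (σ.Omega.inChart x) (extChartAt (𝓡 6) x x) u ![v, w, y]
      = σ.Omega x ![γ v u, w, y] + σ.Omega x ![v, γ w u, y] + σ.Omega x ![v, w, γ y u]
        + nablaOmega (W := EuclideanSpace ℝ (Fin 6)) (σ.g.inner x) (σ.J x) lam u v w y := by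
  have htar := extChartAt_target_mem_nhds (I := 𝓡 6) x
  have h := σ.isSU3 x
  have key := nearlyKahler_chart (W := EuclideanSpace ℝ (Fin 6)) (gh := σ.metricChart x)
    (Jh := σ.complexChart x) (oh := σ.omega.inChart x) (Oh := σ.Omega.inChart x) (vol := σ.vol x)
    (c := extChartAt (𝓡 6) x x) (by simp)
    (by
      rw [σ.metricChart_self, σ.complexChart_self, DForm.inChart_center, DForm.inChart_center]
      exact h)
    (σ.differentiableAt_metricChart x) (σ.smooth_omega.differentiableAt x)
    (σ.smooth_Omega.differentiableAt x)
    (by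
      filter_upwards [htar] with η hη u
      have e1 : σ.complexChart x η (σ.complexChart x η u)
        = mfderiv (𝓡 6) 𝓘(ℝ, EuclideanSpace ℝ (Fin 6)) (extChartAt (𝓡 6) x)
          ((extChartAt (𝓡 6) x).symm η) (σ.J ((extChartAt (𝓡 6) x).symm η)
            (chartSymmDeriv (𝓡 6) x η (σ.complexChart x η u))) := rfl
      rw [e1, σ.chartSymmDeriv_complexChart x hη, σ.J_sq, map_neg, mfderiv_chartSymmDeriv x hη]
      rfl)
    (by
      filter_upwards [htar] with η hη u v
      rw [DForm.inChart_two, σ.omega_eq, σ.metricChart_apply, bilinInChart,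
        σ.chartSymmDeriv_complexChart x hη])
    (by
      filter_upwards [htar] with η hη u v w
      rw [DForm.inChart_three, DForm.inChart_three, σ.chartSymmDeriv_complexChart x hη,
        σ.Omega_type])
    (by
      filter_upwards [htar] with η hη u v w
      obtain ⟨z, E, hz, hΩ⟩ := (σ.isSU3 ((extChartAt (𝓡 6) x).symm η)).exists_unitaryFrame
        (by simp) 1 (by simp)
      simp only [one_mul] at hΩ
      have hh : ∀ a b, herm (σ.metricChart x η) (σ.complexChart x η) a b
          = herm (W := EuclideanSpace ℝ (Fin 6)) (σ.g.inner ((extChartAt (𝓡 6) x).symm η))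
            (σ.J ((extChartAt (𝓡 6) x).symm η)) (chartSymmDeriv (𝓡 6) x η a)
            (chartSymmDeriv (𝓡 6) x η b) := fun a b => by
        simp only [herm, σ.metricChart_apply, bilinInChart, σ.chartSymmDeriv_complexChart x hη]
        rfl
      simp only [hh, DForm.inChart_three]
      exact hz.normSq_form hΩ _ _ _)
    γ γsymm (by rw [σ.metricChart_self]; exact hγ) lam
    (by
      intro u v w
      have e1 := DForm.d_two σ.omega x u v w
      rw [hσ.d_omega] at e1
      rw [DForm.inChart_center]
      exact e1.symm)
    (by
      intro u v w y
      have e1 := DForm.d_three σ.Omega x u v w y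
      rw [hσ.d_Omega] at e1
      rw [DForm.inChart_center]
      have e3 : wedge (σ.omega x) (σ.omega x) ![u, v, w, y]
        = 2 * (σ.omega x ![u, v] * σ.omega x ![w, y] - σ.omega x ![u, w] * σ.omega x ![v, y]
          + σ.omega x ![u, y] * σ.omega x ![v, w]) := by
        refine (wedge_two_two _ _ _).trans ?_
        simp
        ring
      have e2 : ((2 * lam * I) • ofRealForm (wedge (σ.omega x) (σ.omega x))) ![u, v, w, y]
        = 2 * lam * I * ((wedge (σ.omega x) (σ.omega x) ![u, v, w, y] : ℝ) : ℂ) := rfl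
      rw [e3] at e2
      have e4 := e2.symm.trans e1
      push_cast at e4
      have e5 : ∀ a b c d e f : ℂ, 2 * lam * I * (2 * (a * b - c * d + e * f))
          = 4 * lam * I * (a * b - c * d + e * f) := by intros; ring
      exact e4.symm.trans (e5 _ _ _ _ _ _))
  rw [σ.metricChart_self, σ.complexChart_self, DForm.inChart_center, DForm.inChart_center] at key
  exact key

end Base

/-! ### The algebra of `∇φ` on a warped product -/

section WarpedAlgebra

variable {W : Type*} [NormedAddCommGroup W] [NormedSpace ℝ W]
  {g : W →L[ℝ] W →L[ℝ] ℝ} {J : W →L[ℝ] W} {om : W [⋀^Fin 2]→L[ℝ] ℝ}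
  {Ω : W [⋀^Fin 3]→L[ℝ] ℂ} {vol : W [⋀^Fin 6]→L[ℝ] ℝ}

/-- The value of `Re(h³ e^{iθ} Ω) + r h² ds ∧ ω` on three vectors of `W × ℝ`, where `s` is the
coordinate of `ℝ`. -/
def warpedPhi (om : W [⋀^Fin 2]→L[ℝ] ℝ) (Ω : W [⋀^Fin 3]→L[ℝ] ℂ) (h θ r : ℝ)
    (u v w : W × ℝ) : ℝ :=
  h ^ 3 * (Real.cos θ * (Ω ![u.1, v.1, w.1]).re - Real.sin θ * (Ω ![u.1, v.1, w.1]).im)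
    + r * h ^ 2 * (u.2 * om ![v.1, w.1] - v.2 * om ![u.1, w.1] + w.2 * om ![u.1, v.1])

/-- The value of `Im(h³ e^{iθ} Ω)` on three vectors. -/
def warpedIm (Ω : W [⋀^Fin 3]→L[ℝ] ℂ) (h θ : ℝ) (u v w : W) : ℝ :=
  h ^ 3 * (Real.cos θ * (Ω ![u, v, w]).im + Real.sin θ * (Ω ![u, v, w]).re)

/-- The value of `h⁴ ω² / 2 + Im(h³ e^{iθ} Ω) ∧ r ds` on four vectors of `W × ℝ`. -/
def warpedPsi (om : W [⋀^Fin 2]→L[ℝ] ℝ) (Ω : W [⋀^Fin 3]→L[ℝ] ℂ) (h θ r : ℝ)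
    (u v w x : W × ℝ) : ℝ :=
  h ^ 4 * (om ![u.1, v.1] * om ![w.1, x.1] - om ![u.1, w.1] * om ![v.1, x.1]
      + om ![u.1, x.1] * om ![v.1, w.1])
    + r * (warpedIm Ω h θ u.1 v.1 w.1 * x.2 - warpedIm Ω h θ u.1 v.1 x.1 * w.2
      + warpedIm Ω h θ u.1 w.1 x.1 * v.2 - warpedIm Ω h θ v.1 w.1 x.1 * u.2)

/-- The torsion endomorphism `diag(a, b δ₆) - m J₆` of `W × ℝ`. -/
def warpedTorsion (J : W →L[ℝ] W) (a b m : ℝ) (u : W × ℝ) : W × ℝ :=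
  (b • u.1 - m • J u.1, a * u.2)

theorem form_three_add_left (Ω : W [⋀^Fin 3]→L[ℝ] ℂ) (a b v w : W) (t : ℝ) :
    Ω ![a + t • b, v, w] = Ω ![a, v, w] + t * Ω ![b, v, w] := by
  have e1 := Ω.vecCons_add ![v, w] a (t • b)
  have e2 := Ω.toAlternatingMap.map_vecCons_smul ![v, w] t b
  refine e1.trans (congrArg _ ?_)
  exact e2.trans (by simp)

theorem form_two_add_left (om : W [⋀^Fin 2]→L[ℝ] ℝ) (a b v : W) (t : ℝ) :
    om ![a + t • b, v] = om ![a, v] + t * om ![b, v] := by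
  have e1 := om.vecCons_add ![v] a (t • b)
  have e2 := om.toAlternatingMap.map_vecCons_smul ![v] t b
  refine e1.trans (congrArg _ ?_)
  exact e2.trans (by simp)

theorem form_three_add_mid (Ω : W [⋀^Fin 3]→L[ℝ] ℂ) (a b v w : W) (t : ℝ) :
    Ω ![v, a + t • b, w] = Ω ![v, a, w] + t * Ω ![v, b, w] := by
  rw [alt_three_swap_left, form_three_add_left, alt_three_swap_left Ω v a,
    alt_three_swap_left Ω v b]
  ring

theorem form_three_add_right (Ω : W [⋀^Fin 3]→L[ℝ] ℂ) (a b v w : W) (t : ℝ) :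
    Ω ![v, w, a + t • b] = Ω ![v, w, a] + t * Ω ![v, w, b] := by
  rw [alt_three_swap_right, form_three_add_mid, alt_three_swap_right Ω v w a,
    alt_three_swap_right Ω v w b]
  ring

theorem form_two_add_right (om : W [⋀^Fin 2]→L[ℝ] ℝ) (a b v : W) (t : ℝ) :
    om ![v, a + t • b] = om ![v, a] + t * om ![v, b] := by
  rw [alt_two_swap, form_two_add_left, alt_two_swap om v a, alt_two_swap om v b]
  ring

/-- The identity `∇_u φ = ψ(S u, ·, ·, ·)` on a warped product with metric `r² ds² + h² g`, where
`S = diag(θ'/r, -λ sin θ/h δ₆) - h⁻¹ (h'/r + λ cos θ) J₆`. Here `γ` and `Γ` are the Christoffel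
tensors of the base and of the product, `dom` and `dOm` the derivatives of `ω` and `Ω` in a chart,
and `h'`, `θ'`, `r'` are derivatives with respect to `s`. The terms with `γ` cancel. The remaining
ones agree identically, except for the products of `λ` with `cos θ` and `sin θ` in `ψ(S u, ·)`,
which combine to `Re Ω` by `sin² θ + cos² θ = 1`. -/
theorem warpedPhi_covariant (h3 : IsSU3 g J om Ω vol) (lam h θ r h' θ' r' : ℝ) (hh : h ≠ 0)
    (hr : r ≠ 0) (γ : W →L[ℝ] W →L[ℝ] W) (Γ : W × ℝ → W × ℝ → W × ℝ)
    (hΓ1 : ∀ v u, (Γ v u).1 = γ v.1 u.1 + (h' / h) • (u.2 • v.1 + v.2 • u.1))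
    (hΓ2 : ∀ v u, (Γ v u).2 = r' / r * (u.2 * v.2) - h * h' / r ^ 2 * g u.1 v.1)
    (dom : W → W → W → ℝ) (dOm : W → W → W → W → ℂ)
    (hdom : ∀ u v w, dom u v w
      = om ![γ v u, w] + om ![v, γ w u] - lam * (Ω ![u, v, w]).re)
    (hdOm : ∀ u v w x, dOm u v w x
      = Ω ![γ v u, w, x] + Ω ![v, γ w u, x] + Ω ![v, w, γ x u] + nablaOmega g J lam u v w x)
    (u v w x : W × ℝ) :
    (3 * h ^ 2 * h' * u.2 * (Real.cos θ * (Ω ![v.1, w.1, x.1]).re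
          - Real.sin θ * (Ω ![v.1, w.1, x.1]).im)
        + h ^ 3 * (-(Real.sin θ * (θ' * u.2)) * (Ω ![v.1, w.1, x.1]).re
          + Real.cos θ * (dOm u.1 v.1 w.1 x.1).re
          - (Real.cos θ * (θ' * u.2) * (Ω ![v.1, w.1, x.1]).im
            + Real.sin θ * (dOm u.1 v.1 w.1 x.1).im))
        + (r' * h ^ 2 + r * (2 * h * h')) * u.2 * (v.2 * om ![w.1, x.1] - w.2 * om ![v.1, x.1]
          + x.2 * om ![v.1, w.1])
        + r * h ^ 2 * (v.2 * dom u.1 w.1 x.1 - w.2 * dom u.1 v.1 x.1 + x.2 * dom u.1 v.1 w.1))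
      - (warpedPhi om Ω h θ r (Γ v u) w x + warpedPhi om Ω h θ r v (Γ w u) x
        + warpedPhi om Ω h θ r v w (Γ x u))
    = warpedPsi om Ω h θ r (warpedTorsion J (θ' / r) (-(lam * Real.sin θ / h))
        (h⁻¹ * (h' / r + lam * Real.cos θ)) u) v w x := by
  obtain ⟨u, u2⟩ := u
  obtain ⟨v, v2⟩ := v
  obtain ⟨w, w2⟩ := w
  obtain ⟨x, x2⟩ := x
  have hω : ∀ u v, om ![v, u] = -om ![u, v] := fun u v => alt_two_swap om u v
  have hS3 : ∀ (b m : ℝ) (a c : W),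
      Ω ![b • u - m • J u, a, c] = (b - m * Complex.I) * Ω ![u, a, c] := fun b m a c => by
      have e : b • u - m • J u = (0 : W) + b • u + (-m) • J u := by module
      rw [e, form_three_add_left, form_three_add_left, h3.Omega_type]
      have : Ω ![0, a, c] = 0 := Ω.map_coord_zero 0 rfl
      rw [this]; push_cast; ring
  have hS2 : ∀ (b m : ℝ) (a : W), om ![b • u - m • J u, a] = b * om ![u, a] + m * g u a := by
    intro b m a
    rw [h3.omega_eq, h3.omega_eq]
    simp [h3.J_sq]
  simp only [warpedPhi, warpedPsi, warpedTorsion, warpedIm, hΓ1, hΓ2, hdom, hdOm, smul_add,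
    smul_smul, ← add_assoc, form_three_add_left, form_three_add_mid, form_three_add_right,
    form_two_add_left, form_two_add_right, nablaOmega, herm, hS3, hS2, ← h3.omega_eq]
  have s1 : Ω ![v, w, u] = Ω ![u, v, w] := by
    rw [alt_three_swap_right, alt_three_swap_left, neg_neg]
  rw [s1, alt_three_swap_left Ω u v x, hω u v, hω u w, hω u x, hω v x, h3.symm v u, h3.symm w u,
    h3.symm x u]
  have hcs := Real.sin_sq_add_cos_sq θ
  simp only [Complex.add_re, Complex.add_im, Complex.mul_re, Complex.mul_im, Complex.sub_re,
    Complex.sub_im, Complex.neg_re, Complex.neg_im, Complex.ofReal_re, Complex.ofReal_im,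
    Complex.I_re, Complex.I_im]
  generalize Real.cos θ = c at *
  generalize Real.sin θ = s at *
  generalize (Ω ![u, v, w]).re = a1
  generalize (Ω ![u, v, x]).re = a2
  generalize (Ω ![u, w, x]).re = a3
  generalize (Ω ![v, w, x]).re = a4
  generalize (Ω ![u, v, w]).im = b1
  generalize (Ω ![u, v, x]).im = b2
  generalize (Ω ![u, w, x]).im = b3
  generalize (Ω ![v, w, x]).im = b4
  field_simp
  linear_combination (lam * r ^ 2 * h * (x2 * a1 - w2 * a2 + v2 * a3)) * hcs

end WarpedAlgebra

/-! ### Torsion of a `G₂`-structure in a frame -/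

section TorsionFrame

variable {V : Type*} [NormedAddCommGroup V] [NormedSpace ℝ V]

/-- The form `ψ` is nondegenerate: each coordinate of `a` is a value of `a ⌟ ψ` on frame vectors. -/
theorem eq_zero_of_stdPsi (e : Fin 7 → V) (x : Fin 7 → V →L[ℝ] ℝ)
    (hx : ∀ i j, x i (e j) = if i = j then 1 else 0) (hsum : ∀ u, u = ∑ i, x i u • e i)
    (a : V) (ha : ∀ u v w, stdPsi x a u v w = 0) : a = 0 := by
  have h0 := ha (e 1) (e 2) (e 3)
  have h1 := ha (e 0) (e 2) (e 3)
  have h2 := ha (e 0) (e 1) (e 3)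
  have h3 := ha (e 0) (e 1) (e 2)
  have h4 := ha (e 0) (e 1) (e 5)
  have h5 := ha (e 0) (e 1) (e 4)
  have h6 := ha (e 1) (e 2) (e 4)
  simp [stdPsi, det4, det3, hx] at h0 h1 h2 h3 h4 h5 h6
  rw [hsum a]
  simp [Fin.sum_univ_succ, h0, h1, h2, h3, h4, h5, h6]

/-- Double contraction of a monomial `x_i ∧ x_j ∧ x_k` with a skew array. -/
theorem sum_det3_mul_two (e : Fin 7 → V) (x : Fin 7 → V →L[ℝ] ℝ)
    (hx : ∀ i j, x i (e j) = if i = j then 1 else 0) (Y : Fin 7 → Fin 7 → ℝ)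
    (hY : ∀ a b, Y b a = -Y a b) (u : V) (i j k : Fin 7) :
    ∑ a, ∑ b, det3 (x i) (x j) (x k) u (e a) (e b) * Y a b
      = 2 * (x i u * Y j k + x j u * Y k i + x k u * Y i j) := by
  simp only [det3, hx, add_mul, sub_mul, mul_sub, Finset.sum_add_distrib, Finset.sum_sub_distrib]
  simp
  rw [hY j k, hY k i, hY i j]
  ring

/-- The identity `φ_{uab} φ_{abv} = 6 g_{uv}`. -/
theorem sum_stdPhi_mul (e : Fin 7 → V) (x : Fin 7 → V →L[ℝ] ℝ)
    (hx : ∀ i j, x i (e j) = if i = j then 1 else 0) (u v : V) :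
    ∑ a, ∑ b, stdPhi x u (e a) (e b) * stdPhi x (e a) (e b) v = 6 * ∑ i, x i u * x i v := by
  have hY : ∀ a b, stdPhi x (e b) (e a) v = -stdPhi x (e a) (e b) v := fun a b => by
    simp only [stdPhi, det3]; ring
  have key := sum_det3_mul_two e x hx (fun a b => stdPhi x (e a) (e b) v) hY u
  have hexp : ∀ a b, stdPhi x u (e a) (e b) * stdPhi x (e a) (e b) v
      = det3 (x 0) (x 2) (x 4) u (e a) (e b) * stdPhi x (e a) (e b) v
        + det3 (x 3) (x 0) (x 5) u (e a) (e b) * stdPhi x (e a) (e b) v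
        + det3 (x 2) (x 1) (x 5) u (e a) (e b) * stdPhi x (e a) (e b) v
        + det3 (x 3) (x 1) (x 4) u (e a) (e b) * stdPhi x (e a) (e b) v
        + det3 (x 6) (x 0) (x 1) u (e a) (e b) * stdPhi x (e a) (e b) v
        + det3 (x 6) (x 2) (x 3) u (e a) (e b) * stdPhi x (e a) (e b) v
        + det3 (x 6) (x 4) (x 5) u (e a) (e b) * stdPhi x (e a) (e b) v := fun a b => by
    rw [← add_mul, ← add_mul, ← add_mul, ← add_mul, ← add_mul, ← add_mul]
    rfl
  simp only [hexp, Finset.sum_add_distrib, key]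
  simp only [stdPhi, det3, hx]
  simp [Fin.sum_univ_succ]
  ring

theorem sum_symm_mul_skew {n : ℕ} (A B : Fin n → Fin n → ℝ) (hA : ∀ a b, A a b = A b a)
    (hB : ∀ a b, B a b = -B b a) : ∑ a, ∑ b, A a b * B a b = 0 := by
  have h : ∑ a, ∑ b, A a b * B a b = -∑ a, ∑ b, A a b * B a b := by
    conv_lhs => rw [Finset.sum_comm]
    rw [← Finset.sum_neg_distrib]
    refine Finset.sum_congr rfl fun a _ => ?_
    rw [← Finset.sum_neg_distrib]
    refine Finset.sum_congr rfl fun b _ => ?_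
    rw [hA b a, hB b a]; ring
  linarith

/-- The coordinates of an arbitrary orthonormal frame form an orthogonal matrix. -/
theorem IsOrthonormalFrame.sum_coord (x : Fin 7 → V →L[ℝ] ℝ) (g : V →L[ℝ] V →L[ℝ] ℝ)
    (hg : ∀ u v, g u v = ∑ i, x i u * x i v) {f : Fin 7 → V} (hf : IsOrthonormalFrame g f)
    (i j : Fin 7) : ∑ a, x i (f a) * x j (f a) = if i = j then 1 else 0 := by
  let A : Matrix (Fin 7) (Fin 7) ℝ := Matrix.of fun i a => x i (f a)
  have h1 : A.transpose * A = 1 := by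
    ext a b
    have := hf a b
    rw [hg] at this
    simpa [Matrix.mul_apply, Matrix.one_apply, A] using this
  have h2 : A * A.transpose = 1 := mul_eq_one_comm.mp h1
  have := congrFun (congrFun h2 i) j
  simpa [Matrix.mul_apply, Matrix.one_apply, A] using this

/-- The components of the `G₂`-decomposition are unique: `7 τ₁` is the trace of `T`, `6 τ₇` its
contraction with `φ`, and `τ₁₄` and `τ₂₇` are then the skew and the symmetric part of the rest. -/
theorem IsTorsionDecomposition.unique (e : Fin 7 → V) (x : Fin 7 → V →L[ℝ] ℝ)
    (hx : ∀ i j, x i (e j) = if i = j then 1 else 0) (hsum : ∀ u, u = ∑ i, x i u • e i)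
    {φ : V [⋀^Fin 3]→L[ℝ] ℝ} (hφ : ∀ u v w, φ ![u, v, w] = stdPhi x u v w)
    {g : V →L[ℝ] V →L[ℝ] ℝ} (hg : ∀ u v, g u v = ∑ i, x i u * x i v) {S : V →L[ℝ] V}
    {τ₁ τ₁' : ℝ} {τ₇ τ₇' : V [⋀^Fin 1]→L[ℝ] ℝ} {τ₁₄ τ₁₄' : V [⋀^Fin 2]→L[ℝ] ℝ}
    {τ₂₇ τ₂₇' : V →L[ℝ] V →L[ℝ] ℝ} (h : IsTorsionDecomposition g φ S τ₁ τ₇ τ₁₄ τ₂₇)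
    (h' : IsTorsionDecomposition g φ S τ₁' τ₇' τ₁₄' τ₂₇') :
    τ₁ = τ₁' ∧ τ₇ = τ₇' ∧ τ₁₄ = τ₁₄' ∧ τ₂₇ = τ₂₇' := by
  have he : IsOrthonormalFrame g e := fun i j => by simp [hg, hx, eq_comm]
  have skew : ∀ (β : V [⋀^Fin 2]→L[ℝ] ℝ) u, β ![u, u] = 0 := fun β u => by
    linarith [alt_two_swap β u u]
  have skewφ : ∀ X u, φ ![X, u, u] = 0 := fun X u => by linarith [alt_three_swap_right φ X u u]
  have trace : ∀ {τ₁ : ℝ} {τ₇ : V [⋀^Fin 1]→L[ℝ] ℝ} {τ₁₄ : V [⋀^Fin 2]→L[ℝ] ℝ}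
      {τ₂₇ : V →L[ℝ] V →L[ℝ] ℝ}, IsTorsionDecomposition g φ S τ₁ τ₇ τ₁₄ τ₂₇ →
      ∑ a, g (S (e a)) (e a) = 7 * τ₁ := by
    rintro τ₁ τ₇ τ₁₄ τ₂₇ ⟨-, ⟨-, h27⟩, X, -, hX⟩
    simp only [hX, Finset.sum_add_distrib, skew, skewφ, h27 e he, he _ _]
    simp
  have contr : ∀ {τ₁ : ℝ} {τ₇ : V [⋀^Fin 1]→L[ℝ] ℝ} {τ₁₄ : V [⋀^Fin 2]→L[ℝ] ℝ}
      {τ₂₇ : V →L[ℝ] V →L[ℝ] ℝ}, IsTorsionDecomposition g φ S τ₁ τ₇ τ₁₄ τ₂₇ →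
      ∀ v, ∑ a, ∑ b, g (S (e a)) (e b) * φ ![e a, e b, v] = 6 * τ₇ ![v] := by
    rintro τ₁ τ₇ τ₁₄ τ₂₇ ⟨h14, ⟨h27, -⟩, X, h7, hX⟩ v
    have hsk : ∀ a b, φ ![e a, e b, v] = -φ ![e b, e a, v] := fun a b => alt_three_swap_left φ _ _ _
    have c1 := sum_symm_mul_skew (fun a b => τ₁ * g (e a) (e b)) (fun a b => φ ![e a, e b, v])
      (fun a b => by simp only [hg, mul_comm]) hsk
    have c2 := sum_symm_mul_skew (fun a b => τ₂₇ (e a) (e b)) (fun a b => φ ![e a, e b, v])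
      (fun a b => h27 _ _) hsk
    have c3 := sum_stdPhi_mul e x hx X v
    simp only [← hφ, ← hg, h7] at c3
    simp only [hX, add_mul, Finset.sum_add_distrib]
    rw [c1, c2, c3, h14 e he v]
    ring
  have e1 : τ₁ = τ₁' := by linarith [trace h, trace h']
  have e7 : ∀ v, τ₇ ![v] = τ₇' ![v] := fun v => by linarith [contr h v, contr h' v]
  obtain ⟨-, ⟨h27, -⟩, X, h7, hX⟩ := h
  obtain ⟨-, ⟨h27', -⟩, X', h7', hX'⟩ := h'
  have eX : X = X' := by
    have hX : ∀ i, x i X = x i X' := fun i => by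
      have := (h7 (e i)).trans ((e7 _).trans (h7' (e i)).symm)
      simpa [hg, hx] using this
    rw [hsum X, hsum X']
    simp only [hX]
  subst eX e1
  have e0 : ∀ u v, τ₁₄ ![u, v] + τ₂₇ u v = τ₁₄' ![u, v] + τ₂₇' u v := fun u v => by
    linarith [hX u v, hX' u v]
  refine ⟨rfl, ?_, ?_, ?_⟩
  · ext v
    have hv : v = ![v 0] := by ext i; fin_cases i; rfl
    rw [hv]; exact e7 _
  · ext v
    have hv : v = ![v 0, v 1] := by ext i; fin_cases i <;> rfl
    rw [hv]
    linarith [e0 (v 0) (v 1), e0 (v 1) (v 0), h27 (v 0) (v 1), h27' (v 0) (v 1),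
      alt_two_swap τ₁₄ (v 0) (v 1), alt_two_swap τ₁₄' (v 0) (v 1)]
  · ext u v
    linarith [e0 u v, e0 v u, h27 u v, h27' u v, alt_two_swap τ₁₄ u v, alt_two_swap τ₁₄' u v]

/-- The decomposition of an endomorphism which is a multiple of the identity plus a multiple of the
projection to the last vector of the frame plus a multiple of `e₆ ⌟ φ`. -/
theorem isTorsionDecomposition_of_frame (e : Fin 7 → V) (x : Fin 7 → V →L[ℝ] ℝ)
    (hx : ∀ i j, x i (e j) = if i = j then 1 else 0)
    {φ : V [⋀^Fin 3]→L[ℝ] ℝ} {g : V →L[ℝ] V →L[ℝ] ℝ} (hg : ∀ u v, g u v = ∑ i, x i u * x i v)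
    {S : V →L[ℝ] V} {a b m : ℝ}
    (hS : ∀ u v, g (S u) v = b * g u v + (a - b) * (x 6 u * x 6 v) - m * φ ![e 6, u, v])
    {τ₇ : V [⋀^Fin 1]→L[ℝ] ℝ} (h7 : ∀ v, τ₇ ![v] = -m * x 6 v)
    {τ₂₇ : V →L[ℝ] V →L[ℝ] ℝ}
    (h27 : ∀ u v, τ₂₇ u v = 1 / 7 * (a - b) * (7 * (x 6 u * x 6 v) - g u v)) :
    IsTorsionDecomposition g φ S (1 / 7 * (a + 6 * b)) τ₇ 0 τ₂₇ := by
  refine ⟨fun f _ v => by simp, ⟨fun u v => ?_, fun f hf => ?_⟩, (-m) • e 6, fun v => ?_,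
    fun u v => ?_⟩
  · simp only [h27, hg]
    simp only [mul_comm]
  · have h6 := hf.sum_coord x g hg 6 6
    simp only [h27, ← Finset.mul_sum, Finset.sum_sub_distrib, h6, hf _ _]
    simp
  · rw [h7]
    simp [hg, hx]
  · have e2 : φ ![(-m) • e 6, u, v] = -m * φ ![e 6, u, v] := by
      have := φ.toAlternatingMap.map_vecCons_smul ![u, v] (-m) (e 6)
      exact this.trans (by simp)
    rw [hS, e2, h27]
    simp
    ring

end TorsionFrame

/-! ### The Christoffel tensor of a warped product -/

section WarpedChristoffel

variable {W : Type*} [NormedAddCommGroup W] [NormedSpace ℝ W]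

/-- The bilinear map `(v, u) ↦ pr_W Γ((v, 0), (u, 0))` on `W`. For a warped product it is the
Christoffel tensor of the base. -/
def baseChristoffel (Γ : W × ℝ →L[ℝ] W × ℝ →L[ℝ] W × ℝ) : W →L[ℝ] W →L[ℝ] W :=
  (ContinuousLinearMap.compL ℝ W (W × ℝ) W (ContinuousLinearMap.fst ℝ W ℝ)) ∘L
    ((ContinuousLinearMap.compL ℝ W (W × ℝ) (W × ℝ)).flip (ContinuousLinearMap.inl ℝ W ℝ)) ∘L
      Γ ∘L ContinuousLinearMap.inl ℝ W ℝ

theorem baseChristoffel_apply (Γ : W × ℝ →L[ℝ] W × ℝ →L[ℝ] W × ℝ) (v u : W) :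
    baseChristoffel Γ v u = (Γ (v, 0) (u, 0)).1 := rfl

/-- The Christoffel tensor of a warped product metric `r² ds² + h² g`, from the Koszul formula. Here
`dg` is the derivative of `g`, and `r'`, `h'` are the derivatives of `r` and `h` in the direction of
the second factor. The restriction of `Γ` to the base is again symmetric and compatible with `g`. -/
theorem warped_christoffel (Γ : W × ℝ →L[ℝ] W × ℝ →L[ℝ] W × ℝ) (hΓ : ∀ u v, Γ u v = Γ v u)
    (g : W →L[ℝ] W →L[ℝ] ℝ) (gsymm : ∀ u v, g u v = g v u) (gpos : ∀ u, u ≠ 0 → 0 < g u u)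
    (h r h' r' : ℝ) (hh : h ≠ 0) (hr : r ≠ 0) (dg : W → W → W → ℝ)
    (hdg : ∀ v w, dg 0 v w = 0) (hdg' : ∀ u v, dg u v 0 = 0)
    (hmet : ∀ u v w : W × ℝ,
      2 * r * r' * u.2 * (v.2 * w.2) + 2 * h * h' * u.2 * g v.1 w.1 + h ^ 2 * dg u.1 v.1 w.1
        = r ^ 2 * ((Γ v u).2 * w.2) + h ^ 2 * g (Γ v u).1 w.1
          + (r ^ 2 * (v.2 * (Γ w u).2) + h ^ 2 * g v.1 (Γ w u).1)) :
    (∀ v u, baseChristoffel Γ v u = baseChristoffel Γ u v) ∧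
    (∀ u v w, dg u v w = g (baseChristoffel Γ v u) w + g v (baseChristoffel Γ w u)) ∧
    (∀ v u, (Γ v u).1 = baseChristoffel Γ v.1 u.1 + (h' / h) • (u.2 • v.1 + v.2 • u.1)) ∧
    (∀ v u, (Γ v u).2 = r' / r * (u.2 * v.2) - h * h' / r ^ 2 * g u.1 v.1) := by
  have nondeg : ∀ a b : W, (∀ w, g a w = g b w) → a = b := fun a b hab => by
    by_contra hne
    have := gpos (a - b) (sub_ne_zero.mpr hne)
    simp only [map_sub, sub_apply, hab] at this
    simp at this
  have h2 : h ^ 2 ≠ 0 := pow_ne_zero 2 hh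
  have koszul : ∀ v u w : W × ℝ,
      2 * (r ^ 2 * ((Γ v u).2 * w.2) + h ^ 2 * g (Γ v u).1 w.1)
        = 2 * r * r' * (u.2 * v.2 * w.2)
          + 2 * h * h' * (u.2 * g v.1 w.1 + v.2 * g u.1 w.1 - w.2 * g u.1 v.1)
          + h ^ 2 * (dg u.1 v.1 w.1 + dg v.1 u.1 w.1 - dg w.1 u.1 v.1) := fun v u w => by
    have e1 := hmet u v w
    have e2 := hmet v u w
    have e3 := hmet w u v
    rw [hΓ u v] at e2
    rw [hΓ u w, hΓ v w, gsymm (Γ w u).1] at e3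
    linarith
  refine ⟨fun v u => by rw [baseChristoffel_apply, baseChristoffel_apply, hΓ], fun u v w => ?_,
    fun v u => ?_, fun v u => ?_⟩
  · have := hmet (u, 0) (v, 0) (w, 0)
    simp only [mul_zero, zero_mul, zero_add] at this
    rw [← mul_add] at this
    exact mul_left_cancel₀ h2 this
  · refine nondeg _ _ fun w => ?_
    have e1 := koszul v u (w, 0)
    have e2 := koszul (v.1, 0) (u.1, 0) (w, 0)
    simp only [mul_zero, zero_mul, zero_add, sub_zero, add_zero] at e1 e2
    rw [← baseChristoffel_apply] at e2
    simp only [map_add, map_smul, add_apply, smul_apply,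
      smul_eq_mul]
    have e3 : h ^ 2 * g (Γ v u).1 w = h ^ 2 * g (baseChristoffel Γ v.1 u.1) w
        + h * h' * (u.2 * g v.1 w + v.2 * g u.1 w) := by linarith
    refine mul_left_cancel₀ h2 (e3.trans ?_)
    field_simp
  · have e1 := koszul v u (0, 1)
    simp only [map_zero, mul_zero, zero_add, mul_one, hdg, hdg'] at e1
    have e2 : r ^ 2 * (Γ v u).2 = r * r' * (u.2 * v.2) - h * h' * g u.1 v.1 := by linarith
    field_simp
    linarith

end WarpedChristoffel

/-! ### Tensors on `N × L` -/

section Product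

set_option linter.unusedSectionVars false

variable {N : Type*} [TopologicalSpace N] [ChartedSpace (EuclideanSpace ℝ (Fin 6)) N]
  [IsManifold (𝓡 6) ∞ N] {L : Type*} [TopologicalSpace L] [ChartedSpace ℝ L]
  [IsManifold 𝓘(ℝ, ℝ) ∞ L]

theorem projN_apply (q : N × L) (u : EuclideanSpace ℝ (Fin 6) × ℝ) : projN q u = u.1 :=
  congrArg (fun T : EuclideanSpace ℝ (Fin 6) × ℝ →L[ℝ] EuclideanSpace ℝ (Fin 6) => T u)
    (mfderiv_fst (I := 𝓡 6) (I' := 𝓘(ℝ, ℝ)) (x := q))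

theorem projL_apply (q : N × L) (u : EuclideanSpace ℝ (Fin 6) × ℝ) : projL q u = u.2 :=
  congrArg (fun T : EuclideanSpace ℝ (Fin 6) × ℝ →L[ℝ] ℝ => T u)
    (mfderiv_snd (I := 𝓡 6) (I' := 𝓘(ℝ, ℝ)) (x := q))

theorem inclN_apply (q : N × L) (u : EuclideanSpace ℝ (Fin 6)) : inclN q u = (u, (0 : ℝ)) :=
  congrArg (fun T : EuclideanSpace ℝ (Fin 6) →L[ℝ] EuclideanSpace ℝ (Fin 6) × ℝ => T u)
    (mfderiv_prod_left (I := 𝓡 6) (I' := 𝓘(ℝ, ℝ)) (x₀ := q.1) (y₀ := q.2))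

theorem inclL_apply (q : N × L) (a : ℝ) : inclL q a = ((0 : EuclideanSpace ℝ (Fin 6)), a) :=
  congrArg (fun T : ℝ →L[ℝ] EuclideanSpace ℝ (Fin 6) × ℝ => T a)
    (mfderiv_prod_right (I := 𝓡 6) (I' := 𝓘(ℝ, ℝ)) (x₀ := q.1) (y₀ := q.2))

/-- Tangent vectors of `N × L` are pairs, with the component along `N` first. -/
theorem diagEnd_apply (q : N × L) (a b : ℝ) (u : EuclideanSpace ℝ (Fin 6) × ℝ) :
    diagEnd q a b u = (b • u.1, a * u.2) := by
  have e : diagEnd q a b u = a • inclL q (projL q u) + b • inclN q (projN q u) := rfl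
  have e1 : inclL q (projL q u) = ((0 : EuclideanSpace ℝ (Fin 6)), u.2) :=
    (congrArg _ (projL_apply q u)).trans (inclL_apply q u.2)
  have e2 : inclN q (projN q u) = (u.1, (0 : ℝ)) :=
    (congrArg _ (projN_apply q u)).trans (inclN_apply q u.1)
  refine (e.trans (congrArg₂ (fun x y : EuclideanSpace ℝ (Fin 6) × ℝ => a • x + b • y)
    e1 e2)).trans ?_
  have e3 : a • ((0 : EuclideanSpace ℝ (Fin 6)), u.2) + b • (u.1, (0 : ℝ)) =
      (b • u.1, a * u.2) := by
    ext <;> simp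
  exact e3

theorem J6_apply (σ : SU3Structure N) (q : N × L) (u : EuclideanSpace ℝ (Fin 6) × ℝ) :
    J6 σ q u = ((σ.J q.1 u.1 : EuclideanSpace ℝ (Fin 6)), (0 : ℝ)) :=
  (congrArg (fun x => inclN q (σ.J q.1 x)) (projN_apply q u)).trans (inclN_apply q _)

theorem pullback_fst_apply {k : ℕ} {A : Type*} [NormedAddCommGroup A] [NormedSpace ℝ A]
    (α : DForm (𝓡 6) N k A) (q : N × L) (u : Fin k → EuclideanSpace ℝ (Fin 6) × ℝ) :
    α.pullback (I := I7) (M := N × L) Prod.fst q u = α q.1 (fun i => (u i).1) :=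
  congrArg (α q.1) (funext fun i => projN_apply q (u i))

theorem pullback_snd_apply {k : ℕ} {A : Type*} [NormedAddCommGroup A] [NormedSpace ℝ A]
    (α : DForm 𝓘(ℝ, ℝ) L k A) (q : N × L) (u : Fin k → EuclideanSpace ℝ (Fin 6) × ℝ) :
    α.pullback (I := I7) (M := N × L) Prod.snd q u = α q.2 (fun i => (u i).2) :=
  congrArg (α q.2) (funext fun i => projL_apply q (u i))

theorem one_form_apply (β : ℝ [⋀^Fin 1]→L[ℝ] ℝ) (a : Fin 1 → ℝ) : β a = a 0 * β (fun _ => 1) := by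
  have e : a = a 0 • (fun _ : Fin 1 => (1 : ℝ)) := by ext i; fin_cases i; simp
  have h := β.toAlternatingMap.map_update_smul (fun _ : Fin 1 => (1 : ℝ)) 0 (a 0) 1
  have e2 : Function.update (fun _ : Fin 1 => (1 : ℝ)) 0 (a 0 • 1) = a := by
    ext i; fin_cases i; simp
  have e3 : Function.update (fun _ : Fin 1 => (1 : ℝ)) 0 1 = fun _ => (1 : ℝ) := by
    ext i; fin_cases i; simp
  rw [e2, e3] at h
  exact h

/-- The projection to `N` of the coordinate vectors of the product chart. -/
theorem chartSymmDeriv_prod_fst (p : N × L) {η : EuclideanSpace ℝ (Fin 6) × ℝ}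
    (hη : η ∈ (extChartAt I7 p).target) (u : EuclideanSpace ℝ (Fin 6) × ℝ) :
    (chartSymmDeriv I7 p η u : EuclideanSpace ℝ (Fin 6) × ℝ).1
      = chartSymmDeriv (𝓡 6) p.1 η.1 u.1 := by
  have h1 : η.1 ∈ (extChartAt (𝓡 6) p.1).target := by
    rw [extChartAt_prod] at hη; exact hη.1
  have r7 : Set.range I7 = Set.univ := I7.range_eq_univ
  have r6 : Set.range (𝓡 6) = Set.univ := (𝓡 6).range_eq_univ
  have d7 : MDifferentiableAt 𝓘(ℝ, EuclideanSpace ℝ (Fin 6) × ℝ) I7 (extChartAt I7 p).symm η := by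
    have := mdifferentiableWithinAt_extChartAt_symm (I := I7) hη
    rwa [r7, mdifferentiableWithinAt_univ] at this
  have d6 : MDifferentiableAt 𝓘(ℝ, EuclideanSpace ℝ (Fin 6)) (𝓡 6) (extChartAt (𝓡 6) p.1).symm
      η.1 := by
    have := mdifferentiableWithinAt_extChartAt_symm (I := 𝓡 6) h1
    rwa [r6, mdifferentiableWithinAt_univ] at this
  have c1 := mfderiv_comp (I := 𝓘(ℝ, EuclideanSpace ℝ (Fin 6) × ℝ)) (I' := I7) (I'' := 𝓡 6) η
    (g := (Prod.fst : N × L → N)) mdifferentiableAt_fst d7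
  have c2 := mfderiv_comp (I := 𝓘(ℝ, EuclideanSpace ℝ (Fin 6) × ℝ))
    (I' := 𝓘(ℝ, EuclideanSpace ℝ (Fin 6))) (I'' := 𝓡 6) η
    (f := ContinuousLinearMap.fst ℝ (EuclideanSpace ℝ (Fin 6)) ℝ)
    (g := (extChartAt (𝓡 6) p.1).symm) d6 (ContinuousLinearMap.mdifferentiableAt _)
  have e : (Prod.fst : N × L → N) ∘ (extChartAt I7 p).symm
      = (extChartAt (𝓡 6) p.1).symm ∘ (ContinuousLinearMap.fst ℝ (EuclideanSpace ℝ (Fin 6)) ℝ) := by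
    ext z; rw [extChartAt_prod]; rfl
  rw [e] at c1
  have s7 : chartSymmDeriv I7 p η
      = mfderiv 𝓘(ℝ, EuclideanSpace ℝ (Fin 6) × ℝ) I7 (extChartAt I7 p).symm η := by
    rw [chartSymmDeriv, r7, mfderivWithin_univ]
  have s6 : chartSymmDeriv (𝓡 6) p.1 η.1
      = mfderiv 𝓘(ℝ, EuclideanSpace ℝ (Fin 6)) (𝓡 6) (extChartAt (𝓡 6) p.1).symm η.1 := by
    rw [chartSymmDeriv, r6, mfderivWithin_univ]
  have f1 : mfderiv 𝓘(ℝ, EuclideanSpace ℝ (Fin 6) × ℝ) 𝓘(ℝ, EuclideanSpace ℝ (Fin 6))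
      (ContinuousLinearMap.fst ℝ (EuclideanSpace ℝ (Fin 6)) ℝ) η
        = ContinuousLinearMap.fst ℝ (EuclideanSpace ℝ (Fin 6)) ℝ := ContinuousLinearMap.mfderiv_eq _
  have c3 := congrArg (fun T : EuclideanSpace ℝ (Fin 6) × ℝ →L[ℝ] EuclideanSpace ℝ (Fin 6) => T u)
    (c1.symm.trans c2)
  rw [s7, s6]
  refine (projN_apply ((extChartAt I7 p).symm η) _).symm.trans (c3.trans ?_)
  exact congrArg (fun T : EuclideanSpace ℝ (Fin 6) × ℝ →L[ℝ] EuclideanSpace ℝ (Fin 6) =>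
    (mfderiv 𝓘(ℝ, EuclideanSpace ℝ (Fin 6)) (𝓡 6) (extChartAt (𝓡 6) p.1).symm η.1 :
      EuclideanSpace ℝ (Fin 6) →L[ℝ] EuclideanSpace ℝ (Fin 6)) (T u)) f1

/-- The projection to `L` of the coordinate vectors of the product chart. -/
theorem chartSymmDeriv_prod_snd (p : N × L) {η : EuclideanSpace ℝ (Fin 6) × ℝ}
    (hη : η ∈ (extChartAt I7 p).target) (u : EuclideanSpace ℝ (Fin 6) × ℝ) :
    (chartSymmDeriv I7 p η u : EuclideanSpace ℝ (Fin 6) × ℝ).2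
      = chartSymmDeriv 𝓘(ℝ, ℝ) p.2 η.2 u.2 := by
  have h1 : η.2 ∈ (extChartAt 𝓘(ℝ, ℝ) p.2).target := by
    rw [extChartAt_prod] at hη; exact hη.2
  have r7 : Set.range I7 = Set.univ := I7.range_eq_univ
  have r1 : Set.range 𝓘(ℝ, ℝ) = Set.univ := (𝓘(ℝ, ℝ)).range_eq_univ
  have d7 : MDifferentiableAt 𝓘(ℝ, EuclideanSpace ℝ (Fin 6) × ℝ) I7 (extChartAt I7 p).symm η := by
    have := mdifferentiableWithinAt_extChartAt_symm (I := I7) hη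
    rwa [r7, mdifferentiableWithinAt_univ] at this
  have d1 : MDifferentiableAt 𝓘(ℝ, ℝ) 𝓘(ℝ, ℝ) (extChartAt 𝓘(ℝ, ℝ) p.2).symm η.2 := by
    have := mdifferentiableWithinAt_extChartAt_symm (I := 𝓘(ℝ, ℝ)) h1
    rwa [r1, mdifferentiableWithinAt_univ] at this
  have c1 := mfderiv_comp (I := 𝓘(ℝ, EuclideanSpace ℝ (Fin 6) × ℝ)) (I' := I7) (I'' := 𝓘(ℝ, ℝ)) η
    (g := (Prod.snd : N × L → L)) mdifferentiableAt_snd d7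
  have c2 := mfderiv_comp (I := 𝓘(ℝ, EuclideanSpace ℝ (Fin 6) × ℝ))
    (I' := 𝓘(ℝ, ℝ)) (I'' := 𝓘(ℝ, ℝ)) η
    (f := ContinuousLinearMap.snd ℝ (EuclideanSpace ℝ (Fin 6)) ℝ)
    (g := (extChartAt 𝓘(ℝ, ℝ) p.2).symm) d1 (ContinuousLinearMap.mdifferentiableAt _)
  have e : (Prod.snd : N × L → L) ∘ (extChartAt I7 p).symm
      = (extChartAt 𝓘(ℝ, ℝ) p.2).symm ∘
        (ContinuousLinearMap.snd ℝ (EuclideanSpace ℝ (Fin 6)) ℝ) := by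
    ext z; rw [extChartAt_prod]; rfl
  rw [e] at c1
  have s7 : chartSymmDeriv I7 p η
      = mfderiv 𝓘(ℝ, EuclideanSpace ℝ (Fin 6) × ℝ) I7 (extChartAt I7 p).symm η := by
    rw [chartSymmDeriv, r7, mfderivWithin_univ]
  have s1 : chartSymmDeriv 𝓘(ℝ, ℝ) p.2 η.2
      = mfderiv 𝓘(ℝ, ℝ) 𝓘(ℝ, ℝ) (extChartAt 𝓘(ℝ, ℝ) p.2).symm η.2 := by
    rw [chartSymmDeriv, r1, mfderivWithin_univ]
  have f1 : mfderiv 𝓘(ℝ, EuclideanSpace ℝ (Fin 6) × ℝ) 𝓘(ℝ, ℝ)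
      (ContinuousLinearMap.snd ℝ (EuclideanSpace ℝ (Fin 6)) ℝ) η
        = ContinuousLinearMap.snd ℝ (EuclideanSpace ℝ (Fin 6)) ℝ := ContinuousLinearMap.mfderiv_eq _
  have c3 := congrArg (fun T : EuclideanSpace ℝ (Fin 6) × ℝ →L[ℝ] ℝ => T u)
    (c1.symm.trans c2)
  rw [s7, s1]
  refine (projL_apply ((extChartAt I7 p).symm η) _).symm.trans (c3.trans ?_)
  exact congrArg (fun T : EuclideanSpace ℝ (Fin 6) × ℝ →L[ℝ] ℝ =>
    (mfderiv 𝓘(ℝ, ℝ) 𝓘(ℝ, ℝ) (extChartAt 𝓘(ℝ, ℝ) p.2).symm η.2 : ℝ →L[ℝ] ℝ) (T u)) f1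

variable (σ : SU3Structure N) (dr : DForm 𝓘(ℝ, ℝ) L 1 ℝ) (F : L → ℂ) (G : L → ℝ)

/-- The coefficient `ρ` in `dr = ρ ds`, for the coordinate `s` on the tangent space `ℝ` of `L`. -/
def drCoeff (t : L) : ℝ := dr t (fun _ => (1 : ℝ))

/-- The coefficient of `ds` in `G dr`. Its sign depends on the coordinate `s`. -/
def lapse (t : L) : ℝ := G t * drCoeff dr t

theorem polar_cube {F : ℂ} {h θ : ℝ} (hF : F = (h : ℂ) * Complex.exp (Complex.I * ((θ : ℂ) / 3))) :
    F ^ 3 = ((h ^ 3 : ℝ) : ℂ) * ((Real.cos θ : ℝ) + (Real.sin θ : ℝ) * Complex.I) := by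
  rw [hF, mul_pow, ← Complex.exp_nat_mul]
  have e : ((3 : ℕ) : ℂ) * (Complex.I * ((θ : ℂ) / 3)) = θ * Complex.I := by
    push_cast; ring
  rw [e, Complex.exp_mul_I]
  push_cast
  ring

/-- Only `|F|² = h²` holds, since `h` may be negative. -/
theorem polar_norm_sq {F : ℂ} {h θ : ℝ}
    (hF : F = (h : ℂ) * Complex.exp (Complex.I * ((θ : ℂ) / 3))) : ‖F‖ ^ 2 = h ^ 2 := by
  have e : Complex.I * ((θ : ℂ) / 3) = ((θ / 3 : ℝ) : ℂ) * Complex.I := by push_cast; ring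
  rw [hF, norm_mul, e, Complex.norm_exp_ofReal_mul_I, mul_one, Complex.norm_real,
    Real.norm_eq_abs, sq_abs]

/-- The form `ω` at a point, on the model space. -/
def SU3Structure.omegaAt (y : N) : EuclideanSpace ℝ (Fin 6) [⋀^Fin 2]→L[ℝ] ℝ := σ.omega y

/-- The form `Ω` at a point, on the model space. -/
def SU3Structure.OmegaAt (y : N) : EuclideanSpace ℝ (Fin 6) [⋀^Fin 3]→L[ℝ] ℂ := σ.Omega y

/-- The metric at a point, on the model space. -/
def SU3Structure.metricAt (y : N) :
    EuclideanSpace ℝ (Fin 6) →L[ℝ] EuclideanSpace ℝ (Fin 6) →L[ℝ] ℝ := σ.g.inner y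

/-- The almost complex structure at a point, on the model space. -/
def SU3Structure.JAt (y : N) : EuclideanSpace ℝ (Fin 6) →L[ℝ] EuclideanSpace ℝ (Fin 6) := σ.J y

theorem omegaM_apply (q : N × L) (u v : EuclideanSpace ℝ (Fin 6) × ℝ) :
    omegaM σ q ![u, v] = σ.omegaAt q.1 ![u.1, v.1] := by
  refine (pullback_fst_apply σ.omega q ![u, v]).trans (congrArg (σ.omega q.1) ?_)
  ext i; fin_cases i <;> rfl

theorem OmegaM_apply (q : N × L) (u v w : EuclideanSpace ℝ (Fin 6) × ℝ) :
    OmegaM σ q ![u, v, w] = σ.OmegaAt q.1 ![u.1, v.1, w.1] := by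
  refine (pullback_fst_apply σ.Omega q ![u, v, w]).trans (congrArg (σ.Omega q.1) ?_)
  ext i; fin_cases i <;> rfl

theorem drM_apply (q : N × L) (u : EuclideanSpace ℝ (Fin 6) × ℝ) :
    drM dr q ![u] = u.2 * drCoeff dr q.2 :=
  (pullback_snd_apply dr q ![u]).trans (one_form_apply (dr q.2) _)

/-- With `F = h e^{iθ/3}`, the form `φ` is `Re(h³ e^{iθ} Ω) + r h² ds ∧ ω`. -/
theorem phi_apply (q : N × L) (h θ : ℝ)
    (hF : F q.2 = (h : ℂ) * Complex.exp (Complex.I * ((θ : ℂ) / 3)))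
    (u v w : EuclideanSpace ℝ (Fin 6) × ℝ) :
    phi σ dr F G q ![u, v, w]
      = warpedPhi (σ.omegaAt q.1) (σ.OmegaAt q.1) h θ (lapse dr G q.2)
        u v w := by
  have e1 : phi σ dr F G q ![u, v, w]
      = (F q.2 ^ 3 * OmegaM σ q ![u, v, w]).re
        + G q.2 * ‖F q.2‖ ^ 2 * (drM dr q ![u] * omegaM σ q ![v, w]
          - drM dr q ![v] * omegaM σ q ![u, w] + drM dr q ![w] * omegaM σ q ![u, v]) :=
    congrArg (fun x : ℝ => (F q.2 ^ 3 * OmegaM σ q ![u, v, w]).re + G q.2 * ‖F q.2‖ ^ 2 * x)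
      (wedge_one_two (drM dr q) (omegaM σ q) ![u, v, w])
  rw [OmegaM_apply, omegaM_apply, omegaM_apply, omegaM_apply, drM_apply, drM_apply, drM_apply,
    polar_cube hF, polar_norm_sq hF] at e1
  refine e1.trans ?_
  rw [warpedPhi, lapse]
  simp only [Complex.mul_re, Complex.mul_im, Complex.add_re, Complex.add_im, Complex.ofReal_re,
    Complex.ofReal_im, Complex.I_re, Complex.I_im]
  ring

theorem psi_apply (q : N × L) (h θ : ℝ)
    (hF : F q.2 = (h : ℂ) * Complex.exp (Complex.I * ((θ : ℂ) / 3)))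
    (u v w z : EuclideanSpace ℝ (Fin 6) × ℝ) :
    psi σ dr F G q ![u, v, w, z]
      = warpedPsi (σ.omegaAt q.1) (σ.OmegaAt q.1) h θ (lapse dr G q.2)
        u v w z := by
  have e4 : ‖F q.2‖ ^ 4 = h ^ 4 := by
    calc ‖F q.2‖ ^ 4 = (‖F q.2‖ ^ 2) ^ 2 := by ring
      _ = h ^ 4 := by rw [polar_norm_sq hF]; ring
  have e1 : psi σ dr F G q ![u, v, w, z]
      = 1 / 2 * ‖F q.2‖ ^ 4 * (omegaM σ q ![u, v] * omegaM σ q ![w, z]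
          - omegaM σ q ![u, w] * omegaM σ q ![v, z] + omegaM σ q ![u, z] * omegaM σ q ![v, w]
          + omegaM σ q ![v, w] * omegaM σ q ![u, z] - omegaM σ q ![v, z] * omegaM σ q ![u, w]
          + omegaM σ q ![w, z] * omegaM σ q ![u, v])
        + ((F q.2 ^ 3 * OmegaM σ q ![u, v, w]).im * (G q.2 * drM dr q ![z])
          - (F q.2 ^ 3 * OmegaM σ q ![u, v, z]).im * (G q.2 * drM dr q ![w])
          + (F q.2 ^ 3 * OmegaM σ q ![u, w, z]).im * (G q.2 * drM dr q ![v])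
          - (F q.2 ^ 3 * OmegaM σ q ![v, w, z]).im * (G q.2 * drM dr q ![u])) :=
    congrArg₂ (fun x y : ℝ => 1 / 2 * ‖F q.2‖ ^ 4 * x + y)
      (wedge_two_two (omegaM σ q) (omegaM σ q) ![u, v, w, z])
      (wedge_three_one (imForm (F q.2 ^ 3 • OmegaM σ q)) (G q.2 • drM dr q) ![u, v, w, z])
  have hIm : ∀ a b c : EuclideanSpace ℝ (Fin 6) × ℝ, (F q.2 ^ 3 * OmegaM σ q ![a, b, c]).im
      = warpedIm (σ.OmegaAt q.1) h θ a.1 b.1 c.1 := fun a b c => by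
    rw [OmegaM_apply, polar_cube hF, warpedIm]
    simp only [Complex.mul_re, Complex.mul_im, Complex.add_re, Complex.add_im, Complex.ofReal_re,
      Complex.ofReal_im, Complex.I_re, Complex.I_im]
    ring
  rw [hIm, hIm, hIm, hIm, omegaM_apply, omegaM_apply, omegaM_apply, omegaM_apply,
    omegaM_apply, omegaM_apply, drM_apply, drM_apply, drM_apply,
    drM_apply, e4] at e1
  rw [e1, warpedPsi, lapse]
  ring

theorem g7_apply (q : N × L) (h θ : ℝ)
    (hF : F q.2 = (h : ℂ) * Complex.exp (Complex.I * ((θ : ℂ) / 3)))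
    (u v : EuclideanSpace ℝ (Fin 6) × ℝ) :
    g7 σ dr F G q u v
      = lapse dr G q.2 ^ 2 * (u.2 * v.2) + h ^ 2 * σ.metricAt q.1 u.1 v.1 := by
  have hone : ∀ w : EuclideanSpace ℝ (Fin 6) × ℝ,
      drM dr q (fun _ => w) = w.2 * drCoeff dr q.2 := fun w =>
    (pullback_snd_apply dr q fun _ => w).trans (one_form_apply (dr q.2) _)
  have e1 : g7 σ dr F G q u v
      = G q.2 ^ 2 * (drM dr q (fun _ => u) * drM dr q (fun _ => v))
      + ‖F q.2‖ ^ 2 * σ.metricAt q.1 (projN q u) (projN q v) := rfl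
  rw [hone, hone, polar_norm_sq hF, projN_apply, projN_apply] at e1
  rw [e1, lapse]
  ring

end Product

/-! ### Warped forms and their derivatives -/

section WarpedForm

variable {W : Type*} [NormedAddCommGroup W] [NormedSpace ℝ W]

/-- The operator `β ↦ ds ∧ β` from `2`-forms on `W` to `3`-forms on `W × ℝ`, as a bounded operator,
so that `ds ∧ ω` is differentiable when `ω` is. -/
def wedgeDs : (W [⋀^Fin 2]→L[ℝ] ℝ) →L[ℝ] (W × ℝ) [⋀^Fin 3]→L[ℝ] ℝ :=
  LinearMap.mkContinuous
    { toFun := fun β => (wedge (ContinuousAlternatingMap.ofSubsingleton ℝ (W × ℝ) ℝ (0 : Fin 1)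
          (ContinuousLinearMap.snd ℝ W ℝ))
        (β.compContinuousLinearMap (ContinuousLinearMap.fst ℝ W ℝ)) :
        (W × ℝ) [⋀^Fin (1 + 2)]→L[ℝ] ℝ)
      map_add' := fun β β' => by
        ext v
        simp only [wedge_one_two, ContinuousAlternatingMap.add_apply,
          ContinuousAlternatingMap.compContinuousLinearMap_apply]
        ring
      map_smul' := fun c β => by
        ext v
        simp only [wedge_one_two, ContinuousAlternatingMap.smul_apply,
          ContinuousAlternatingMap.compContinuousLinearMap_apply, RingHom.id_apply, smul_eq_mul]
        ring } 3 (by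
    intro β
    refine ContinuousAlternatingMap.opNorm_le_bound _ (by positivity) fun v => ?_
    have hb : ∀ i j k : Fin 3, ‖(v i).2 * β ![(v j).1, (v k).1]‖
        ≤ ‖β‖ * (‖v i‖ * ‖v j‖ * ‖v k‖) := fun i j k => by
      rw [norm_mul]
      have h1 : ‖β ![(v j).1, (v k).1]‖ ≤ ‖β‖ * (‖v j‖ * ‖v k‖) := by
        refine (β.le_opNorm _).trans ?_
        rw [Fin.prod_univ_two]
        gcongr
        · exact norm_fst_le (v j)
        · exact norm_fst_le (v k)
      calc ‖(v i).2‖ * ‖β ![(v j).1, (v k).1]‖ ≤ ‖v i‖ * (‖β‖ * (‖v j‖ * ‖v k‖)) :=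
            mul_le_mul (norm_snd_le (v i)) h1 (norm_nonneg _) (norm_nonneg _)
        _ = _ := by ring
    have e : (wedge (ContinuousAlternatingMap.ofSubsingleton ℝ (W × ℝ) ℝ (0 : Fin 1)
          (ContinuousLinearMap.snd ℝ W ℝ))
        (β.compContinuousLinearMap (ContinuousLinearMap.fst ℝ W ℝ)) :
        (W × ℝ) [⋀^Fin (1 + 2)]→L[ℝ] ℝ) v = (v 0).2 * β ![(v 1).1, (v 2).1]
          - (v 1).2 * β ![(v 0).1, (v 2).1] + (v 2).2 * β ![(v 0).1, (v 1).1] := by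
      refine (wedge_one_two _ _ v).trans ?_
      have h2 : ∀ i j : Fin 3, (β.compContinuousLinearMap (ContinuousLinearMap.fst ℝ W ℝ))
          ![v i, v j] = β ![(v i).1, (v j).1] := fun i j =>
        congrArg β (by ext k; fin_cases k <;> rfl)
      exact congrArg₂ (· + ·) (congrArg₂ (· - ·) (congrArg (_ * ·) (h2 1 2))
        (congrArg (_ * ·) (h2 0 2))) (congrArg (_ * ·) (h2 0 1))
    refine (congrArg norm e).le.trans ((norm_add_le _ _).trans
      ((add_le_add (norm_sub_le _ _) le_rfl).trans ?_))
    have := add_le_add (add_le_add (hb 0 1 2) (hb 1 0 2)) (hb 2 0 1)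
    refine this.trans (le_of_eq ?_)
    rw [Fin.prod_univ_three]
    ring)

theorem wedgeDs_apply (β : W [⋀^Fin 2]→L[ℝ] ℝ) (u v w : W × ℝ) :
    wedgeDs β ![u, v, w] = u.2 * β ![v.1, w.1] - v.2 * β ![u.1, w.1] + w.2 * β ![u.1, v.1] := by
  refine (wedge_one_two _ _ ![u, v, w]).trans ?_
  have h2 : ∀ a b : W × ℝ, (β.compContinuousLinearMap (ContinuousLinearMap.fst ℝ W ℝ))
      ![a, b] = β ![a.1, b.1] := fun a b => congrArg β (by ext k; fin_cases k <;> rfl)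
  exact congrArg₂ (· + ·) (congrArg₂ (· - ·) (congrArg (_ * ·) (h2 v w))
    (congrArg (_ * ·) (h2 u w))) (congrArg (_ * ·) (h2 u v))

/-- The form `Re(h³ e^{iθ} Ω) + r h² ds ∧ ω` on `W × ℝ`, for functions `h`, `θ`, `r` on `ℝ` and
forms on `W`. -/
def warpedForm (oh : W → W [⋀^Fin 2]→L[ℝ] ℝ) (Oh : W → W [⋀^Fin 3]→L[ℝ] ℂ) (h θ r : ℝ → ℝ)
    (η : W × ℝ) : (W × ℝ) [⋀^Fin 3]→L[ℝ] ℝ :=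
  (h η.2 ^ 3 * Real.cos (θ η.2)) • Complex.reCLM.compContinuousAlternatingMap
      ((Oh η.1).compContinuousLinearMap (ContinuousLinearMap.fst ℝ W ℝ))
    - (h η.2 ^ 3 * Real.sin (θ η.2)) • Complex.imCLM.compContinuousAlternatingMap
      ((Oh η.1).compContinuousLinearMap (ContinuousLinearMap.fst ℝ W ℝ))
    + (r η.2 * h η.2 ^ 2) • wedgeDs (oh η.1)

theorem warpedForm_apply (oh : W → W [⋀^Fin 2]→L[ℝ] ℝ) (Oh : W → W [⋀^Fin 3]→L[ℝ] ℂ)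
    (h θ r : ℝ → ℝ) (η u v w : W × ℝ) : warpedForm oh Oh h θ r η ![u, v, w]
      = warpedPhi (oh η.1) (Oh η.1) (h η.2) (θ η.2) (r η.2) u v w := by
  have e : ((Oh η.1).compContinuousLinearMap (ContinuousLinearMap.fst ℝ W ℝ)) ![u, v, w]
      = Oh η.1 ![u.1, v.1, w.1] := congrArg (Oh η.1) (by ext k; fin_cases k <;> rfl)
  simp only [warpedForm, ContinuousAlternatingMap.add_apply, ContinuousAlternatingMap.sub_apply,
    ContinuousAlternatingMap.smul_apply, wedgeDs_apply, smul_eq_mul, warpedPhi,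
    ContinuousLinearMap.compContinuousAlternatingMap_coe, Function.comp_apply, e,
    Complex.reCLM_apply, Complex.imCLM_apply]
  ring

variable {oh : W → W [⋀^Fin 2]→L[ℝ] ℝ} {Oh : W → W [⋀^Fin 3]→L[ℝ] ℂ} {h θ r : ℝ → ℝ} {c : W × ℝ}

theorem differentiableAt_warpedForm (ho : DifferentiableAt ℝ oh c.1)
    (hO : DifferentiableAt ℝ Oh c.1) (hh : DifferentiableAt ℝ h c.2)
    (hθ : DifferentiableAt ℝ θ c.2) (hr : DifferentiableAt ℝ r c.2) :
    DifferentiableAt ℝ (warpedForm oh Oh h θ r) c := by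
  have hh' : DifferentiableAt ℝ (fun η : W × ℝ => h η.2) c := hh.comp c differentiableAt_snd
  have hθ' : DifferentiableAt ℝ (fun η : W × ℝ => θ η.2) c := hθ.comp c differentiableAt_snd
  have hr' : DifferentiableAt ℝ (fun η : W × ℝ => r η.2) c := hr.comp c differentiableAt_snd
  have ho' : DifferentiableAt ℝ (fun η : W × ℝ => oh η.1) c := ho.comp c differentiableAt_fst
  have hO' : DifferentiableAt ℝ (fun η : W × ℝ => Oh η.1) c := hO.comp c differentiableAt_fst
  have hO2 : DifferentiableAt ℝ (fun η : W × ℝ => (Oh η.1).compContinuousLinearMap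
      (ContinuousLinearMap.fst ℝ W ℝ)) c :=
    hO'.continuousAlternatingMapCompContinuousLinearMap (differentiableAt_const _)
  have hre : DifferentiableAt ℝ (fun η : W × ℝ => Complex.reCLM.compContinuousAlternatingMap
      ((Oh η.1).compContinuousLinearMap (ContinuousLinearMap.fst ℝ W ℝ))) c :=
    (ContinuousLinearMap.compContinuousAlternatingMapCLM ℝ (W × ℝ) ℂ ℝ (Fin 3)
      Complex.reCLM).differentiableAt.comp c hO2
  have him : DifferentiableAt ℝ (fun η : W × ℝ => Complex.imCLM.compContinuousAlternatingMap
      ((Oh η.1).compContinuousLinearMap (ContinuousLinearMap.fst ℝ W ℝ))) c :=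
    (ContinuousLinearMap.compContinuousAlternatingMapCLM ℝ (W × ℝ) ℂ ℝ (Fin 3)
      Complex.imCLM).differentiableAt.comp c hO2
  have hw : DifferentiableAt ℝ (fun η : W × ℝ => wedgeDs (oh η.1)) c :=
    (wedgeDs (W := W)).differentiableAt.comp c (f := fun η : W × ℝ => oh η.1) ho'
  exact (((hh'.pow 3).mul hθ'.cos).smul hre |>.sub (((hh'.pow 3).mul hθ'.sin).smul him)).add
    ((hr'.mul (hh'.pow 2)).smul hw)

/-- The derivative of `warpedForm`, computed along the line `c + t u`. -/
theorem fderiv_warpedForm {h' θ' r' : ℝ} (ho : DifferentiableAt ℝ oh c.1)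
    (hO : DifferentiableAt ℝ Oh c.1) (hh : HasDerivAt h h' c.2) (hθ : HasDerivAt θ θ' c.2)
    (hr : HasDerivAt r r' c.2) (u v w x : W × ℝ) :
    fderiv ℝ (warpedForm oh Oh h θ r) c u ![v, w, x]
      = 3 * h c.2 ^ 2 * h' * u.2 * (Real.cos (θ c.2) * (Oh c.1 ![v.1, w.1, x.1]).re
          - Real.sin (θ c.2) * (Oh c.1 ![v.1, w.1, x.1]).im)
        + h c.2 ^ 3 * (-(Real.sin (θ c.2) * (θ' * u.2)) * (Oh c.1 ![v.1, w.1, x.1]).re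
          + Real.cos (θ c.2) * (fderiv ℝ Oh c.1 u.1 ![v.1, w.1, x.1]).re
          - (Real.cos (θ c.2) * (θ' * u.2) * (Oh c.1 ![v.1, w.1, x.1]).im
            + Real.sin (θ c.2) * (fderiv ℝ Oh c.1 u.1 ![v.1, w.1, x.1]).im))
        + (r' * h c.2 ^ 2 + r c.2 * (2 * h c.2 * h')) * u.2 * (v.2 * oh c.1 ![w.1, x.1]
          - w.2 * oh c.1 ![v.1, x.1] + x.2 * oh c.1 ![v.1, w.1])
        + r c.2 * h c.2 ^ 2 * (v.2 * fderiv ℝ oh c.1 u.1 ![w.1, x.1]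
          - w.2 * fderiv ℝ oh c.1 u.1 ![v.1, x.1] + x.2 * fderiv ℝ oh c.1 u.1 ![v.1, w.1]) := by
  have hd := differentiableAt_warpedForm ho hO hh.differentiableAt hθ.differentiableAt
    hr.differentiableAt
  have line : HasDerivAt (fun t : ℝ => c + t • u) u 0 := by
    simpa using ((hasDerivAt_id (0 : ℝ)).smul_const u).const_add c
  have c0 : c + (0 : ℝ) • u = c := by simp
  have comp1 : ∀ {f : ℝ → ℝ} {f' : ℝ}, HasDerivAt f f' c.2 →
      HasDerivAt (fun t : ℝ => f (c + t • u).2) (f' * u.2) 0 := fun {f f'} hf => by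
    have l2 : HasDerivAt (fun t : ℝ => (c + t • u).2) u.2 0 :=
      (ContinuousLinearMap.snd ℝ W ℝ).hasFDerivAt.comp_hasDerivAt 0 line
    exact HasDerivAt.comp (0 : ℝ) (h₂ := f) (h := fun t : ℝ => (c + t • u).2)
      (by rw [c0]; exact hf) l2
  have comp2 : ∀ {k : ℕ} {A : Type} [NormedAddCommGroup A] [NormedSpace ℝ A]
      {f : W → W [⋀^Fin k]→L[ℝ] A}, DifferentiableAt ℝ f c.1 → ∀ b : Fin k → W,
      HasDerivAt (fun t : ℝ => f (c + t • u).1 b) (fderiv ℝ f c.1 u.1 b) 0 := by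
    intro k A _ _ f hf b
    have l1 : HasDerivAt (fun t : ℝ => (c + t • u).1) u.1 0 :=
      (ContinuousLinearMap.fst ℝ W ℝ).hasFDerivAt.comp_hasDerivAt 0 line
    have h1 : HasFDerivAt f (fderiv ℝ f c.1) ((fun t : ℝ => (c + t • u).1) 0) := by
      simpa using hf.hasFDerivAt
    have h2 := h1.comp_hasDerivAt (0 : ℝ) l1
    exact (ContinuousAlternatingMap.apply ℝ W A b).hasFDerivAt.comp_hasDerivAt (0 : ℝ) h2
  have h1 : HasDerivAt (fun t : ℝ => warpedForm oh Oh h θ r (c + t • u) ![v, w, x])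
      (fderiv ℝ (warpedForm oh Oh h θ r) c u ![v, w, x]) 0 := by
    have h0 : HasFDerivAt (warpedForm oh Oh h θ r) (fderiv ℝ (warpedForm oh Oh h θ r) c)
        ((fun t : ℝ => c + t • u) 0) := by simpa using hd.hasFDerivAt
    have h2 := h0.comp_hasDerivAt (0 : ℝ) line
    exact (ContinuousAlternatingMap.apply ℝ (W × ℝ) ℝ ![v, w, x]).hasFDerivAt.comp_hasDerivAt
      (0 : ℝ) h2
  have hre : ∀ b, HasDerivAt (fun t : ℝ => (Oh (c + t • u).1 b).re) (fderiv ℝ Oh c.1 u.1 b).re 0 :=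
    fun b => Complex.reCLM.hasFDerivAt.comp_hasDerivAt (0 : ℝ) (comp2 hO b)
  have him : ∀ b, HasDerivAt (fun t : ℝ => (Oh (c + t • u).1 b).im) (fderiv ℝ Oh c.1 u.1 b).im 0 :=
    fun b => Complex.imCLM.hasFDerivAt.comp_hasDerivAt (0 : ℝ) (comp2 hO b)
  have hcos := (comp1 hθ).cos
  have hsin := (comp1 hθ).sin
  have h3 := ((((comp1 hh).pow 3).mul ((hcos.mul (hre ![v.1, w.1, x.1])).sub
      (hsin.mul (him ![v.1, w.1, x.1])))).add
    (((comp1 hr).mul ((comp1 hh).pow 2)).mul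
      ((((comp2 ho ![w.1, x.1]).const_mul v.2).sub ((comp2 ho ![v.1, x.1]).const_mul w.2)).add
        ((comp2 ho ![v.1, w.1]).const_mul x.2))))
  have h4 : HasDerivAt (fun t : ℝ => warpedForm oh Oh h θ r (c + t • u) ![v, w, x]) _ 0 :=
    h3.congr_of_eventuallyEq (Filter.Eventually.of_forall fun t => by
      exact (warpedForm_apply oh Oh h θ r (c + t • u) v w x).trans rfl)
  rw [h1.unique h4]
  simp only [Pi.pow_apply, Pi.mul_apply, Pi.sub_apply, Pi.add_apply, c0]
  push_cast
  ring

theorem fderiv_warpedMetric {m : W → W →L[ℝ] W →L[ℝ] ℝ} {h' r' : ℝ} (hm : DifferentiableAt ℝ m c.1)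
    (hh : HasDerivAt h h' c.2) (hr : HasDerivAt r r' c.2) (u v w : W × ℝ) :
    fderiv ℝ (fun η : W × ℝ => r η.2 ^ 2 * (v.2 * w.2) + h η.2 ^ 2 * m η.1 v.1 w.1) c u
      = 2 * r c.2 * r' * u.2 * (v.2 * w.2) + 2 * h c.2 * h' * u.2 * m c.1 v.1 w.1
        + h c.2 ^ 2 * fderiv ℝ m c.1 u.1 v.1 w.1 := by
  have hr1 : HasFDerivAt (fun η : W × ℝ => r η.2) (r' • ContinuousLinearMap.snd ℝ W ℝ) c :=
    hr.comp_hasFDerivAt c hasFDerivAt_snd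
  have hh1 : HasFDerivAt (fun η : W × ℝ => h η.2) (h' • ContinuousLinearMap.snd ℝ W ℝ) c :=
    hh.comp_hasFDerivAt c hasFDerivAt_snd
  have hm1 : HasFDerivAt (fun η : W × ℝ => m η.1)
      ((fderiv ℝ m c.1).comp (ContinuousLinearMap.fst ℝ W ℝ)) c :=
    HasFDerivAt.comp (𝕜 := ℝ) (E := W × ℝ) (F := W) (G := W →L[ℝ] W →L[ℝ] ℝ) (f := Prod.fst)
      (g := m) c hm.hasFDerivAt hasFDerivAt_fst
  have hm2 := (hm1.clm_apply (hasFDerivAt_const v.1 c)).clm_apply (hasFDerivAt_const w.1 c)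
  have := (((hr1.pow 2).mul_const (v.2 * w.2)).add ((hh1.pow 2).mul hm2)).fderiv
  refine (congrArg (fun T : W × ℝ →L[ℝ] ℝ => T u) this).trans ?_
  simp
  ring

end WarpedForm

/-! ### `φ` and `g₇` in the product chart -/

section ProductChart

set_option linter.unusedSectionVars false

variable {N : Type*} [TopologicalSpace N] [ChartedSpace (EuclideanSpace ℝ (Fin 6)) N]
  [IsManifold (𝓡 6) ∞ N] {L : Type*} [TopologicalSpace L] [ChartedSpace ℝ L]
  [IsManifold 𝓘(ℝ, ℝ) ∞ L]
  (σ : SU3Structure N) (dr : DForm 𝓘(ℝ, ℝ) L 1 ℝ) (F : L → ℂ) (G : L → ℝ)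

/-- The coefficient of `ds` in `G dr`, where `s` is the coordinate of the chart at `t`. -/
def lapseChart (t : L) (s : ℝ) : ℝ :=
  G ((extChartAt 𝓘(ℝ, ℝ) t).symm s) * dr.inChart t s (fun _ => (1 : ℝ))

/-- The derivative of the inverse of the chart at `t`. -/
def symmDerivOne (t : L) (s : ℝ) : ℝ := chartSymmDeriv 𝓘(ℝ, ℝ) t s (1 : ℝ)

/-- The vector at `η` with constant components `u` in the product chart. -/
def prodFrame (p : N × L) (η u : EuclideanSpace ℝ (Fin 6) × ℝ) : EuclideanSpace ℝ (Fin 6) × ℝ :=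
  (chartSymmDeriv (𝓡 6) p.1 η.1 u.1, u.2 * symmDerivOne p.2 η.2)

theorem chartSymmDeriv_prod (p : N × L) {η : EuclideanSpace ℝ (Fin 6) × ℝ}
    (hη : η ∈ (extChartAt I7 p).target) (u : EuclideanSpace ℝ (Fin 6) × ℝ) :
    chartSymmDeriv I7 p η u = prodFrame p η u := by
  have e := (chartSymmDeriv 𝓘(ℝ, ℝ) p.2 η.2).map_smul u.2 (1 : ℝ)
  rw [smul_eq_mul, mul_one] at e
  exact Prod.ext (chartSymmDeriv_prod_fst p hη u) ((chartSymmDeriv_prod_snd p hη u).trans e)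

/-- The one-form `G dr`, evaluated on a vector with given components in the chart. -/
theorem lapse_mul_prodFrame (p : N × L) (η u : EuclideanSpace ℝ (Fin 6) × ℝ) :
    lapse dr G ((extChartAt I7 p).symm η).2 * (prodFrame p η u).2
      = lapseChart dr G p.2 η.2 * u.2 := by
  have e : dr.inChart p.2 η.2 (fun _ => (1 : ℝ)) = symmDerivOne p.2 η.2
      * drCoeff dr ((extChartAt 𝓘(ℝ, ℝ) p.2).symm η.2) :=
    one_form_apply (dr ((extChartAt 𝓘(ℝ, ℝ) p.2).symm η.2)) (fun _ => symmDerivOne p.2 η.2)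
  have hs : ((extChartAt I7 p).symm η).2 = (extChartAt 𝓘(ℝ, ℝ) p.2).symm η.2 := rfl
  rw [lapseChart, e, lapse, prodFrame, hs]
  ring

theorem lapseChart_self (t : L) : lapseChart dr G t (extChartAt 𝓘(ℝ, ℝ) t t) = lapse dr G t := by
  rw [lapseChart, extChartAt_to_inv, lapse, drCoeff]
  exact congrArg (G t * ·) (DForm.inChart_self dr t fun _ => (1 : ℝ))

variable {F} {U : Set L} {h θ : L → ℝ}

/-- `φ` in the product chart. -/
theorem phi_inChart_eventuallyEq (hU : IsOpen U)
    (hF : ∀ t ∈ U, F t = (h t : ℂ) * Complex.exp (Complex.I * ((θ t : ℂ) / 3)))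
    (p : N × L) (hp : p.2 ∈ U) :
    (phi σ dr F G).inChart p =ᶠ[𝓝 (extChartAt I7 p p)]
      warpedForm (σ.omega.inChart p.1) (σ.Omega.inChart p.1)
        (h ∘ (extChartAt 𝓘(ℝ, ℝ) p.2).symm) (θ ∘ (extChartAt 𝓘(ℝ, ℝ) p.2).symm)
        (lapseChart dr G p.2) := by
  have hU' : ∀ᶠ q : N × L in 𝓝 p, q.2 ∈ U :=
    continuous_snd.continuousAt.eventually (hU.mem_nhds hp)
  filter_upwards [extChartAt_target_mem_nhds (I := I7) p,
    eventually_comp_extChartAt_symm (I := I7) p hU'] with η hη hηU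
  ext v
  have hv : v = ![v 0, v 1, v 2] := by ext1 i; fin_cases i <;> rfl
  rw [hv, warpedForm_apply]
  have e1 : (phi σ dr F G).inChart p η ![v 0, v 1, v 2]
      = phi σ dr F G ((extChartAt I7 p).symm η)
        ![prodFrame p η (v 0), prodFrame p η (v 1), prodFrame p η (v 2)] := by
    refine congrArg (phi σ dr F G ((extChartAt I7 p).symm η)) ?_
    funext i
    fin_cases i
    · exact chartSymmDeriv_prod p hη (v 0)
    · exact chartSymmDeriv_prod p hη (v 1)
    · exact chartSymmDeriv_prod p hη (v 2)
  have e2 := phi_apply σ dr F G ((extChartAt I7 p).symm η) _ _ (hF _ hηU)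
    (prodFrame p η (v 0)) (prodFrame p η (v 1)) (prodFrame p η (v 2))
  refine (e1.trans e2).trans ?_
  have o2 : ∀ a b : EuclideanSpace ℝ (Fin 6) × ℝ, σ.omega.inChart p.1 η.1 ![a.1, b.1]
      = σ.omegaAt ((extChartAt I7 p).symm η).1 ![(prodFrame p η a).1, (prodFrame p η b).1] :=
    fun a b => DForm.inChart_two σ.omega p.1 η.1 a.1 b.1
  have o3 : ∀ a b d : EuclideanSpace ℝ (Fin 6) × ℝ, σ.Omega.inChart p.1 η.1 ![a.1, b.1, d.1]
      = σ.OmegaAt ((extChartAt I7 p).symm η).1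
        ![(prodFrame p η a).1, (prodFrame p η b).1, (prodFrame p η d).1] :=
    fun a b d => DForm.inChart_three σ.Omega p.1 η.1 a.1 b.1 d.1
  have hs : ((extChartAt I7 p).symm η).2 = (extChartAt 𝓘(ℝ, ℝ) p.2).symm η.2 := rfl
  simp only [warpedPhi, o2, o3, Function.comp_apply, ← hs]
  linear_combination (h ((extChartAt I7 p).symm η).2 ^ 2
      * σ.omegaAt ((extChartAt I7 p).symm η).1 ![(prodFrame p η (v 1)).1, (prodFrame p η (v 2)).1])
        * lapse_mul_prodFrame dr G p η (v 0)
    - (h ((extChartAt I7 p).symm η).2 ^ 2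
      * σ.omegaAt ((extChartAt I7 p).symm η).1 ![(prodFrame p η (v 0)).1, (prodFrame p η (v 2)).1])
        * lapse_mul_prodFrame dr G p η (v 1)
    + (h ((extChartAt I7 p).symm η).2 ^ 2
      * σ.omegaAt ((extChartAt I7 p).symm η).1 ![(prodFrame p η (v 0)).1, (prodFrame p η (v 1)).1])
        * lapse_mul_prodFrame dr G p η (v 2)

/-- `g₇` in the product chart. -/
theorem g7_inChart_eventuallyEq (hU : IsOpen U)
    (hF : ∀ t ∈ U, F t = (h t : ℂ) * Complex.exp (Complex.I * ((θ t : ℂ) / 3)))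
    (p : N × L) (hp : p.2 ∈ U) (v w : EuclideanSpace ℝ (Fin 6) × ℝ) :
    (fun η => bilinInChart (g7 σ dr F G) p η v w) =ᶠ[𝓝 (extChartAt I7 p p)]
      fun η => lapseChart dr G p.2 η.2 ^ 2 * (v.2 * w.2)
        + (h ∘ (extChartAt 𝓘(ℝ, ℝ) p.2).symm) η.2 ^ 2 * σ.metricChart p.1 η.1 v.1 w.1 := by
  have hU' : ∀ᶠ q : N × L in 𝓝 p, q.2 ∈ U :=
    continuous_snd.continuousAt.eventually (hU.mem_nhds hp)
  filter_upwards [extChartAt_target_mem_nhds (I := I7) p,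
    eventually_comp_extChartAt_symm (I := I7) p hU'] with η hη hηU
  have e1 : bilinInChart (g7 σ dr F G) p η v w
      = g7 σ dr F G ((extChartAt I7 p).symm η) (prodFrame p η v) (prodFrame p η w) :=
    congrArg₂ (fun a b : EuclideanSpace ℝ (Fin 6) × ℝ =>
      g7 σ dr F G ((extChartAt I7 p).symm η) a b) (chartSymmDeriv_prod p hη v)
      (chartSymmDeriv_prod p hη w)
  have e2 := g7_apply σ dr F G ((extChartAt I7 p).symm η) _ _ (hF _ hηU)
    (prodFrame p η v) (prodFrame p η w)
  have e3 : σ.metricChart p.1 η.1 v.1 w.1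
      = σ.metricAt ((extChartAt I7 p).symm η).1 (prodFrame p η v).1 (prodFrame p η w).1 := rfl
  have hs : ((extChartAt I7 p).symm η).2 = (extChartAt 𝓘(ℝ, ℝ) p.2).symm η.2 := rfl
  rw [e1, e2, e3, Function.comp_apply, ← hs]
  have o5 : lapse dr G ((extChartAt I7 p).symm η).2 ^ 2
      * ((prodFrame p η v).2 * (prodFrame p η w).2)
      = (lapse dr G ((extChartAt I7 p).symm η).2 * (prodFrame p η v).2)
        * (lapse dr G ((extChartAt I7 p).symm η).2 * (prodFrame p η w).2) := by ring
  rw [o5, lapse_mul_prodFrame, lapse_mul_prodFrame]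
  ring

end ProductChart

/-! ### The covariant derivative of `φ` -/

section Torsion

set_option linter.unusedSectionVars false

variable {N : Type*} [TopologicalSpace N] [ChartedSpace (EuclideanSpace ℝ (Fin 6)) N]
  [IsManifold (𝓡 6) ∞ N] {L : Type*} [TopologicalSpace L] [ChartedSpace ℝ L]
  [IsManifold 𝓘(ℝ, ℝ) ∞ L]
  {σ : SU3Structure N} {dr : DForm 𝓘(ℝ, ℝ) L 1 ℝ} {F : L → ℂ} {G : L → ℝ} {U : Set L}
  {h θ : L → ℝ}

theorem SU3Structure.isSU3At (y : N) :
    IsSU3 (σ.metricAt y) (σ.JAt y) (σ.omegaAt y) (σ.OmegaAt y) (σ.vol y) := σ.isSU3 y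

theorem drCoeff_ne_zero (t : L) (h : dr t ≠ 0) : drCoeff dr t ≠ 0 := fun h0 => by
  have e : ∀ β : ℝ [⋀^Fin 1]→L[ℝ] ℝ, β (fun _ => 1) = 0 → β = 0 := fun β hβ =>
    ContinuousAlternatingMap.ext fun a => by rw [one_form_apply, hβ, mul_zero]; rfl
  exact h (e _ h0)

/-- The derivative `f'`, computed in the chart. -/
theorem derivR_eq (f : L → ℝ) (t : L) : derivR dr f t
    = deriv (f ∘ (extChartAt 𝓘(ℝ, ℝ) t).symm) (extChartAt 𝓘(ℝ, ℝ) t t) / drCoeff dr t := by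
  rw [derivR, drCoeff, mvfderiv_eq_fderiv, fderiv_apply_one_eq_deriv]

theorem hasDerivAt_chart {f : L → ℝ} {t : L} (hU : IsOpen U) (ht : t ∈ U)
    (hf : ContMDiffOn 𝓘(ℝ, ℝ) 𝓘(ℝ, ℝ) ∞ f U) :
    HasDerivAt (f ∘ (extChartAt 𝓘(ℝ, ℝ) t).symm)
      (deriv (f ∘ (extChartAt 𝓘(ℝ, ℝ) t).symm) (extChartAt 𝓘(ℝ, ℝ) t t))
      (extChartAt 𝓘(ℝ, ℝ) t t) := by
  have h1 := ((hf.contMDiffAt (hU.mem_nhds ht)).mdifferentiableAt (by simp))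
  exact (MDifferentiableAt.differentiableAt_comp_symm h1).hasDerivAt

theorem hasDerivAt_lapseChart (hdr : dr.IsSmooth) (hG : ContMDiff 𝓘(ℝ, ℝ) 𝓘(ℝ, ℝ) ∞ G) (t : L) :
    HasDerivAt (lapseChart dr G t) (deriv (lapseChart dr G t) (extChartAt 𝓘(ℝ, ℝ) t t))
      (extChartAt 𝓘(ℝ, ℝ) t t) := by
  have h1 := MDifferentiableAt.differentiableAt_comp_symm
    (hG.contMDiffAt (x := t) |>.mdifferentiableAt (by simp))
  have h2 : DifferentiableAt ℝ (fun s => dr.inChart t s (fun _ => (1 : ℝ)))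
      (extChartAt 𝓘(ℝ, ℝ) t t) :=
    (ContinuousAlternatingMap.apply ℝ ℝ ℝ (fun _ => (1 : ℝ))).differentiableAt.comp
      (f := dr.inChart t) _
      (hdr.differentiableAt t)
  exact (h1.mul h2).hasDerivAt

/-- The covariant derivative of `φ`: the full torsion tensor is `diag(θ'/G, -λ sin θ/h δ₆) - m J₆`
with `m = h⁻¹(h'/G + λ cos θ)`. -/
theorem covDerivForm_phi {lam : ℝ} (hσ : σ.IsOfType lam) (hdr : dr.IsSmooth)
    (hG : ContMDiff 𝓘(ℝ, ℝ) 𝓘(ℝ, ℝ) ∞ G) (hU : IsOpen U)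
    (hh : ContMDiffOn 𝓘(ℝ, ℝ) 𝓘(ℝ, ℝ) ∞ h U) (hθ : ContMDiffOn 𝓘(ℝ, ℝ) 𝓘(ℝ, ℝ) ∞ θ U)
    (hF : ∀ t ∈ U, F t = (h t : ℂ) * Complex.exp (Complex.I * ((θ t : ℂ) / 3)))
    (cov : CovariantDerivative I7 (EuclideanSpace ℝ (Fin 6) × ℝ) (TangentSpace I7 : N × L → Type _))
    (hcov : IsLeviCivita (g7 σ dr F G) cov) (p : N × L) (hp : p.2 ∈ U) (hh0 : h p.2 ≠ 0)
    (hr0 : lapse dr G p.2 ≠ 0) (u : EuclideanSpace ℝ (Fin 6) × ℝ)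
    (B : Fin 3 → ∀ q : N × L, TangentSpace I7 q) (hB : ∀ i, VFDiffAt I7 (B i) p) :
    covDerivForm cov (phi σ dr F G) p u B
      = warpedPsi (σ.omegaAt p.1) (σ.OmegaAt p.1) (h p.2) (θ p.2) (lapse dr G p.2)
        (warpedTorsion (σ.JAt p.1) (derivR dr θ p.2 / G p.2) (-(lam * Real.sin (θ p.2) / h p.2))
          ((h p.2)⁻¹ * (derivR dr h p.2 / G p.2 + lam * Real.cos (θ p.2))) u)
        (B 0 p) (B 1 p) (B 2 p) := by
  -- the values of the fields at `p` are named, as elements of the model space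
  suffices H : ∀ b : Fin 3 → EuclideanSpace ℝ (Fin 6) × ℝ, (∀ i, B i p = b i) →
      covDerivForm cov (phi σ dr F G) p u B
        = warpedPsi (σ.omegaAt p.1) (σ.OmegaAt p.1) (h p.2) (θ p.2) (lapse dr G p.2)
          (warpedTorsion (σ.JAt p.1) (derivR dr θ p.2 / G p.2) (-(lam * Real.sin (θ p.2) / h p.2))
            ((h p.2)⁻¹ * (derivR dr h p.2 / G p.2 + lam * Real.cos (θ p.2))) u)
          (b 0) (b 1) (b 2) from
    H (fun i => B i p) fun _ => rfl
  intro b hb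
  have dh := hasDerivAt_chart hU hp hh
  have dθ := hasDerivAt_chart hU hp hθ
  have dl := hasDerivAt_lapseChart hdr hG p.2
  have eh : ∀ f : L → ℝ,
      (f ∘ (extChartAt 𝓘(ℝ, ℝ) p.2).symm) (extChartAt 𝓘(ℝ, ℝ) p.2 p.2) = f p.2 := fun f => by
    rw [Function.comp_apply, extChartAt_to_inv]
  have el := lapseChart_self dr G p.2
  rw [derivR_eq, derivR_eq, div_div, div_div, mul_comm (drCoeff dr p.2)]
  have hl : G p.2 * drCoeff dr p.2 = lapse dr G p.2 := rfl
  rw [hl]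
  generalize deriv (h ∘ (extChartAt 𝓘(ℝ, ℝ) p.2).symm) (extChartAt 𝓘(ℝ, ℝ) p.2 p.2) = h' at *
  generalize deriv (θ ∘ (extChartAt 𝓘(ℝ, ℝ) p.2).symm) (extChartAt 𝓘(ℝ, ℝ) p.2 p.2) = θ' at *
  generalize deriv (lapseChart dr G p.2) (extChartAt 𝓘(ℝ, ℝ) p.2 p.2) = r' at *
  -- the Christoffel tensor of `g₇`, and its restriction to `N`
  obtain ⟨Γ, hΓ⟩ := exists_christoffel cov p
  have Γsymm := christoffel_symm hΓ (hcov.torsion_free p)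
  have Γmet := christoffel_metric hΓ hcov
  have hc : extChartAt I7 p p = (extChartAt (𝓡 6) p.1 p.1, extChartAt 𝓘(ℝ, ℝ) p.2 p.2) := rfl
  have g0 : ∀ v w : EuclideanSpace ℝ (Fin 6) × ℝ,
      bilinInChart (g7 σ dr F G) p (extChartAt I7 p p) v w
      = lapse dr G p.2 ^ 2 * (v.2 * w.2) + h p.2 ^ 2 * σ.metricAt p.1 v.1 w.1 := fun v w =>
    (bilinInChart_self (g7 σ dr F G) p v w).trans (g7_apply σ dr F G p _ _ (hF _ hp) v w)
  have dg : ∀ u v w : EuclideanSpace ℝ (Fin 6) × ℝ,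
      fderiv ℝ (fun η => bilinInChart (g7 σ dr F G) p η v w) (extChartAt I7 p p) u
        = 2 * lapse dr G p.2 * r' * u.2 * (v.2 * w.2)
          + 2 * h p.2 * h' * u.2 * σ.metricAt p.1 v.1 w.1
          + h p.2 ^ 2 * fderiv ℝ (σ.metricChart p.1) (extChartAt (𝓡 6) p.1 p.1) u.1 v.1 w.1 := by
    intro u v w
    rw [(g7_inChart_eventuallyEq σ dr G hU hF p hp v w).fderiv_eq]
    refine (fderiv_warpedMetric (c := extChartAt I7 p p) (σ.differentiableAt_metricChart p.1)
      dh dl u v w).trans ?_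
    have em : σ.metricChart p.1 (extChartAt I7 p p).1 = σ.metricAt p.1 := σ.metricChart_self p.1
    rw [em]
    simp only [hc, eh, el]
  have key := warped_christoffel Γ (fun u v => Γsymm v u) (σ.metricAt p.1) (σ.isSU3 p.1).symm
    (σ.isSU3 p.1).pos (h p.2) (lapse dr G p.2) h' r' hh0 hr0
    (fun u v w => fderiv ℝ (σ.metricChart p.1) (extChartAt (𝓡 6) p.1 p.1) u v w)
    (fun v w => by simp) (fun u v => by simp) (fun u v w => by
      rw [← dg, Γmet, g0, g0])
  obtain ⟨γsymm, γmet, hΓ1, hΓ2⟩ := key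
  -- the derivatives of `ω` and `Ω` in terms of the Christoffel tensor of `g₆`
  obtain ⟨dom, dOm⟩ := hσ.fderiv_inChart σ p.1 (baseChristoffel Γ) γsymm γmet
  have ephi := phi_inChart_eventuallyEq σ dr G hU hF p hp
  have hd : DifferentiableAt ℝ ((phi σ dr F G).inChart p) (extChartAt I7 p p) :=
    (differentiableAt_warpedForm (c := extChartAt I7 p p) (σ.smooth_omega.differentiableAt p.1)
      (σ.smooth_Omega.differentiableAt p.1) dh.differentiableAt dθ.differentiableAt
      dl.differentiableAt).congr_of_eventuallyEq ephi
  have h1 := covDerivForm_eq cov hΓ (phi σ dr F G) hd u B hB ![b 0, b 1, b 2]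
    (fun i => (hb i).trans (by fin_cases i <;> rfl))
  have h2 := fderiv_warpedForm (c := extChartAt I7 p p) (σ.smooth_omega.differentiableAt p.1)
      (σ.smooth_Omega.differentiableAt p.1) dh dθ dl u (b 0) (b 1) (b 2)
  have h3 := warpedPhi_covariant (σ.isSU3At p.1) lam (h p.2) (θ p.2) (lapse dr G p.2) h' θ' r' hh0
    hr0 (baseChristoffel Γ) (fun v u => Γ v u) hΓ1 hΓ2
    (fun u v w => fderiv ℝ (σ.omega.inChart p.1) (extChartAt (𝓡 6) p.1 p.1) u ![v, w])
    (fun u v w x => fderiv ℝ (σ.Omega.inChart p.1) (extChartAt (𝓡 6) p.1 p.1) u ![v, w, x])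
    dom dOm u (b 0) (b 1) (b 2)
  have up : ∀ a b d y : EuclideanSpace ℝ (Fin 6) × ℝ, Function.update ![a, b, d] 0 y = ![y, b, d]
      ∧ Function.update ![a, b, d] 1 y = ![a, y, d] ∧ Function.update ![a, b, d] 2 y = ![a, b, y] :=
    fun a b d y => ⟨by ext1 i; fin_cases i <;> rfl, by ext1 i; fin_cases i <;> rfl,
      by ext1 i; fin_cases i <;> rfl⟩
  have e0 : ∀ a b d : EuclideanSpace ℝ (Fin 6) × ℝ,
      (phi σ dr F G).inChart p (extChartAt I7 p p) ![a, b, d]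
        = warpedPhi (σ.omegaAt p.1) (σ.OmegaAt p.1) (h p.2) (θ p.2) (lapse dr G p.2) a b d :=
    fun a b d => (DForm.inChart_self (phi σ dr F G) p ![a, b, d]).trans
      (phi_apply σ dr F G p _ _ (hF _ hp) a b d)
  rw [h1, ephi.fderiv_eq, Fin.sum_univ_three, (up _ _ _ _).1, (up _ _ _ _).2.1, (up _ _ _ _).2.2]
  simp only [Matrix.cons_val]
  rw [e0, e0, e0, ← h3, h2]
  have ho : σ.omega.inChart p.1 (extChartAt (𝓡 6) p.1 p.1) = σ.omegaAt p.1 :=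
    DForm.inChart_center σ.omega p.1
  have hO : σ.Omega.inChart p.1 (extChartAt (𝓡 6) p.1 p.1) = σ.OmegaAt p.1 :=
    DForm.inChart_center σ.Omega p.1
  simp only [hc, eh, el, ho, hO]

end Torsion

/-! ### The coframe of a warped product -/

section WarpedFrame

variable {W : Type*} [NormedAddCommGroup W] [NormedSpace ℝ W]
  {g : W →L[ℝ] W →L[ℝ] ℝ} {J : W →L[ℝ] W} {om : W [⋀^Fin 2]→L[ℝ] ℝ}
  {Ω : W [⋀^Fin 3]→L[ℝ] ℂ} {vol : W [⋀^Fin 6]→L[ℝ] ℝ} {z : Fin 3 → W →L[ℝ] ℂ} {E : Fin 3 → W}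

open Complex

/-- The coframe `h Re z₀, h Im z₀, …, h Re z₂, h Im z₂, r ds` of `W × ℝ`. -/
def warpedCoords (z : Fin 3 → W →L[ℝ] ℂ) (h r : ℝ) : Fin 7 → W × ℝ →L[ℝ] ℝ :=
  ![h • (reCLM ∘L z 0 ∘L ContinuousLinearMap.fst ℝ W ℝ),
    h • (imCLM ∘L z 0 ∘L ContinuousLinearMap.fst ℝ W ℝ),
    h • (reCLM ∘L z 1 ∘L ContinuousLinearMap.fst ℝ W ℝ),
    h • (imCLM ∘L z 1 ∘L ContinuousLinearMap.fst ℝ W ℝ),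
    h • (reCLM ∘L z 2 ∘L ContinuousLinearMap.fst ℝ W ℝ),
    h • (imCLM ∘L z 2 ∘L ContinuousLinearMap.fst ℝ W ℝ),
    r • ContinuousLinearMap.snd ℝ W ℝ]

/-- The frame of `W × ℝ` dual to `warpedCoords`. -/
def warpedFrame (J : W →L[ℝ] W) (E : Fin 3 → W) (h r : ℝ) : Fin 7 → W × ℝ :=
  ![(h⁻¹ • E 0, 0), (h⁻¹ • J (E 0), 0), (h⁻¹ • E 1, 0), (h⁻¹ • J (E 1), 0), (h⁻¹ • E 2, 0),
    (h⁻¹ • J (E 2), 0), (0, r⁻¹)]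

theorem warpedCoords_warpedFrame (hz : IsUnitaryFrame g J z E) {h r : ℝ} (hh : h ≠ 0) (hr : r ≠ 0)
    (i j : Fin 7) : warpedCoords z h r i (warpedFrame J E h r j) = if i = j then 1 else 0 := by
  fin_cases i <;> fin_cases j <;>
    simp [warpedCoords, warpedFrame, hz.dual, hz.map_J, hh, hr]

theorem warpedCoords_expand (hz : IsUnitaryFrame g J z E) {h r : ℝ} (hh : h ≠ 0) (hr : r ≠ 0)
    (u : W × ℝ) : u = ∑ i, warpedCoords z h r i u • warpedFrame J E h r i := by
  have h1 := hz.expand u.1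
  simp only [Fin.sum_univ_three] at h1
  apply Prod.ext
  · conv_lhs => rw [h1]
    simp [Fin.sum_univ_succ, warpedCoords, warpedFrame, smul_smul]
    field_simp
    module
  · simp [Fin.sum_univ_succ, warpedCoords, warpedFrame]
    field_simp

theorem warpedMetric_eq (hz : IsUnitaryFrame g J z E) (h r : ℝ) (u v : W × ℝ) :
    r ^ 2 * (u.2 * v.2) + h ^ 2 * g u.1 v.1
      = ∑ i, warpedCoords z h r i u * warpedCoords z h r i v := by
  rw [hz.metric]
  simp [Fin.sum_univ_succ, warpedCoords]
  ring

theorem warpedPhi_eq (hs : IsSU3 g J om Ω vol) (hz : IsUnitaryFrame g J z E) {θ : ℝ}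
    (hΩ : ∀ u v w, ((Real.cos θ : ℝ) + (Real.sin θ : ℝ) * I) * Ω ![u, v, w]
      = det3 (z 0) (z 1) (z 2) u v w) (h r : ℝ) (u v w : W × ℝ) :
    warpedPhi om Ω h θ r u v w = stdPhi (warpedCoords z h r) u v w := by
  have h1 := congrArg Complex.re (hΩ u.1 v.1 w.1)
  simp only [mul_re, mul_im, add_re, add_im, ofReal_re, ofReal_im, I_re, I_im, det3, sub_re,
    sub_im] at h1
  simp only [warpedPhi, hs.omega_eq, hz.metric, hz.map_J, Fin.sum_univ_three, stdPhi, det3]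
  simp [warpedCoords]
  linear_combination h ^ 3 * h1

theorem warpedIm_eq {θ : ℝ}
    (hΩ : ∀ u v w, ((Real.cos θ : ℝ) + (Real.sin θ : ℝ) * I) * Ω ![u, v, w]
      = det3 (z 0) (z 1) (z 2) u v w) (h : ℝ) (u v w : W) :
    warpedIm Ω h θ u v w = h ^ 3 * (det3 (z 0) (z 1) (z 2) u v w).im := by
  rw [← hΩ, warpedIm]
  simp only [mul_im, add_re, add_im, mul_re, ofReal_re, ofReal_im, I_re, I_im]
  ring

theorem warpedPsi_eq (hs : IsSU3 g J om Ω vol) (hz : IsUnitaryFrame g J z E) {θ : ℝ}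
    (hΩ : ∀ u v w, ((Real.cos θ : ℝ) + (Real.sin θ : ℝ) * I) * Ω ![u, v, w]
      = det3 (z 0) (z 1) (z 2) u v w) (h r : ℝ) (u v w x : W × ℝ) :
    warpedPsi om Ω h θ r u v w x = stdPsi (warpedCoords z h r) u v w x := by
  simp only [warpedPsi, warpedIm_eq hΩ, hs.omega_eq, hz.metric, hz.map_J, Fin.sum_univ_three,
    stdPsi, det4, det3]
  simp [warpedCoords]
  ring

theorem vol_warpedFrame (hs : IsSU3 g J om Ω vol) (hz : IsUnitaryFrame g J z E) (h r : ℝ) :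
    vol (fun i => (warpedFrame J E h r (Fin.castAdd 1 i)).1) = (h⁻¹) ^ 6 := by
  have h2 : (fun i => (warpedFrame J E h r (Fin.castAdd 1 i)).1)
      = fun i => (h⁻¹ : ℝ) • realFrame J E i := by
    funext i; fin_cases i <;> rfl
  have h3 := vol.toAlternatingMap.map_smul_univ (fun _ : Fin 6 => h⁻¹) (realFrame J E)
  rw [h2]
  refine h3.trans ?_
  have h4 : vol.toAlternatingMap (realFrame J E) = 1 := hz.vol_eq_one hs
  rw [h4]
  simp

end WarpedFrame

/-- The product of a `6`-form with a multiple of the last form of the coframe `x`, on the dual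
frame `e`. -/
theorem wedge_six_one_frame {V : Type*} [AddCommGroup V] [Module ℝ V] [TopologicalSpace V]
    {A : Type*} [NormedCommRing A] [NormedAlgebra ℝ A]
    (e : Fin 7 → V) (x : Fin 7 → V →L[ℝ] A) (hx : ∀ i j, x i (e j) = if i = j then 1 else 0)
    (α : V [⋀^Fin 6]→L[ℝ] A) (β : V [⋀^Fin 1]→L[ℝ] A) (c : A) (hβ : ∀ v, β v = c * x 6 (v 0)) :
    wedge α β e = c * α (fun k => e (Fin.castAdd 1 k)) := by
  have h1 := wedge_apply_frame (p := 6) (q := 1) e x hx α β (fun _ : Fin 1 => 1) (fun _ => c)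
    fun v => by
      simp only [hβ, Finset.univ_unique, Finset.sum_singleton, Matrix.det_unique, Matrix.of_apply]
      rfl
  refine h1.trans ?_
  simp

/-! ### Adapted frames of `N × L` -/

section Assembly

set_option linter.unusedSectionVars false

variable {N : Type*} [TopologicalSpace N] [ChartedSpace (EuclideanSpace ℝ (Fin 6)) N]
  [IsManifold (𝓡 6) ∞ N] {L : Type*} [TopologicalSpace L] [ChartedSpace ℝ L]
  [IsManifold 𝓘(ℝ, ℝ) ∞ L]
  {σ : SU3Structure N} {dr : DForm 𝓘(ℝ, ℝ) L 1 ℝ} {F : L → ℂ} {G : L → ℝ}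

/-- There is a unitary coframe in which `e^{iθ} Ω` is the standard complex volume form. -/
theorem SU3Structure.exists_unitaryFrame (y : N) (θ : ℝ) : ∃ z E,
    IsUnitaryFrame (σ.metricAt y) (σ.JAt y) z E ∧ ∀ u v w,
      ((Real.cos θ : ℝ) + (Real.sin θ : ℝ) * Complex.I) * σ.OmegaAt y ![u, v, w]
        = det3 (z 0) (z 1) (z 2) u v w := by
  refine (σ.isSU3At y).exists_unitaryFrame (by simp) _ ?_
  have := Real.sin_sq_add_cos_sq θ
  rw [mul_comm, Complex.mul_conj, Complex.ofReal_eq_one, Complex.normSq_apply]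
  simp only [Complex.add_re, Complex.add_im, Complex.mul_re, Complex.mul_im, Complex.ofReal_re,
    Complex.ofReal_im, Complex.I_re, Complex.I_im]
  linarith

theorem vol7_frame (p : N × L) (e : Fin 7 → TangentSpace I7 p)
    (x : Fin 7 → TangentSpace I7 p →L[ℝ] ℝ) (hx : ∀ i j, x i (e j) = if i = j then 1 else 0) (c : ℝ)
    (hc : ∀ v, drM dr p v = c * x 6 (v 0)) :
    vol7 σ dr F G p e
      = G p.2 * ‖F p.2‖ ^ 6 * (c * volM σ p (fun k => e (Fin.castAdd 1 k))) := by
  have h0 : vol7 σ dr F G p e = G p.2 * ‖F p.2‖ ^ 6 * wedge (volM σ p) (drM dr p) e := rfl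
  have h1 := wedge_six_one_frame e x hx (volM σ p) (drM dr p) c hc
  rw [h0, h1]

/-- The data of a frame of `N × L` at `p` adapted to the `G₂`-structure: a polar decomposition of
`F` and a unitary frame of `N` in which `e^{iθ} Ω` is the standard complex volume form. -/
structure IsAdaptedFrame (σ : SU3Structure N) (dr : DForm 𝓘(ℝ, ℝ) L 1 ℝ) (F : L → ℂ) (G : L → ℝ)
    (p : N × L) (h θ : ℝ) (z : Fin 3 → EuclideanSpace ℝ (Fin 6) →L[ℝ] ℂ)
    (E : Fin 3 → EuclideanSpace ℝ (Fin 6)) : Prop where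
  polar : F p.2 = (h : ℂ) * Complex.exp (Complex.I * ((θ : ℂ) / 3))
  h_ne : h ≠ 0
  lapse_ne : lapse dr G p.2 ≠ 0
  unitary : IsUnitaryFrame (σ.metricAt p.1) (σ.JAt p.1) z E
  Omega_eq : ∀ u v w, ((Real.cos θ : ℝ) + (Real.sin θ : ℝ) * Complex.I) * σ.OmegaAt p.1 ![u, v, w]
    = det3 (z 0) (z 1) (z 2) u v w

namespace IsAdaptedFrame

variable {p : N × L} {h θ : ℝ} {z : Fin 3 → EuclideanSpace ℝ (Fin 6) →L[ℝ] ℂ}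
  {E : Fin 3 → EuclideanSpace ℝ (Fin 6)}

theorem coords_frame (H : IsAdaptedFrame σ dr F G p h θ z E) (i j : Fin 7) :
    warpedCoords z h (lapse dr G p.2) i (warpedFrame (σ.JAt p.1) E h (lapse dr G p.2) j)
      = if i = j then 1 else 0 :=
  warpedCoords_warpedFrame H.unitary H.h_ne H.lapse_ne i j

theorem expand (H : IsAdaptedFrame σ dr F G p h θ z E) (u : EuclideanSpace ℝ (Fin 6) × ℝ) :
    u = ∑ i, warpedCoords z h (lapse dr G p.2) i u
      • warpedFrame (σ.JAt p.1) E h (lapse dr G p.2) i :=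
  warpedCoords_expand H.unitary H.h_ne H.lapse_ne u

theorem g7_eq (H : IsAdaptedFrame σ dr F G p h θ z E) (u v : EuclideanSpace ℝ (Fin 6) × ℝ) :
    g7 σ dr F G p u v
      = ∑ i, warpedCoords z h (lapse dr G p.2) i u * warpedCoords z h (lapse dr G p.2) i v :=
  (g7_apply σ dr F G p h θ H.polar u v).trans (warpedMetric_eq H.unitary h _ u v)

theorem phi_eq (H : IsAdaptedFrame σ dr F G p h θ z E) (u v w : EuclideanSpace ℝ (Fin 6) × ℝ) :
    phi σ dr F G p ![u, v, w] = stdPhi (warpedCoords z h (lapse dr G p.2)) u v w :=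
  (phi_apply σ dr F G p h θ H.polar u v w).trans
    (warpedPhi_eq (σ.isSU3At p.1) H.unitary H.Omega_eq h _ u v w)

theorem psi_eq (H : IsAdaptedFrame σ dr F G p h θ z E) (u v w x : EuclideanSpace ℝ (Fin 6) × ℝ) :
    psi σ dr F G p ![u, v, w, x] = stdPsi (warpedCoords z h (lapse dr G p.2)) u v w x :=
  (psi_apply σ dr F G p h θ H.polar u v w x).trans
    (warpedPsi_eq (σ.isSU3At p.1) H.unitary H.Omega_eq h _ u v w x)

theorem vol7_eq (H : IsAdaptedFrame σ dr F G p h θ z E) :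
    vol7 σ dr F G p (warpedFrame (σ.JAt p.1) E h (lapse dr G p.2)) = 1 := by
  have hr := H.lapse_ne
  have hh := H.h_ne
  have h1 := vol7_frame (σ := σ) (F := F) (G := G) p
    (warpedFrame (σ.JAt p.1) E h (lapse dr G p.2)) (warpedCoords z h (lapse dr G p.2))
    H.coords_frame (drCoeff dr p.2 / lapse dr G p.2) fun v => by
      have e : ∀ a : ℝ, a * drCoeff dr p.2
          = drCoeff dr p.2 / lapse dr G p.2 * (lapse dr G p.2 * a) := fun a => by field_simp
      exact (pullback_snd_apply dr p v).trans ((one_form_apply (dr p.2) _).trans (e _))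
  have h2 : volM σ p (fun k => warpedFrame (σ.JAt p.1) E h (lapse dr G p.2) (Fin.castAdd 1 k))
      = (h⁻¹) ^ 6 :=
    (pullback_fst_apply σ.vol p _).trans (vol_warpedFrame (σ.isSU3At p.1) H.unitary h _)
  have h3 : ‖F p.2‖ ^ 6 = h ^ 6 := by
    calc ‖F p.2‖ ^ 6 = (‖F p.2‖ ^ 2) ^ 3 := by ring
      _ = h ^ 6 := by rw [polar_norm_sq H.polar]; ring
  have h4 : G p.2 * ‖F p.2‖ ^ 6 * (drCoeff dr p.2 / lapse dr G p.2 * (h⁻¹) ^ 6) = 1 := by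
    have h5 : lapse dr G p.2 = G p.2 * drCoeff dr p.2 := rfl
    rw [h3, inv_pow]
    field_simp
    exact h5.symm
  have h6 : G p.2 * ‖F p.2‖ ^ 6 * (drCoeff dr p.2 / lapse dr G p.2 * volM σ p (fun k =>
      warpedFrame (σ.JAt p.1) E h (lapse dr G p.2) (Fin.castAdd 1 k))) = 1 :=
    (congrArg (fun y : ℝ => G p.2 * ‖F p.2‖ ^ 6 * (drCoeff dr p.2 / lapse dr G p.2 * y)) h2).trans
      h4
  exact h1.trans h6

theorem isG2Form (H : IsAdaptedFrame σ dr F G p h θ z E) :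
    IsG2Form (phi σ dr F G p) (g7 σ dr F G p) (vol7 σ dr F G p) :=
  isG2Form_of_frame (V := EuclideanSpace ℝ (Fin 6) × ℝ) _ _ H.coords_frame H.expand
    (phi σ dr F G p) H.phi_eq (g7 σ dr F G p) H.g7_eq (vol7 σ dr F G p) H.vol7_eq

theorem isHodgeDual (H : IsAdaptedFrame σ dr F G p h θ z E) :
    IsHodgeDual (g7 σ dr F G p) (vol7 σ dr F G p) (phi σ dr F G p) (psi σ dr F G p) :=
  isHodgeDual_of_frame (V := EuclideanSpace ℝ (Fin 6) × ℝ) _ _ H.coords_frame H.expand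
    (phi σ dr F G p) H.phi_eq (psi σ dr F G p) H.psi_eq (g7 σ dr F G p) H.g7_eq
    (vol7 σ dr F G p) H.vol7_eq

theorem eq_of_psi (H : IsAdaptedFrame σ dr F G p h θ z E) (a b : EuclideanSpace ℝ (Fin 6) × ℝ)
    (hab : ∀ u v w : EuclideanSpace ℝ (Fin 6) × ℝ,
      psi σ dr F G p ![a, u, v, w] = psi σ dr F G p ![b, u, v, w]) : a = b := by
  refine sub_eq_zero.1 (eq_zero_of_stdPsi _ _ H.coords_frame H.expand (a - b) fun u v w => ?_)
  have h1 : stdPsi (warpedCoords z h (lapse dr G p.2)) (a - b) u v w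
      = stdPsi (warpedCoords z h (lapse dr G p.2)) a u v w
        - stdPsi (warpedCoords z h (lapse dr G p.2)) b u v w := by
    simp only [stdPsi, det4, det3, map_sub]
    ring
  rw [h1, ← H.psi_eq, ← H.psi_eq, hab, sub_self]

end IsAdaptedFrame

theorem torsion_apply (p : N × L) (a b m : ℝ) (u : EuclideanSpace ℝ (Fin 6) × ℝ) :
    (diagEnd p a b - m • J6 σ p) u = warpedTorsion (σ.JAt p.1) a b m u := by
  have e : (diagEnd p a b - m • J6 σ p) u = diagEnd p a b u - m • J6 σ p u := rfl
  have e2 : ∀ x y : EuclideanSpace ℝ (Fin 6),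
      ((x, a * u.2) : EuclideanSpace ℝ (Fin 6) × ℝ) - m • (y, (0 : ℝ)) = (x - m • y, a * u.2) :=
    fun x y => by ext <;> simp
  refine e.trans (Eq.trans ?_ (e2 (b • u.1) (σ.JAt p.1 u.1)))
  exact congrArg₂ (fun x y : EuclideanSpace ℝ (Fin 6) × ℝ => x - m • y) (diagEnd_apply p a b u)
    (J6_apply σ p u)

/-- The decomposition of `diag(a, b δ₆) - m J₆`. The symmetric part splits into its trace and the
traceless rest; as `e₆ ⌟ φ = h² ω = g₇(J₆ ·, ·)` for the unit vector `e₆` dual to `G dr`, the skew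
part is `τ₇ ⌟ φ` with `τ₇ = -m G dr`. -/
theorem IsAdaptedFrame.isTorsionDecomposition {p : N × L} {h θ : ℝ}
    {z : Fin 3 → EuclideanSpace ℝ (Fin 6) →L[ℝ] ℂ} {E : Fin 3 → EuclideanSpace ℝ (Fin 6)}
    (H : IsAdaptedFrame σ dr F G p h θ z E) (a b m : ℝ) :
    IsTorsionDecomposition (g7 σ dr F G p) (phi σ dr F G p) (diagEnd p a b - m • J6 σ p)
      (1 / 7 * (a + 6 * b)) ((-(m * G p.2)) • drM dr p) 0
      ((1 / 7 * (a - b)) • (g7 σ dr F G p ∘L diagEnd p 6 (-1))) := by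
  have x6 : ∀ u : EuclideanSpace ℝ (Fin 6) × ℝ,
      warpedCoords z h (lapse dr G p.2) 6 u = lapse dr G p.2 * u.2 := fun u => rfl
  have hr := H.lapse_ne
  refine isTorsionDecomposition_of_frame (V := EuclideanSpace ℝ (Fin 6) × ℝ) _ _ H.coords_frame
    (φ := phi σ dr F G p) (g := g7 σ dr F G p) H.g7_eq (m := m) (fun u v => ?_) (fun v => ?_)
    (fun u v => ?_)
  · have e1 : g7 σ dr F G p ((diagEnd p a b - m • J6 σ p) u) v
        = g7 σ dr F G p (warpedTorsion (σ.JAt p.1) a b m u) v :=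
      congrArg (fun y : EuclideanSpace ℝ (Fin 6) × ℝ => g7 σ dr F G p y v)
        (torsion_apply p a b m u)
    have e2 := phi_apply σ dr F G p h θ H.polar
      (warpedFrame (σ.JAt p.1) E h (lapse dr G p.2) 6) u v
    have e3 := g7_apply σ dr F G p h θ H.polar (warpedTorsion (σ.JAt p.1) a b m u) v
    have e4 := g7_apply σ dr F G p h θ H.polar u v
    have z2 : ∀ w, σ.omegaAt p.1 ![0, w] = 0 := fun w => (σ.omegaAt p.1).map_coord_zero 0 rfl
    have z3 : ∀ v w, σ.OmegaAt p.1 ![0, v, w] = 0 :=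
      fun v w => (σ.OmegaAt p.1).map_coord_zero 0 rfl
    have e5 : warpedFrame (σ.JAt p.1) E h (lapse dr G p.2) 6
      = ((0 : EuclideanSpace ℝ (Fin 6)), (lapse dr G p.2)⁻¹) := rfl
    rw [e5] at e2
    simp only [warpedPhi, z2, z3, (σ.isSU3At p.1).omega_eq] at e2
    simp only [warpedTorsion, map_sub, map_smul, sub_apply, smul_apply, smul_eq_mul] at e3
    rw [← e5] at e2
    -- `r = G dr/ds`, and `P`, `Q` stand for `g₆(u, v)` and `ω(u, v)`
    have key : ∀ r A B C X Y P Q : ℝ, r ≠ 0 →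
        A = r ^ 2 * (a * u.2 * v.2) + h ^ 2 * (b * P - m * Q) →
        B = r ^ 2 * (u.2 * v.2) + h ^ 2 * P →
        C = h ^ 3 * (Real.cos θ * Complex.re 0 - Real.sin θ * Complex.im 0)
          + r * h ^ 2 * (r⁻¹ * Q - u.2 * 0 + v.2 * 0) → X = r * u.2 → Y = r * v.2 →
        A = b * B + (a - b) * (X * Y) - m * C := by
      rintro r A B C X Y P Q hr rfl rfl rfl rfl rfl
      simp
      field_simp
      ring
    exact key _ _ _ _ _ _ _ _ hr (e1.trans e3) e4 e2 (x6 u) (x6 v)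
  · have e1 : ((-(m * G p.2)) • drM dr p) ![v] = -(m * G p.2) * drM dr p ![v] := rfl
    have e2 : lapse dr G p.2 = G p.2 * drCoeff dr p.2 := rfl
    have e3 := drM_apply dr p v
    rw [x6, e2]
    exact e1.trans ((congrArg (-(m * G p.2) * ·) e3).trans (by ring))
  · have e1 : ((1 / 7 * (a - b)) • (g7 σ dr F G p ∘L diagEnd p 6 (-1))) u v
        = (1 / 7 * (a - b)) * g7 σ dr F G p (diagEnd p 6 (-1) u) v := rfl
    have e2 : g7 σ dr F G p (diagEnd p 6 (-1) u) v
        = g7 σ dr F G p (((-1 : ℝ) • u.1, 6 * u.2) : EuclideanSpace ℝ (Fin 6) × ℝ) v :=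
      congrArg (fun y : EuclideanSpace ℝ (Fin 6) × ℝ => g7 σ dr F G p y v)
        (diagEnd_apply p 6 (-1) u)
    have e3 := g7_apply σ dr F G p h θ H.polar
      (((-1 : ℝ) • u.1, 6 * u.2) : EuclideanSpace ℝ (Fin 6) × ℝ) v
    have e4 := g7_apply σ dr F G p h θ H.polar u v
    simp only [map_smul, smul_apply, smul_eq_mul] at e3
    have key : ∀ r A B X Y P : ℝ,
        A = r ^ 2 * (6 * u.2 * v.2) + h ^ 2 * (-1 * P) → B = r ^ 2 * (u.2 * v.2) + h ^ 2 * P →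
        X = r * u.2 → Y = r * v.2 →
        (1 / 7 * (a - b)) * A = 1 / 7 * (a - b) * (7 * (X * Y) - B) := by
      rintro r A B X Y P rfl rfl rfl rfl
      ring
    exact e1.trans (key _ _ _ _ _ _ (e2.trans e3) e4 (x6 u) (x6 v))

theorem IsAdaptedFrame.torsionDecomposition_unique {p : N × L} {h θ : ℝ}
    {z : Fin 3 → EuclideanSpace ℝ (Fin 6) →L[ℝ] ℂ} {E : Fin 3 → EuclideanSpace ℝ (Fin 6)}
    (H : IsAdaptedFrame σ dr F G p h θ z E) {S : TangentSpace I7 p →L[ℝ] TangentSpace I7 p}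
    {τ₁ τ₁' : ℝ} {τ₇ τ₇' : TangentSpace I7 p [⋀^Fin 1]→L[ℝ] ℝ}
    {τ₁₄ τ₁₄' : TangentSpace I7 p [⋀^Fin 2]→L[ℝ] ℝ}
    {τ₂₇ τ₂₇' : TangentSpace I7 p →L[ℝ] TangentSpace I7 p →L[ℝ] ℝ}
    (h1 : IsTorsionDecomposition (g7 σ dr F G p) (phi σ dr F G p) S τ₁ τ₇ τ₁₄ τ₂₇)
    (h2 : IsTorsionDecomposition (g7 σ dr F G p) (phi σ dr F G p) S τ₁' τ₇' τ₁₄' τ₂₇') :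
    τ₁ = τ₁' ∧ τ₇ = τ₇' ∧ τ₁₄ = τ₁₄' ∧ τ₂₇ = τ₂₇' :=
  IsTorsionDecomposition.unique (V := EuclideanSpace ℝ (Fin 6) × ℝ) _ _ H.coords_frame H.expand
    (φ := phi σ dr F G p) H.phi_eq (g := g7 σ dr F G p) H.g7_eq h1 h2

/-- The full torsion tensor is unique, as `ψ` is nondegenerate. -/
theorem IsAdaptedFrame.isFullTorsion_iff {p : N × L} {h θ : ℝ}
    {z : Fin 3 → EuclideanSpace ℝ (Fin 6) →L[ℝ] ℂ} {E : Fin 3 → EuclideanSpace ℝ (Fin 6)}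
    (H : IsAdaptedFrame σ dr F G p h θ z E)
    (cov : CovariantDerivative I7 (EuclideanSpace ℝ (Fin 6) × ℝ) (TangentSpace I7 : N × L → Type _))
    {a b m : ℝ}
    (hcov : ∀ (u : EuclideanSpace ℝ (Fin 6) × ℝ) (B : Fin 3 → ∀ q : N × L, TangentSpace I7 q),
      (∀ i, VFDiffAt I7 (B i) p) → covDerivForm cov (phi σ dr F G) p u B
        = warpedPsi (σ.omegaAt p.1) (σ.OmegaAt p.1) h θ (lapse dr G p.2)
          (warpedTorsion (σ.JAt p.1) a b m u) (B 0 p) (B 1 p) (B 2 p))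
    (S : TangentSpace I7 p →L[ℝ] TangentSpace I7 p) :
    IsFullTorsion cov (phi σ dr F G) (psi σ dr F G) p S ↔ S = diagEnd p a b - m • J6 σ p := by
  have hpsi : ∀ (y u v w : EuclideanSpace ℝ (Fin 6) × ℝ), psi σ dr F G p ![y, u, v, w]
      = warpedPsi (σ.omegaAt p.1) (σ.OmegaAt p.1) h θ (lapse dr G p.2) y u v w := fun y u v w =>
    psi_apply σ dr F G p h θ H.polar y u v w
  constructor
  · intro hS
    refine ContinuousLinearMap.ext fun u => ?_
    refine Eq.trans ?_ (torsion_apply p a b m u).symm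
    refine H.eq_of_psi _ _ fun v w x => ?_
    -- the defining identity is tested on coordinate fields with arbitrary values at `p`
    let B : Fin 3 → ∀ q : N × L, TangentSpace I7 q := fun i => coordField I7 p (![v, w, x] i)
    have hB : ∀ i, VFDiffAt I7 (B i) p := fun i => vfDiffAt_coordField p _
    have h1 := (hS u B hB).symm.trans (hcov u B hB)
    have b0 : B 0 p = v := coordField_self p _
    have b1 : B 1 p = w := coordField_self p _
    have b2 : B 2 p = x := coordField_self p _
    rw [b0, b1, b2] at h1
    exact h1.trans (hpsi _ _ _ _).symm
  · rintro rfl u B hB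
    refine ((hcov u B hB).trans (hpsi _ _ _ _).symm).trans ?_
    exact congrArg (fun y : EuclideanSpace ℝ (Fin 6) × ℝ =>
      psi σ dr F G p ![y, B 0 p, B 1 p, B 2 p]) (torsion_apply p a b m u).symm

end Assembly

end G2Warped

end

theorem mainTheorem1
    -- the 6-manifold with its Calabi-Yau or nearly Kähler structure, and the 1-manifold
    {N : Type*} [TopologicalSpace N] [ChartedSpace (EuclideanSpace ℝ (Fin 6)) N]
    [IsManifold (𝓡 6) ∞ N]
    {L : Type*} [TopologicalSpace L] [ChartedSpace ℝ L] [IsManifold 𝓘(ℝ, ℝ) ∞ L]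
    (σ : G2Warped.SU3Structure N) (lam : ℝ) (hσ : σ.IsOfType lam)
    -- the coordinate 1-form on `L`
    (dr : G2Warped.DForm 𝓘(ℝ, ℝ) L 1 ℝ) (hdr : dr.IsSmooth) (hdr0 : ∀ t, dr t ≠ 0)
    -- the warping functions
    (F : L → ℂ) (hF : ContMDiff 𝓘(ℝ, ℝ) 𝓘(ℝ, ℂ) ∞ F) (hF0 : ∀ t, F t ≠ 0)
    (G : L → ℝ) (hG : ContMDiff 𝓘(ℝ, ℝ) 𝓘(ℝ, ℝ) ∞ G) (hG0 : ∀ t, 0 < G t)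
    -- `F = h exp(iθ/3)` with `h` and `θ` smooth on an open set of `L`
    (U : Set L) (hU : IsOpen U) (h θ : L → ℝ)
    (hh : ContMDiffOn 𝓘(ℝ, ℝ) 𝓘(ℝ, ℝ) ∞ h U) (hθ : ContMDiffOn 𝓘(ℝ, ℝ) 𝓘(ℝ, ℝ) ∞ θ U)
    (hFhθ : ∀ t ∈ U, F t = (h t : ℂ) * Complex.exp (Complex.I * ((θ t : ℂ) / 3)))
    -- the Levi-Civita connection of `g₇`
    (cov : CovariantDerivative G2Warped.I7 (EuclideanSpace ℝ (Fin 6) × ℝ)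
      (TangentSpace G2Warped.I7 : N × L → Type _))
    (hcov : G2Warped.IsLeviCivita (G2Warped.g7 σ dr F G) cov)
    (p : N × L) (hp : p.2 ∈ U) :
    -- `φ` is a `G₂`-structure with metric `g₇`, volume form `vol₇` and dual form `ψ`
    G2Warped.IsG2Form (G2Warped.phi σ dr F G p) (G2Warped.g7 σ dr F G p)
        (G2Warped.vol7 σ dr F G p) ∧
    G2Warped.IsHodgeDual (G2Warped.g7 σ dr F G p) (G2Warped.vol7 σ dr F G p)
        (G2Warped.phi σ dr F G p) (G2Warped.psi σ dr F G p) ∧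
    -- the full torsion tensor
    (∀ S : TangentSpace G2Warped.I7 p →L[ℝ] TangentSpace G2Warped.I7 p,
      G2Warped.IsFullTorsion cov (G2Warped.phi σ dr F G) (G2Warped.psi σ dr F G) p S ↔
        S = G2Warped.diagEnd p (G2Warped.derivR dr θ p.2 / G p.2)
              (-(lam * Real.sin (θ p.2) / h p.2))
            - ((h p.2)⁻¹ * (G2Warped.derivR dr h p.2 / G p.2 + lam * Real.cos (θ p.2))) •
              G2Warped.J6 σ p) ∧
    -- the torsion components
    (∀ (τ₁ : ℝ) (τ₇ : TangentSpace G2Warped.I7 p [⋀^Fin 1]→L[ℝ] ℝ)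
        (τ₁₄ : TangentSpace G2Warped.I7 p [⋀^Fin 2]→L[ℝ] ℝ)
        (τ₂₇ : TangentSpace G2Warped.I7 p →L[ℝ] TangentSpace G2Warped.I7 p →L[ℝ] ℝ),
      G2Warped.AreTorsionComponents cov (G2Warped.g7 σ dr F G) (G2Warped.phi σ dr F G)
          (G2Warped.psi σ dr F G) p τ₁ τ₇ τ₁₄ τ₂₇ ↔
        τ₁ = 1 / 7 * (G2Warped.derivR dr θ p.2 / G p.2 - 6 * lam * Real.sin (θ p.2) / h p.2) ∧
        τ₇ = (-((h p.2)⁻¹ * (G2Warped.derivR dr h p.2 / G p.2 + lam * Real.cos (θ p.2)) * G p.2)) •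
          G2Warped.drM dr p ∧
        τ₁₄ = 0 ∧
        ∀ u v, τ₂₇ u v = G2Warped.g7 σ dr F G p
          ((1 / 7 * (G2Warped.derivR dr θ p.2 / G p.2 + lam * Real.sin (θ p.2) / h p.2)) •
            G2Warped.diagEnd p 6 (-1) u) v) := by
  have hh0 : h p.2 ≠ 0 := fun h0 => hF0 p.2 (by rw [hFhθ _ hp, h0]; simp)
  have hr0 : G2Warped.lapse dr G p.2 ≠ 0 :=
    mul_ne_zero (hG0 p.2).ne' (G2Warped.drCoeff_ne_zero p.2 (hdr0 p.2))
  obtain ⟨z, E, hz, hΩ⟩ := σ.exists_unitaryFrame p.1 (θ p.2)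
  have H : G2Warped.IsAdaptedFrame σ dr F G p (h p.2) (θ p.2) z E :=
    ⟨hFhθ _ hp, hh0, hr0, hz, hΩ⟩
  have hcovφ := G2Warped.covDerivForm_phi hσ hdr hG hU hh hθ hFhθ cov hcov p hp hh0 hr0
  have torsion : ∀ S : TangentSpace G2Warped.I7 p →L[ℝ] TangentSpace G2Warped.I7 p,
      G2Warped.IsFullTorsion cov (G2Warped.phi σ dr F G) (G2Warped.psi σ dr F G) p S ↔
        S = G2Warped.diagEnd p (G2Warped.derivR dr θ p.2 / G p.2)
              (-(lam * Real.sin (θ p.2) / h p.2))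
            - ((h p.2)⁻¹ * (G2Warped.derivR dr h p.2 / G p.2 + lam * Real.cos (θ p.2))) •
              G2Warped.J6 σ p :=
    H.isFullTorsion_iff cov hcovφ
  refine ⟨H.isG2Form, H.isHodgeDual, torsion, fun τ₁ τ₇ τ₁₄ τ₂₇ => ?_⟩
  -- the claimed components form a decomposition of the torsion endomorphism; uniqueness of both the
  -- endomorphism and its decomposition gives the converse
  have dec := H.isTorsionDecomposition (G2Warped.derivR dr θ p.2 / G p.2)
    (-(lam * Real.sin (θ p.2) / h p.2))
    ((h p.2)⁻¹ * (G2Warped.derivR dr h p.2 / G p.2 + lam * Real.cos (θ p.2)))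
  have e1 : 1 / 7 * (G2Warped.derivR dr θ p.2 / G p.2 + 6 * -(lam * Real.sin (θ p.2) / h p.2))
      = 1 / 7 * (G2Warped.derivR dr θ p.2 / G p.2 - 6 * lam * Real.sin (θ p.2) / h p.2) := by ring
  have e2 : 1 / 7 * (G2Warped.derivR dr θ p.2 / G p.2 - -(lam * Real.sin (θ p.2) / h p.2))
      = 1 / 7 * (G2Warped.derivR dr θ p.2 / G p.2 + lam * Real.sin (θ p.2) / h p.2) := by ring
  rw [e1, e2] at dec
  constructor
  · rintro ⟨S, hS, hdec⟩
    rw [torsion] at hS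
    subst hS
    obtain ⟨h1, h7, h14, h27⟩ := H.torsionDecomposition_unique hdec dec
    exact ⟨h1, h7, h14, fun u v => (congrArg (fun T => T u v) h27).trans
      (congrArg (fun T => T v) ((G2Warped.g7 σ dr F G p).map_smul _ _)).symm⟩
  · rintro ⟨rfl, rfl, rfl, h27⟩
    have e27 : τ₂₇ = (1 / 7 * (G2Warped.derivR dr θ p.2 / G p.2
        + lam * Real.sin (θ p.2) / h p.2)) •
          (G2Warped.g7 σ dr F G p ∘L G2Warped.diagEnd p 6 (-1)) := by
      refine ContinuousLinearMap.ext fun u => ContinuousLinearMap.ext fun v => (h27 u v).trans ?_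
      exact congrArg (fun T => T v) ((G2Warped.g7 σ dr F G p).map_smul _ _)
    exact ⟨_, (torsion _).2 rfl, e27 ▸ dec⟩
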